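/- **Model.** A dynamic network has $n\ge 2$ nodes with distinct identifiers of $O(\log n)$ bits (identifiers below $n^a$ for a constant $a$). All nodes know a number $N$ with $n\le N\le 2n$, the message size $b$ and the token size $d$. In every synchronous round an adaptive adversary fixes a connected graph on the nodes, depending on all past actions and the current states of the nodes; then each node, using fresh randomness and not knowing its neighbours, chooses a message of $O(b)$ bits, and it receives the messages of its neighbours (anonymous broadcast). In $k$-token dissemination, $k\le n$ distinct tokens, which are $d$-bit strings with $d\le b$, are distributed arbitrarily over the nodes (a token may be at several nodes), and every node has to terminate with the set of all $k$ tokens as its output. **Algorithm `priority-forward`.** Let $L=\lfloor\log_2 N\rfloor+1$, $m=\lfloor b/\max(d,1)\rfloor$ (tokens per block), $s=\min(b,N)$, $m'=\max(1,\lfloor b/L\rfloor)$, $s'=\min(m',N)$, and let $\kappa$ be a constant. * *Coded broadcast* of indexed blocks $B_1,\dots,B_r$: each $B_i$ is a vector over $\mathbb F_2$, prefixed by the $i$-th unit vector; for $\kappa N$ rounds each node sends a uniformly random element of the span of the vectors it has. Then $N$ rounds of flooding determine whether all nodes can decode all $r$ blocks; only in this case the broadcast counts as successful. * *Random forwarding*: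 for $\kappa N$ rounds each node sends a uniformly random set of $m$ of the items it considers (all, if there are fewer). * *Iteration* (for items to be disseminated): each node groups its items into blocks, and gives each block a priority consisting of $8L$ random bits followed by its identifier and the position of the block; some of the blocks are indexed; these are disseminated by coded broadcast, and, if this succeeds, all items in them are removed from consideration at all nodes. Greedy stage: repeat random forwarding of the remaining tokens, and find by flooding a node with the maximal number of remaining tokens; if this number is at least $ms$, that node disseminates $ms$ of its tokens, as $s$ blocks, by coded broadcast and these are removed; otherwise the greedy stage ends. Then repeat iterations on the remaining tokens with blocks of $m$ tokens, in which at most $s$ blocks are indexed recursively: the priorities become items, of which each node considers only the $s$ smallest that it knows; they undergo random forwarding with $m'$ priorities per message, and then one iteration with blocks of $m'$ priorities, in which the blocks with the $s'$ smallest (second-level) priorities are found by flooding; the $s$ smallest of the priorities thereby delivered to all nodes are the selected ones, indexed in increasing order. Before every step the nodes check by $N$ rounds of flooding whether any node still has a remaining token; if not, all nodes terminate and output the tokens broadcast so far. **Theorem.** The constant $\kappa$ can be chosen such that for every $a$ the messages of `priority-forward` have $O(b)$ bits, and for every $c$ there is a constant $C$ such that the following holds for all $n\ge2$, all $b\ge\log^3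 n$, all $d\le b$, $k\le n$, all identifiers, all token distributions and all adaptive adversaries: any node that terminates outputs exactly the set of all $k$ tokens, and with probability at least $1-n^{-c}$ all nodes have terminated after $$C\left(\frac{\log n}{b}\cdot\frac{nkd}{b}+n\log n\right)$$ rounds. (Here $\kappa$ is absolute, the constant in $O(b)$ depends only on $a$, and $C$ only on $a$ and $c$.) -/

import Mathlib

open scoped ENNReal

noncomputable section

/-! ## Dynamic networks -/

/-- Messages are bit strings. -/
abbrev Msg : Type := List Bool

/-- A synchronous randomized anonymous-broadcast protocol; every node runs the same code on its own
input. In each round a node draws, from its current state alone, a message together with the way in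
which the multiset of received messages determines its next state (so the second component carries
the random choices of the round). `output s = some o` means that the node has terminated with
output `o`. -/
structure Protocol (I O : Type) where
  State : Type 1
  init : I → State
  act : State → PMF (Msg × (Multiset Msg → State))
  output : State → Option O

/-- The joint law of independent random variables with laws `f 0, …, f (n - 1)`. -/
def indepLaw {α : Type 1} : (n : ℕ) → (Fin n → PMF α) → PMF (Fin n → α)
  | 0, _ => PMF.pure Fin.elim0
  | n + 1, f => (f 0).bind fun x =>
      (indepLaw n fun i => f i.succ).bind fun xs => PMF.pure (Fin.cons x xs)

namespace Protocol

variable {I O : Type}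

/-- What one node does in one round: the message sent, and the reaction to the received messages. -/
abbrev Action (P : Protocol I O) : Type 1 := Msg × (Multiset Msg → P.State)

/-- The actions of all nodes in all past rounds, latest round first. -/
abbrev History (P : Protocol I O) (n : ℕ) : Type 1 := List (Fin n → P.Action)

/-- An adaptive adversary: the topology of a round is a function of all past actions and of the
current states, fixed before the nodes make the random choices of that round. -/
abbrev Adversary (P : Protocol I O) (n : ℕ) : Type 1 :=
  P.History n → (Fin n → P.State) → SimpleGraph (Fin n)

open Classical in
/-- The messages that node `v` receives: those sent by its neighbours. -/
def received {P : Protocol I O} {n : ℕ} (G : SimpleGraph (Fin n)) (a : Fin n → P.Action)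
    (v : Fin n) : Multiset Msg :=
  (Finset.univ.filter fun u => G.Adj v u).val.map fun u => (a u).1

/-- The law of the history and the states after `t` rounds. -/
def exec (P : Protocol I O) {n : ℕ} (input : Fin n → I) (adv : P.Adversary n) :
    ℕ → PMF (P.History n × (Fin n → P.State))
  | 0 => PMF.pure ([], fun v => P.init (input v))
  | t + 1 => (exec P input adv t).bind fun x =>
      (indepLaw n fun v => P.act (x.2 v)).bind fun a =>
        PMF.pure (a :: x.1, fun v => (a v).2 (received (adv x.1 x.2) a v))

end Protocol

/-! ## A small language for node programs -/

/-- Programs of a node: stop with a value, draw a random value, or spend one round on broadcasting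
a message and receiving the messages of the neighbours. -/
inductive Prog (α : Type) : Type 1
  | done (a : α) : Prog α
  | draw {β : Type} (μ : PMF β) (next : β → Prog α) : Prog α
  | comm (m : Msg) (next : Multiset Msg → Prog α) : Prog α

namespace Prog

def bind {α β : Type} : Prog α → (α → Prog β) → Prog β
  | done a, f => f a
  | draw μ k, f => draw μ fun x => (k x).bind f
  | comm m k, f => comm m fun r => (k r).bind f

instance : Monad Prog where
  pure := done
  bind := bind

def sample {β : Type} (μ : PMF β) : Prog β := draw μ done

/-- `r`-fold repetition. -/
def iter {α : Type} (f : α → Prog α) : ℕ → α → Prog α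
  | 0, a => done a
  | r + 1, a => f a >>= iter f r

section Loop

variable {S O : Type}

/-- At the end of a loop iteration that did not terminate, start the next one. -/
def settle (body : S → Prog (S ⊕ O)) : Prog (S ⊕ O) → Prog (S ⊕ O)
  | done (Sum.inl s) => body s
  | p => p

/-- Perform the pending random draws up to the next broadcast. A terminated program stays
unchanged and sends the empty string. -/
def act (body : S → Prog (S ⊕ O)) :
    Prog (S ⊕ O) → PMF (Msg × (Multiset Msg → Prog (S ⊕ O)))
  | done a => PMF.pure ([], fun _ => settle body (done a))
  | draw μ k => μ.bind fun x => act body (k x)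
  | comm m k => PMF.pure (m, fun r => settle body (k r))

def result : Prog (S ⊕ O) → Option O
  | done (Sum.inr o) => some o
  | _ => none

/-- The protocol in which every node repeats `body` until it returns an output. -/
def loop {I : Type} (start : I → S) (body : S → Prog (S ⊕ O)) : Protocol I O where
  State := Prog (S ⊕ O)
  init i := body (start i)
  act := act body
  output := result

end Loop

/-- Encoding of the elements of a finite type by bit strings of the same, minimal length. -/
def enc {X : Type} [Fintype X] (x : X) : Msg :=
  List.ofFn fun i : Fin (Nat.clog 2 (Fintype.card X)) => (Fintype.equivFin X x).val.testBit i

open Classical in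
def dec (X : Type) [Fintype X] (m : Msg) : Option X :=
  if h : ∃ x : X, enc x = m then some h.choose else none

/-- One round in which every node broadcasts an element of the finite type `X`. -/
def exchange {X : Type} [Fintype X] (x : X) : Prog (Multiset X) :=
  comm (enc x) fun r => done (r.filterMap (dec X))

/-- In each round broadcast the current value and merge the received ones into it. -/
def flood {X : Type} [Fintype X] (rounds : ℕ) (merge : X → Multiset X → X) (x : X) : Prog X :=
  iter (fun x => do
    let r ← exchange x
    return merge x r) rounds x

end Prog

/-! ## Words, packets and blocks -/

/-- `w`-bit strings, read as binary numbers. -/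
abbrev Word (w : ℕ) : Type := Fin (2 ^ w)

/-- The `s` smallest elements of a set of words. -/
def smallest {w : ℕ} (s : ℕ) (A : Finset (Word w)) : Finset (Word w) :=
  ((A.sort (· ≤ ·)).take s).toFinset

/-- Sets of at most `m` words of `w` bits. -/
abbrev Packet (m w : ℕ) : Type := {A : Finset (Word w) // A.card ≤ m}

theorem card_smallest_le {w : ℕ} (s : ℕ) (A : Finset (Word w)) : (smallest s A).card ≤ s :=
  (List.toFinset_card_le _).trans (List.length_take_le _ _)

/-- The packet consisting of the `m` smallest elements of `A` (all of `A` if `A.card ≤ m`). -/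
def packet {w : ℕ} (m : ℕ) (A : Finset (Word w)) : Packet m w :=
  ⟨smallest m A, card_smallest_le m A⟩

/-- The union of the received packets. -/
def unite {m w : ℕ} (r : Multiset (Packet m w)) : Finset (Word w) :=
  (r.map Subtype.val).sup

/-- The elements of `A` in increasing order, cut into blocks of `m` words (the last block may be
shorter). -/
def blocks {w : ℕ} (m : ℕ) (A : Finset (Word w)) : List (List (Word w)) :=
  (List.range ((A.card + m - 1) / m)).map fun i => ((A.sort (· ≤ ·)).drop (i * m)).take m

/-- A word as a vector over `F₂`, preceded by a `1` that marks its presence. -/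
def wordVec {w : ℕ} (x : Word w) : Fin (w + 1) → ZMod 2 :=
  Fin.cons 1 fun i : Fin w => if x.val.testBit i then 1 else 0

/-- A block of at most `m` words as a vector over `F₂`; empty slots are zero. -/
def blockVec {w : ℕ} (m : ℕ) (B : List (Word w)) : Fin m → Fin (w + 1) → ZMod 2 :=
  fun j => match B[j.val]? with
    | some x => wordVec x
    | none => 0

/-- Network coded messages: the coefficients with respect to `s` indexed blocks, and the same
linear combination of these blocks. -/
abbrev Coded (s m w : ℕ) : Type := (Fin s → ZMod 2) × (Fin m → Fin (w + 1) → ZMod 2)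

/-! ## The algorithm -/

/-- What all nodes know: an estimate `N` of the number of nodes, the message size `b`, the token
size `d`, and the constant `a` in the size of the identifiers; and the constant `κ` of the
algorithm. -/
structure Params where
  N : ℕ
  b : ℕ
  d : ℕ
  a : ℕ
  κ : ℕ

namespace Params

variable (P : Params)

/-- The number of binary digits of `N`. -/
def L : ℕ := Nat.log 2 P.N + 1

/-- The number of tokens that fit into a block, `b / d`. -/
def m : ℕ := P.b / max P.d 1

/-- The number of blocks that are broadcast together, `b`; more than `N` are never needed. -/
def s : ℕ := min P.b P.N

/-- The number of priorities that fit into a message, of the order of `b / log n`. -/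
def m' : ℕ := max 1 (P.b / P.L)

/-- The number of blocks of priorities that are broadcast together. -/
def s' : ℕ := min P.m' P.N

/-- The size of a priority: `8 L` random bits, `a L` bits for the identifier of the node and `L`
bits for the position of the block at that node. The last two make all priorities distinct. -/
def w : ℕ := 8 * P.L + P.a * P.L + P.L

/-- Priorities, and other keys of logarithmic size. -/
abbrev Key : Type := Word P.w

def key (x : ℕ) : P.Key := Fin.ofNat (2 ^ P.w) x

end Params

namespace PriorityForward

open Prog

variable (P : Params)

/-- The disjunction of a Boolean over all nodes, by flooding. -/
def anyNode (x : Bool) : Prog Bool :=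
  flood P.N (fun x r => x || decide (true ∈ r)) x

/-- The maximum of a key over all nodes, by flooding. -/
def maxKey (x : P.Key) : Prog P.Key :=
  flood P.N (fun x r => (insert x r.toFinset).max' (Finset.insert_nonempty _ _)) x

/-- A uniformly random set of `min m |A|` elements of `A`. -/
def randomSubset {w : ℕ} (m : ℕ) (A : Finset (Word w)) : PMF (Finset (Word w)) :=
  PMF.uniformOfFinset (A.powersetCard (min m A.card))
    (Finset.powersetCard_nonempty.2 (min_le_right _ _))

/-- Algorithm `random-forward` (without the identification of a node): for `κ N` rounds, each node
forwards `m` random words from those it knows. The function `keep` says which of the known words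
are considered. -/
def randomForward {w : ℕ} (m : ℕ) (keep : Finset (Word w) → Finset (Word w))
    (A : Finset (Word w)) : Prog (Finset (Word w)) :=
  iter (fun A => do
    let B ← sample (randomSubset m A)
    let r ← exchange (packet m B)
    return keep (A ∪ unite r)) (P.κ * P.N) (keep A)

open Classical in
/-- A uniformly random element of a subspace, that is, a random linear combination of any
generating family. -/
def randomVector {s m w : ℕ} (V : Submodule (ZMod 2) (Coded s m w)) : PMF (Coded s m w) :=
  PMF.uniformOfFinset (Finset.univ.filter fun x => x ∈ V) ⟨0, by simp⟩

open Classical in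
/-- The words of block `i` if the node can decode this block from the span `V` of the vectors that
it received. -/
def decoded {s m w : ℕ} (V : Submodule (ZMod 2) (Coded s m w)) (i : Fin s) : Finset (Word w) :=
  Finset.univ.filter fun x => ∃ y, (Pi.single i 1, y) ∈ V ∧ ∃ j, y j = wordVec x

open Classical in
/-- Network coded indexed broadcast of the blocks with indices below `r`, where `own i` is block `i`
if the node has it. The nodes send random linear combinations for `κ N` rounds; then they find out
by flooding whether all of them can decode. If so, the result is the set of all words in these
blocks, and otherwise it is `none`; all nodes get the same result. -/
def indexedBroadcast (s m w r : ℕ) (own : Fin s → Option (List (Word w))) :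
    Prog (Option (Finset (Word w))) := do
  let V ← iter (fun V : Submodule (ZMod 2) (Coded s m w) => do
      let x ← sample (randomVector V)
      let R ← exchange x
      return V ⊔ Submodule.span (ZMod 2) {y | y ∈ R}) (P.κ * P.N)
    (Submodule.span (ZMod 2) {y | ∃ i, ∃ B, own i = some B ∧ y = (Pi.single i 1, blockVec m B)})
  let failed ← anyNode P (decide (¬ ∀ i : Fin s, i.val < r → ∃ y, (Pi.single i 1, y) ∈ V))
  if failed then return none
  else return some ((Finset.univ.filter fun i : Fin s => i.val < r).biUnion (decoded V))

/-- Assign independent random priorities to the blocks of a node. -/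
def assignPriorities {w : ℕ} (uid : ℕ) (bs : List (List (Word w))) :
    Prog (List (P.Key × List (Word w))) :=
  bs.zipIdx.mapM fun B => do
    let ρ ← sample (PMF.uniformOfFintype (Word (8 * P.L)))
    return (P.key ((ρ.val * 2 ^ (P.a * P.L) + uid) * 2 ^ P.L + B.2), B.1)

/-- One iteration of the while loop of `priority-forward` on words of `w` bits: group the words
into blocks of size `m`, assign priorities, index at most `s` blocks by means of `index` (which
returns, at all nodes, the same set of priorities), and broadcast these blocks. The result is the
set of the words that have been broadcast. -/
def iteration (s m w : ℕ) (index : Finset P.Key → Prog (Finset P.Key)) (uid : ℕ)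
    (A : Finset (Word w)) : Prog (Option (Finset (Word w))) := do
  let bs ← assignPriorities P uid (blocks m A)
  let chosen ← index (bs.map Prod.fst).toFinset
  indexedBroadcast P s m w chosen.card fun i =>
    (chosen.sort (· ≤ ·))[i.val]?.bind fun q => (bs.find? fun B => B.1 = q).map Prod.snd

/-- The naive indexing: the smallest `s'` priorities are found by flooding. -/
def floodIndex (K : Finset P.Key) : Prog (Finset P.Key) := do
  let A ← flood P.N (fun A r => packet P.s' (A.1 ∪ unite r)) (packet P.s' K)
  return A.1

/-- The recursive indexing: `priority-forward` is called for the priorities as tokens, where nodes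
consider only the `s` smallest ones that they know. As no node considers more than `s` of them, the
initial greedy stage is a single `random-forward`; it is followed by one iteration of the while loop,
whose `s'` blocks (of priorities) are indexed naively. The smallest `s` of the priorities that this
delivers to all nodes are the selected ones. -/
def recursiveIndex (uid : ℕ) (K : Finset P.Key) : Prog (Finset P.Key) := do
  let A ← randomForward P P.m' (smallest P.s) K
  let R ← iteration P P.s' P.m' P.w (floodIndex P) uid A
  return smallest P.s (R.getD ∅)

/-- The state of a node between iterations: whether the initial greedy stage is still going on,
the known tokens that remain to be broadcast, and those already broadcast to all nodes. -/
structure NodeState where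
  uid : ℕ
  greedy : Bool
  active : Finset (Word P.d)
  finished : Finset (Word P.d)

/-- Remove the broadcast tokens from consideration. -/
def NodeState.remove {P : Params} (σ : NodeState P) (R : Option (Finset (Word P.d))) :
    NodeState P :=
  { σ with active := σ.active \ R.getD ∅, finished := σ.finished ∪ R.getD ∅ }

/-- One iteration of `greedy-forward`, as long as some node gets `m s` (that is, `b² / d`) tokens;
otherwise the greedy stage ends after `random-forward`. -/
def greedyStep (σ : NodeState P) : Prog (NodeState P) := do
  let A ← randomForward P P.m id σ.active
  let σ := { σ with active := A }
  let own := P.key (A.card * 2 ^ (P.a * P.L) + σ.uid)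
  let top ← maxKey P own
  if top.val / 2 ^ (P.a * P.L) < P.m * P.s then
    return { σ with greedy := false }
  else do
    let R ← indexedBroadcast P P.s P.m P.d P.s fun i =>
      if own = top then some ((blocks P.m A)[i.val]?.getD []) else none
    return σ.remove R

/-- One iteration of the while loop of `priority-forward` on the tokens. -/
def priorityStep (σ : NodeState P) : Prog (NodeState P) := do
  let R ← iteration P P.s P.m P.d (recursiveIndex P σ.uid) σ.uid σ.active
  return σ.remove R

/-- Terminate if no node has tokens that remain to be broadcast; otherwise do one more step. -/
def body (σ : NodeState P) : Prog (NodeState P ⊕ Finset (Word P.d)) := do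
  let remain ← anyNode P (decide σ.active.Nonempty)
  if remain then do
    let σ' ← if σ.greedy then greedyStep P σ else priorityStep P σ
    return Sum.inl σ'
  else return Sum.inr σ.finished

end PriorityForward

/-- Algorithm `priority-forward`. The input of a node is its identifier and its set of tokens. -/
def priorityForward (P : Params) : Protocol (ℕ × Finset (Word P.d)) (Finset (Word P.d)) :=
  Prog.loop (fun i => { uid := i.1, greedy := true, active := i.2, finished := ∅ })
    (PriorityForward.body P)

end

/-! The adversary is absorbed into `ev f T p`, the supremum over adaptive adversaries of the
expectation of `f` of the results when the nodes run their programs `p v` and all stop together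
within `T` rounds; outcomes in which they fall out of lockstep or need more rounds count as `⊤`.
This value respects sequencing (`ev_bind`) and potentials controlled round by round (`ev_iter`), so
every subroutine is analysed separately. `failure` is the analogous value for the endless loop. Sure
statements, such as correctness of the output, say that a value is `0`.

Connectivity is used in one way only: an informed set that is neither empty nor everything has an
edge to an uninformed node. Hence the weight `2^(-|D|)` of the informed set `D`, replaced by `0`
when all are informed, at least halves whenever the set grows (`spreadWeight`). In network coding,
each linear form on coefficient vectors has its own set of nodes that know a vector outside its
kernel. A random vector of such a node avoids the kernel with probability at least 1/2, so the
weight shrinks by 3/4 per round in expectation, and a union bound over at most `2^s` forms gives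
`ev_indexedBroadcast`. In random forwarding, many words share the packets. The potential is a
product of factors `1 + α * weight`; Chebyshev's sum inequality for elementary symmetric functions
shows that sampling without replacement does no harm, and one round replaces `α` by `α (1 - p)`
(`ev_randomForward`).

Priorities are lottery tickets. If `c` of `Q` blocks contain a word, a second moment computation
shows that one of them is among the `s` smallest with probability of order `min 1 (s c / Q)`
(`expect_lottery_le`). The `s` smallest priorities must then be found. Forwarding them makes each
one known, with constant probability, to about `n * min m' s / s` nodes. The assumption `b ≥ log³
n`, in the form `s² = O(m'³)`, then makes naive flooding of `s'` second-level priorities sufficient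
to select each of them with constant probability (`ev_recursiveIndex_le`). So an iteration removes a
token with `c` copies with probability at least `2^(-22) * min 1 (s c / Q)`.

The priority stage is measured by the load, the total number of copies of tokens. If at most `s`
tokens are rare, meaning known to fewer than `n / s` nodes, then one iteration removes in
expectation a fraction of order `1 / (1 + k / (m s))` of the load (`progress_of_rare`), and this
persists under removal of tokens. A nonempty load is at least 1, so the expected load bounds the
failure probability (`failure_priority`).

Each greedy step either broadcasts `m s` tokens, with probability at least 1/2, or ends the stage.
The stage ends only if every node has fewer than `m s` tokens, and then forwarding was fast enough
that more than `s` rare tokens survive with probability at most `exp (-n)` (`exists_forwardWeight`,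
`failure_greedy`). For small `n` this error is too large, and the crude rate of order `1 / n²` from
`progress_trivial` is used instead.

With `r = k / (m s) = O(1 + k d / b²)`, there are `O(r + log n)` greedy steps and `O((1 + r) log n)`
iterations, of `O(n)` rounds each, which is the claimed bound (`exists_failure_le`). -/

noncomputable section

set_option linter.unusedSectionVars false

/-! ## Expectations -/

namespace PMF

/-- The expectation of a nonnegative function. -/
def expect {α : Type*} (μ : PMF α) (g : α → ℝ≥0∞) : ℝ≥0∞ := ∑' x, μ x * g x

variable {α β : Type*}

theorem expect_pure (a : α) (g : α → ℝ≥0∞) : (PMF.pure a).expect g = g a := by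
  classical
  rw [expect, tsum_eq_single a (by intro b hb; simp [PMF.pure_apply, hb])]
  simp [PMF.pure_apply]

theorem expect_bind (μ : PMF α) (f : α → PMF β) (g : β → ℝ≥0∞) :
    (μ.bind f).expect g = μ.expect fun x => (f x).expect g := by
  simp only [expect, PMF.bind_apply, ← ENNReal.tsum_mul_right, ← ENNReal.tsum_mul_left]
  rw [ENNReal.tsum_comm]
  simp only [mul_assoc]

theorem expect_map (μ : PMF α) (f : α → β) (g : β → ℝ≥0∞) :
    (μ.map f).expect g = μ.expect fun x => g (f x) := by
  rw [PMF.map, expect_bind]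
  simp [expect_pure]

theorem expect_const (μ : PMF α) (c : ℝ≥0∞) : (μ.expect fun _ => c) = c := by
  rw [expect, ENNReal.tsum_mul_right, μ.tsum_coe, one_mul]

theorem expect_mono_support {μ : PMF α} {g g' : α → ℝ≥0∞} (h : ∀ x, μ x ≠ 0 → g x ≤ g' x) :
    μ.expect g ≤ μ.expect g' := by
  refine ENNReal.tsum_le_tsum fun x => ?_
  by_cases hx : μ x = 0
  · simp [hx]
  · gcongr
    exact h x hx

theorem expect_mono {μ : PMF α} {g g' : α → ℝ≥0∞} (h : ∀ x, g x ≤ g' x) :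
    μ.expect g ≤ μ.expect g' := expect_mono_support fun x _ => h x

theorem expect_add (μ : PMF α) (g g' : α → ℝ≥0∞) :
    (μ.expect fun x => g x + g' x) = μ.expect g + μ.expect g' := by
  simp only [expect, mul_add, ENNReal.tsum_add]

theorem expect_const_mul (μ : PMF α) (c : ℝ≥0∞) (g : α → ℝ≥0∞) :
    (μ.expect fun x => c * g x) = c * μ.expect g := by
  simp only [expect, ← ENNReal.tsum_mul_left, mul_left_comm]

theorem expect_uniformOfFinset (s : Finset α) (hs : s.Nonempty) (g : α → ℝ≥0∞) :
    (PMF.uniformOfFinset s hs).expect g = (s.card : ℝ≥0∞)⁻¹ * ∑ x ∈ s, g x := by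
  rw [expect, tsum_eq_sum (s := s) (by intro x hx; simp [hx]), Finset.mul_sum]
  exact Finset.sum_congr rfl fun x hx => by simp [hx]

theorem expect_uniformOfFintype [Fintype α] [Nonempty α] (g : α → ℝ≥0∞) :
    (PMF.uniformOfFintype α).expect g = (Fintype.card α : ℝ≥0∞)⁻¹ * ∑ x, g x := by
  rw [PMF.uniformOfFintype, expect_uniformOfFinset, Finset.card_univ]

end PMF

/-- The expectation of a function of independent random variables with laws `μ 0, …, μ (n - 1)`. -/
def jointExpect {α : Type*} : (n : ℕ) → (Fin n → PMF α) → ((Fin n → α) → ℝ≥0∞) → ℝ≥0∞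
  | 0, _, g => g Fin.elim0
  | n + 1, μ, g => (μ 0).expect fun x =>
      jointExpect n (fun i => μ i.succ) fun xs => g (Fin.cons x xs)

section jointExpect

variable {α β : Type*}

theorem expect_indepLaw {α : Type 1} (n : ℕ) (μ : Fin n → PMF α) (g : (Fin n → α) → ℝ≥0∞) :
    (indepLaw n μ).expect g = jointExpect n μ g := by
  induction n with
  | zero => simp [indepLaw, jointExpect, PMF.expect_pure]
  | succ n ih => simp [indepLaw, jointExpect, PMF.expect_bind, PMF.expect_pure, ih]

theorem jointExpect_mono_support {n : ℕ} {μ : Fin n → PMF α} {g g' : (Fin n → α) → ℝ≥0∞}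
    (h : ∀ x, (∀ v, μ v (x v) ≠ 0) → g x ≤ g' x) : jointExpect n μ g ≤ jointExpect n μ g' := by
  induction n with
  | zero => exact h _ fun v => v.elim0
  | succ n ih =>
    refine PMF.expect_mono_support fun x hx => ih fun xs hxs => h _ fun v => ?_
    refine Fin.cases ?_ (fun i => ?_) v
    · simpa using hx
    · simpa using hxs i

theorem jointExpect_mono {n : ℕ} {μ : Fin n → PMF α} {g g' : (Fin n → α) → ℝ≥0∞}
    (h : ∀ x, g x ≤ g' x) : jointExpect n μ g ≤ jointExpect n μ g' :=
  jointExpect_mono_support fun x _ => h x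

theorem jointExpect_congr_support {n : ℕ} {μ : Fin n → PMF α} {g g' : (Fin n → α) → ℝ≥0∞}
    (h : ∀ x, (∀ v, μ v (x v) ≠ 0) → g x = g' x) : jointExpect n μ g = jointExpect n μ g' :=
  le_antisymm (jointExpect_mono_support fun x hx => (h x hx).le)
    (jointExpect_mono_support fun x hx => (h x hx).ge)

theorem jointExpect_const {n : ℕ} (μ : Fin n → PMF α) (c : ℝ≥0∞) :
    (jointExpect n μ fun _ => c) = c := by
  induction n with
  | zero => rfl
  | succ n ih => simp [jointExpect, ih, PMF.expect_const]

theorem jointExpect_add {n : ℕ} (μ : Fin n → PMF α) (g g' : (Fin n → α) → ℝ≥0∞) :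
    (jointExpect n μ fun x => g x + g' x) = jointExpect n μ g + jointExpect n μ g' := by
  induction n with
  | zero => rfl
  | succ n ih => simp [jointExpect, ih, PMF.expect_add]

theorem jointExpect_const_mul {n : ℕ} (μ : Fin n → PMF α) (c : ℝ≥0∞)
    (g : (Fin n → α) → ℝ≥0∞) :
    (jointExpect n μ fun x => c * g x) = c * jointExpect n μ g := by
  induction n with
  | zero => rfl
  | succ n ih => simp [jointExpect, ih, PMF.expect_const_mul]

theorem jointExpect_sum {n : ℕ} {ι : Type*} (s : Finset ι) (μ : Fin n → PMF α)
    (g : ι → (Fin n → α) → ℝ≥0∞) :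
    (jointExpect n μ fun x => ∑ i ∈ s, g i x) = ∑ i ∈ s, jointExpect n μ (g i) := by
  classical
  induction s using Finset.induction_on with
  | empty => simpa using jointExpect_const μ 0
  | insert a s ha ih => simp only [Finset.sum_insert ha, jointExpect_add, ih]

theorem jointExpect_pure {n : ℕ} (a : Fin n → α) (g : (Fin n → α) → ℝ≥0∞) :
    jointExpect n (fun v => PMF.pure (a v)) g = g a := by
  induction n with
  | zero => exact congrArg g (Subsingleton.elim _ _)
  | succ n ih =>
    simp only [jointExpect, PMF.expect_pure, ih]
    exact congrArg g (Fin.cons_self_tail a)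

theorem jointExpect_comm_expect {n : ℕ} (μ : Fin n → PMF α) (ν : PMF β)
    (g : β → (Fin n → α) → ℝ≥0∞) :
    (ν.expect fun y => jointExpect n μ (g y)) =
      jointExpect n μ fun x => ν.expect fun y => g y x := by
  induction n with
  | zero => rfl
  | succ n ih =>
    simp only [jointExpect]
    rw [show (ν.expect fun y => (μ 0).expect fun x => jointExpect n (fun i => μ i.succ)
        fun xs => g y (Fin.cons x xs)) = (μ 0).expect fun x => ν.expect fun y =>
          jointExpect n (fun i => μ i.succ) fun xs => g y (Fin.cons x xs) by
      simp only [PMF.expect, ← ENNReal.tsum_mul_left]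
      rw [ENNReal.tsum_comm]
      simp only [mul_left_comm]]
    simp only [ih]

/-- Independence across nodes allows all nodes to make their first draws before any node makes its
second one; this lets two-stage randomness be treated in lockstep. -/
theorem jointExpect_bind {n : ℕ} (μ : Fin n → PMF α) (k : Fin n → α → PMF β)
    (g : (Fin n → β) → ℝ≥0∞) :
    jointExpect n (fun v => (μ v).bind (k v)) g =
      jointExpect n μ fun x => jointExpect n (fun v => k v (x v)) g := by
  induction n with
  | zero => rfl
  | succ n ih =>
    simp only [jointExpect, PMF.expect_bind, ih, Fin.cons_zero, Fin.cons_succ]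
    congr 1
    ext x
    rw [jointExpect_comm_expect]

theorem jointExpect_map {n : ℕ} (μ : Fin n → PMF α) (k : Fin n → α → β)
    (g : (Fin n → β) → ℝ≥0∞) :
    jointExpect n (fun v => (μ v).map (k v)) g =
      jointExpect n μ fun x => g fun v => k v (x v) := by
  simp only [PMF.map]
  rw [jointExpect_bind]
  simp only [Function.comp_apply, jointExpect_pure]

/-- Independence in product form; it factors the potential of random forwarding over the senders. -/
theorem jointExpect_prod {n : ℕ} (μ : Fin n → PMF α) (g : Fin n → α → ℝ≥0∞) :
    (jointExpect n μ fun x => ∏ v, g v (x v)) = ∏ v, (μ v).expect (g v) := by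
  induction n with
  | zero => simp [jointExpect]
  | succ n ih =>
    simp only [jointExpect, Fin.prod_univ_succ, Fin.cons_zero, Fin.cons_succ,
      jointExpect_const_mul, ih fun i => μ i.succ]
    simp only [mul_comm _ (∏ v : Fin n, (μ v.succ).expect (g v.succ)), PMF.expect_const_mul]

theorem jointExpect_apply {n : ℕ} (μ : Fin n → PMF α) (u : Fin n) (g : α → ℝ≥0∞) :
    (jointExpect n μ fun x => g (x u)) = (μ u).expect g := by
  classical
  have := jointExpect_prod μ fun v => if v = u then g else fun _ => 1
  simp only [apply_ite (PMF.expect _), PMF.expect_const, Finset.prod_ite_eq', Finset.mem_univ,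
    if_true] at this
  rw [← this]
  congr 1
  ext x
  rw [Finset.prod_eq_single u] <;> simp +contextual

/-- The passage from a vanishing expectation to a statement about every possible outcome, needed for
the sure correctness of the outputs. -/
theorem eq_zero_of_jointExpect_eq_zero {n : ℕ} {μ : Fin n → PMF α} {g : (Fin n → α) → ℝ≥0∞}
    (h : jointExpect n μ g = 0) (x : Fin n → α) (hx : ∀ v, μ v (x v) ≠ 0) : g x = 0 := by
  induction n with
  | zero => rw [← h]; exact congrArg g (Subsingleton.elim _ _)
  | succ n ih =>
    simp only [jointExpect, PMF.expect, ENNReal.tsum_eq_zero, mul_eq_zero] at h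
    have := ih ((h (x 0)).resolve_left (hx 0)) (fun i => x i.succ) fun v => hx v.succ
    rwa [show (Fin.cons (x 0) fun i => x i.succ : Fin (n + 1) → α) = x from
      Fin.cons_self_tail x] at this

theorem mem_support_indepLaw {α : Type 1} {n : ℕ} {μ : Fin n → PMF α} {x : Fin n → α}
    (hx : x ∈ (indepLaw n μ).support) (v : Fin n) : x v ∈ (μ v).support := by
  induction n with
  | zero => exact v.elim0
  | succ n ih =>
    simp only [indepLaw, PMF.mem_support_bind_iff, PMF.mem_support_pure_iff] at hx
    obtain ⟨y, hy, ys, hys, rfl⟩ := hx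
    refine Fin.cases ?_ (fun i => ?_) v
    · simpa using hy
    · simpa using ih hys i

end jointExpect

/-! ## Demonic expectations of programs that run in lockstep -/

/-- The multiset of the values of the neighbours of `v`. -/
def neighbourValues {n : ℕ} {X : Type*} (G : SimpleGraph (Fin n)) (x : Fin n → X) (v : Fin n) :
    Multiset X :=
  open Classical in (Finset.univ.filter fun u => G.Adj v u).val.map x

/-- Connected topologies. -/
abbrev Topology (n : ℕ) : Type := {G : SimpleGraph (Fin n) // G.Connected}

namespace Prog

theorem bind_def {α β : Type} (p : Prog α) (f : α → Prog β) : p >>= f = p.bind f := rfl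

theorem pure_def {α : Type} (a : α) : (pure a : Prog α) = done a := rfl

theorem bind_done {α : Type} (p : Prog α) : p.bind done = p := by
  induction p with
  | done a => rfl
  | draw μ k ih => simp only [bind, ih]
  | comm m k ih => simp only [bind, ih]

theorem bind_assoc {α β γ : Type} (p : Prog α) (f : α → Prog β) (g : β → Prog γ) :
    (p.bind f).bind g = p.bind fun x => (f x).bind g := by
  induction p with
  | done a => rfl
  | draw μ k ih => simp only [bind, ih]
  | comm m k ih => simp only [bind, ih]

/-- Lawfulness makes `List.mapM_cons` available, by which the list of priority draws is unfolded. -/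
instance : LawfulMonad Prog := LawfulMonad.mk' Prog
  (id_map := fun p => bind_done p)
  (pure_bind := fun _ _ => rfl)
  (bind_assoc := fun p f g => bind_assoc p f g)
  (bind_pure_comp := fun _ _ => rfl)

/-- What a program does next: it stops, or it broadcasts a message and waits for the messages of
the neighbours. -/
abbrev Head (α : Type) : Type 1 := α ⊕ (Msg × (Multiset Msg → Prog α))

/-- Perform the pending random draws. -/
def head {α : Type} : Prog α → PMF (Head α)
  | done a => PMF.pure (Sum.inl a)
  | draw μ k => μ.bind fun x => head (k x)
  | comm m k => PMF.pure (Sum.inr (m, k))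

/-- Continue with `f` after the end of a program. -/
def Head.bind {α β : Type} (f : α → Prog β) : Head α → PMF (Head β)
  | Sum.inl a => head (f a)
  | Sum.inr c => PMF.pure (Sum.inr (c.1, fun r => (c.2 r).bind f))

theorem head_bind {α β : Type} (p : Prog α) (f : α → Prog β) :
    head (p.bind f) = (head p).bind (Head.bind f) := by
  induction p with
  | done a => simp [bind, head, Head.bind]
  | draw μ k ih => simp [bind, head, ih]
  | comm m k ih => simp [bind, head, Head.bind]

variable {n : ℕ} {α β : Type}

open Classical in
/-- Bring the next actions of all nodes together: all nodes stop, all nodes broadcast, or (with the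
value `⊤`) the nodes are not in lockstep. -/
def joinHeads {α β : Type*} (f : (Fin n → α) → ℝ≥0∞) (g : (Fin n → β) → ℝ≥0∞)
    (h : Fin n → α ⊕ β) : ℝ≥0∞ :=
  if H : ∃ a : Fin n → α, h = fun v => Sum.inl (a v) then f H.choose
  else if H : ∃ b : Fin n → β, h = fun v => Sum.inr (b v) then g H.choose
  else ⊤

theorem joinHeads_inl {α β : Type*} (f : (Fin n → α) → ℝ≥0∞) (g : (Fin n → β) → ℝ≥0∞)
    (a : Fin n → α) : joinHeads f g (fun v => Sum.inl (a v)) = f a := by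
  have H : ∃ a' : Fin n → α, (fun v => (Sum.inl (a v) : α ⊕ β)) = fun v => Sum.inl (a' v) :=
    ⟨a, rfl⟩
  rw [joinHeads, dif_pos H]
  congr 1
  ext v
  exact (Sum.inl.inj (congrFun H.choose_spec v)).symm

/-- Without nodes, the empty tuple would count both as stopping and as broadcasting; this is why `n`
is nonzero from here on. -/
theorem joinHeads_inr [NeZero n] {α β : Type*} (f : (Fin n → α) → ℝ≥0∞)
    (g : (Fin n → β) → ℝ≥0∞) (b : Fin n → β) :
    joinHeads f g (fun v => Sum.inr (b v)) = g b := by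
  have H : ∃ b' : Fin n → β, (fun v => (Sum.inr (b v) : α ⊕ β)) = fun v => Sum.inr (b' v) :=
    ⟨b, rfl⟩
  rw [joinHeads, dif_neg, dif_pos H]
  · congr 1
    ext v
    exact (Sum.inr.inj (congrFun H.choose_spec v)).symm
  · rintro ⟨a, ha⟩
    exact absurd (congrFun ha 0) (by simp)

theorem joinHeads_cases [NeZero n] {α β : Type*} (f : (Fin n → α) → ℝ≥0∞)
    (g : (Fin n → β) → ℝ≥0∞) (h : Fin n → α ⊕ β) :
    (∃ a, h = (fun v => Sum.inl (a v)) ∧ joinHeads f g h = f a) ∨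
    (∃ b, h = (fun v => Sum.inr (b v)) ∧ joinHeads f g h = g b) ∨ joinHeads f g h = ⊤ := by
  by_cases H : ∃ a : Fin n → α, h = fun v => Sum.inl (a v)
  · obtain ⟨a, rfl⟩ := H
    exact Or.inl ⟨a, rfl, joinHeads_inl f g a⟩
  by_cases H' : ∃ b : Fin n → β, h = fun v => Sum.inr (b v)
  · obtain ⟨b, rfl⟩ := H'
    exact Or.inr (Or.inl ⟨b, rfl, joinHeads_inr f g b⟩)
  · exact Or.inr (Or.inr (by rw [joinHeads, dif_neg H, dif_neg H']))

theorem joinHeads_eq_top [NeZero n] {α β : Type*} (f : (Fin n → α) → ℝ≥0∞)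
    (g : (Fin n → β) → ℝ≥0∞) (h : Fin n → α ⊕ β) {u v : Fin n} {a : α} {b : β}
    (hu : h u = Sum.inl a) (hv : h v = Sum.inr b) : joinHeads f g h = ⊤ := by
  rcases joinHeads_cases f g h with ⟨a', rfl, -⟩ | ⟨b', rfl, -⟩ | h'
  · cases hv
  · cases hu
  · exact h'

theorem joinHeads_mono [NeZero n] {α β : Type*} {f f' : (Fin n → α) → ℝ≥0∞}
    {g g' : (Fin n → β) → ℝ≥0∞} (hf : ∀ a, f a ≤ f' a) (hg : ∀ b, g b ≤ g' b)
    (h : Fin n → α ⊕ β) : joinHeads f g h ≤ joinHeads f' g' h := by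
  rcases joinHeads_cases f' g' h with ⟨a, rfl, h'⟩ | ⟨b, rfl, h'⟩ | h'
  · rw [h', joinHeads_inl]; exact hf a
  · rw [h', joinHeads_inr]; exact hg b
  · rw [h']; exact le_top

/-- The supremum, over all adaptive adversaries, of the expectation of `f` of the results of the
programs `p v`, which must end simultaneously after at most `T` rounds. -/
def ev (f : (Fin n → α) → ℝ≥0∞) : ℕ → (Fin n → Prog α) → ℝ≥0∞
  | 0, p => jointExpect n (fun v => head (p v)) (joinHeads f fun _ => ⊤)
  | T + 1, p => ⨆ G : Topology n, jointExpect n (fun v => head (p v)) (joinHeads f fun c =>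
      ev f T fun v => (c v).2 (neighbourValues G.1 (fun u => (c u).1) v))

instance [NeZero n] : Nonempty (Topology n) := ⟨⟨⊤, SimpleGraph.connected_top⟩⟩

variable [NeZero n]

theorem ev_mono {f g : (Fin n → α) → ℝ≥0∞} (h : ∀ a, f a ≤ g a) (T : ℕ) (p : Fin n → Prog α) :
    ev f T p ≤ ev g T p := by
  induction T generalizing p with
  | zero => exact jointExpect_mono fun x => joinHeads_mono h (fun _ => le_rfl) x
  | succ T ih =>
    exact iSup_mono fun G => jointExpect_mono fun x => joinHeads_mono h (fun _ => ih _) x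

/-- An additional permitted round can only replace the penalty `⊤` for running out of time by a
smaller value. -/
theorem ev_succ_le (f : (Fin n → α) → ℝ≥0∞) (T : ℕ) (p : Fin n → Prog α) :
    ev f (T + 1) p ≤ ev f T p := by
  induction T generalizing p with
  | zero =>
    exact iSup_le fun G => jointExpect_mono fun x =>
      joinHeads_mono (fun _ => le_rfl) (fun _ => le_top) x
  | succ T ih =>
    exact iSup_mono fun G => jointExpect_mono fun x =>
      joinHeads_mono (fun _ => le_rfl) (fun _ => ih _) x

theorem ev_antitone (f : (Fin n → α) → ℝ≥0∞) (p : Fin n → Prog α) :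
    Antitone fun T => ev f T p :=
  antitone_nat_of_succ_le fun T => ev_succ_le f T p

theorem ev_done (f : (Fin n → α) → ℝ≥0∞) (T : ℕ) (a : Fin n → α) :
    ev f T (fun v => done (a v)) = f a := by
  cases T <;> simp [ev, head, jointExpect_pure, joinHeads_inl]

/-- Only an inequality: the two summands on the right may be maximised by different adversaries. -/
theorem ev_add (f g : (Fin n → α) → ℝ≥0∞) (T : ℕ) (p : Fin n → Prog α) :
    ev (fun a => f a + g a) T p ≤ ev f T p + ev g T p := by
  have key : ∀ (F F' F'' : (Fin n → Msg × (Multiset Msg → Prog α)) → ℝ≥0∞)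
      (_ : ∀ c, F c ≤ F' c + F'' c) (x : Fin n → Head α),
      joinHeads (fun a => f a + g a) F x ≤ joinHeads f F' x + joinHeads g F'' x := by
    intro F F' F'' hF x
    rcases joinHeads_cases f F' x with ⟨a, rfl, h'⟩ | ⟨b, rfl, h'⟩ | h'
    · simp only [joinHeads_inl, le_refl]
    · simp only [joinHeads_inr]; exact hF b
    · rw [h', top_add]; exact le_top
  induction T generalizing p with
  | zero =>
    simp only [ev]
    rw [← jointExpect_add]
    exact jointExpect_mono (key _ _ _ fun _ => by simp)
  | succ T ih =>
    refine iSup_le fun G => ?_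
    refine le_trans ?_ (add_le_add (le_iSup _ G) (le_iSup _ G))
    rw [← jointExpect_add]
    exact jointExpect_mono (key _ _ _ fun _ => ih _)

/-- The factor must be nonzero because `0 * ⊤ = 0` would erase the penalty for leaving lockstep. -/
theorem ev_const_mul {c : ℝ≥0∞} (hc : c ≠ 0) (f : (Fin n → α) → ℝ≥0∞) (T : ℕ)
    (p : Fin n → Prog α) : ev (fun a => c * f a) T p ≤ c * ev f T p := by
  have key : ∀ (F F' : (Fin n → Msg × (Multiset Msg → Prog α)) → ℝ≥0∞)
      (_ : ∀ x, F x ≤ c * F' x) (x : Fin n → Head α),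
      joinHeads (fun a => c * f a) F x ≤ c * joinHeads f F' x := by
    intro F F' hF x
    rcases joinHeads_cases f F' x with ⟨a, rfl, h'⟩ | ⟨b, rfl, h'⟩ | h'
    · simp only [joinHeads_inl, le_refl]
    · simp only [joinHeads_inr]; exact hF b
    · rw [h', ENNReal.mul_top hc]; exact le_top
  induction T generalizing p with
  | zero =>
    simp only [ev]
    rw [← jointExpect_const_mul]
    exact jointExpect_mono (key _ _ fun _ => by simp [ENNReal.mul_top hc])
  | succ T ih =>
    refine iSup_le fun G => ?_
    refine le_trans ?_ (mul_le_mul_right (le_iSup _ G) c)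
    rw [← jointExpect_const_mul]
    exact jointExpect_mono (key _ _ fun _ => ih _)

/-- Sequential composition. -/
theorem ev_bind (f : (Fin n → β) → ℝ≥0∞) (T T' : ℕ) (p : Fin n → Prog α)
    (k : Fin n → α → Prog β) :
    ev f (T + T') (fun v => p v >>= k v) ≤ ev (fun a => ev f T' fun v => k v (a v)) T p := by
  simp only [bind_def]
  -- One round of the composite, for a fixed graph. `h₁` covers nodes that stop within `p` before
  -- broadcasting and pass on to `k`; `h₂` covers a broadcast that still belongs to `p`.
  have key : ∀ (p : Fin n → Prog α) (F : (Fin n → Msg × (Multiset Msg → Prog β)) → ℝ≥0∞)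
      (F' : (Fin n → Msg × (Multiset Msg → Prog α)) → ℝ≥0∞)
      (_ : ∀ q : Fin n → Prog β, jointExpect n (fun v => head (q v)) (joinHeads f F) ≤ ev f T' q)
      (_ : ∀ c, F (fun v => ((c v).1, fun r => ((c v).2 r).bind (k v))) ≤ F' c),
      jointExpect n (fun v => head ((p v).bind (k v))) (joinHeads f F) ≤
        jointExpect n (fun v => head (p v))
          (joinHeads (fun a => ev f T' fun v => k v (a v)) F') := by
    intro p F F' h₁ h₂
    simp only [head_bind]
    rw [jointExpect_bind]
    refine jointExpect_mono fun x => ?_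
    rcases joinHeads_cases (fun a => ev f T' fun v => k v (a v)) F' x with
      ⟨a, rfl, h'⟩ | ⟨b, rfl, h'⟩ | h'
    · rw [h']
      exact h₁ _
    · rw [h']
      simp only [Head.bind, jointExpect_pure, joinHeads_inr]
      exact h₂ b
    · rw [h']; exact le_top
  induction T generalizing p with
  | zero =>
    rw [zero_add]
    cases T' with
    | zero => exact key _ _ _ (fun _ => le_rfl) fun _ => le_rfl
    | succ T' =>
      refine iSup_le fun G => key _ _ _ (fun q => ?_) fun _ => le_top
      exact le_iSup (fun G : Topology n => jointExpect n (fun v => head (q v)) (joinHeads f fun c =>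
        ev f T' fun v => (c v).2 (neighbourValues G.1 (fun u => (c u).1) v))) G
  | succ T ih =>
    rw [show T + 1 + T' = (T + T') + 1 by omega]
    refine iSup_le fun G => le_trans ?_ (le_iSup _ G)
    refine key _ _ _ (fun q => ?_) fun c => ?_
    · refine le_trans ?_ (ev_antitone f q (show T' ≤ T + T' + 1 by omega))
      exact le_iSup (fun G : Topology n => jointExpect n (fun v => head (q v)) (joinHeads f fun c =>
        ev f (T + T') fun v => (c v).2 (neighbourValues G.1 (fun u => (c u).1) v))) G
    · exact ih _

end Prog

/-! ### Encoded broadcasts, single rounds and repetition -/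

namespace Prog

variable {n : ℕ} {α : Type}

theorem enc_injective {X : Type} [Fintype X] : Function.Injective (enc : X → Msg) := by
  intro x y h
  have h' := List.ofFn_injective h
  apply (Fintype.equivFin X).injective
  apply Fin.ext
  have hlt : ∀ z : X, (Fintype.equivFin X z).val < 2 ^ Nat.clog 2 (Fintype.card X) := fun z =>
    (Fintype.equivFin X z).isLt.trans_le (Nat.le_pow_clog one_lt_two _)
  refine Nat.eq_of_testBit_eq fun i => ?_
  by_cases hi : i < Nat.clog 2 (Fintype.card X)
  · exact congrFun h' ⟨i, hi⟩
  · have := Nat.pow_le_pow_right (n := 2) (by norm_num) (not_lt.1 hi)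
    rw [Nat.testBit_lt_two_pow ((hlt x).trans_le this),
      Nat.testBit_lt_two_pow ((hlt y).trans_le this)]

theorem dec_enc {X : Type} [Fintype X] (x : X) : dec X (enc x) = some x := by
  have h : ∃ y : X, enc y = enc x := ⟨x, rfl⟩
  rw [dec, dif_pos h, enc_injective h.choose_spec]

theorem filterMap_dec_neighbourValues {X : Type} [Fintype X] (G : SimpleGraph (Fin n))
    (x : Fin n → X) (v : Fin n) :
    (neighbourValues G (fun u => enc (x u)) v).filterMap (dec X) = neighbourValues G x v := by
  classical
  simp only [neighbourValues]
  rw [Multiset.filterMap_map, show dec X ∘ (fun u => enc (x u)) = some ∘ x from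
    funext fun u => dec_enc (x u), ← Multiset.filterMap_map, Multiset.filterMap_some]

variable [NeZero n]

/-- One round in which every node draws a random value and broadcasts a function of it. -/
theorem ev_sample_exchange {X Y : Type} [Fintype X] (f : (Fin n → α) → ℝ≥0∞)
    (μ : Fin n → PMF Y) (x : Fin n → Y → X) (h : Fin n → Y → Multiset X → α) :
    ev f 1 (fun v => sample (μ v) >>= fun y => exchange (x v y) >>= fun r => pure (h v y r)) =
      ⨆ G : Topology n, jointExpect n μ fun y =>
        f fun v => h v (y v) (neighbourValues G.1 (fun u => x u (y u)) v) := by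
  have hh : ∀ v, head (sample (μ v) >>= fun y => exchange (x v y) >>= fun r => pure (h v y r)) =
      (μ v).map fun y => Sum.inr (enc (x v y), fun r => done (h v y (r.filterMap (dec X)))) := by
    intro v
    simp only [bind_def, pure_def, sample, exchange, bind, head, PMF.map]
    rfl
  simp only [ev, hh]
  refine iSup_congr fun G => ?_
  rw [jointExpect_map]
  refine congrArg _ (funext fun y => ?_)
  simp only [joinHeads_inr, head, jointExpect_pure, joinHeads_inl, filterMap_dec_neighbourValues]

theorem ev_exchange {X : Type} [Fintype X] (f : (Fin n → α) → ℝ≥0∞)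
    (x : Fin n → X) (h : Fin n → Multiset X → α) :
    ev f 1 (fun v => exchange (x v) >>= fun r => pure (h v r)) =
      ⨆ G : Topology n, f fun v => h v (neighbourValues G.1 x v) := by
  simp only [ev, bind_def, pure_def, exchange, bind, head, jointExpect_pure, joinHeads_inr,
    joinHeads_inl, filterMap_dec_neighbourValues]

/-- The potential method: `g r` bounds the value when `r` repetitions remain, so the index of `g`
counts backwards in time and `g 0` is the payoff. -/
theorem ev_iter (g : ℕ → (Fin n → α) → ℝ≥0∞) (step : Fin n → α → Prog α)
    (h : ∀ r a, ev (g r) 1 (fun v => step v (a v)) ≤ g (r + 1) a) (R : ℕ) (a : Fin n → α) :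
    ev (g 0) R (fun v => iter (step v) R (a v)) ≤ g R a := by
  have key : ∀ R a, ev (g 0) R (fun v => iter (step v) R (a v)) ≤ g R a := by
    intro R
    induction R with
    | zero => intro a; simp only [iter, ev_done, le_refl]
    | succ R ih =>
      intro a
      simp only [iter]
      rw [add_comm R 1]
      refine (ev_bind _ _ _ _ _).trans ((ev_mono (fun b => ih b) _ _).trans ?_)
      rw [add_comm 1 R]
      exact h R a
  exact key R a

/-! ### Flooding -/

/-- The only consequence of connectivity used anywhere: a path from inside `D` to outside crosses
the boundary. The uninformed node `v` is about to hear the informed node `u`. -/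
theorem exists_adj_of_connected {G : SimpleGraph (Fin n)} (hG : G.Connected) {D : Set (Fin n)}
    (hD : D.Nonempty) (hD' : D ≠ Set.univ) : ∃ v u, v ∉ D ∧ u ∈ D ∧ G.Adj v u := by
  obtain ⟨u, hu⟩ := hD
  obtain ⟨v, hv⟩ := (Set.ne_univ_iff_exists_notMem D).1 hD'
  obtain ⟨w⟩ := hG.preconnected u v
  obtain ⟨d, -, h₁, h₂⟩ := w.exists_boundary_dart D hu hv
  exact ⟨d.snd, d.fst, h₂, h₁, d.adj.symm⟩

/-- After at least `n` rounds of flooding, all nodes know the aggregate of all values. -/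
theorem ev_flood {X : Type} [Fintype X] (f : (Fin n → X) → ℝ≥0∞) {N : ℕ} (hN : n ≤ N)
    (merge : X → Multiset X → X) (x : Fin n → X) (agg : Finset (Fin n) → X)
    (h₁ : ∀ v, agg {v} = x v)
    (h₂ : ∀ (K₀ : Finset (Fin n)) (S : Finset (Fin n)) (K : Fin n → Finset (Fin n)),
      K₀.Nonempty → (∀ u, (K u).Nonempty) →
      merge (agg K₀) (S.val.map fun u => agg (K u)) = agg (K₀ ∪ S.biUnion K)) :
    ev f N (fun v => flood N merge (x v)) ≤ f fun _ => agg Finset.univ := by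
  classical
  -- `K v` is the set of nodes whose values have reached `v`. For each origin `u`, the number of
  -- nodes reached plus the number of remaining rounds never drops below `n`, since a nonfull
  -- reached set gains a node in every round.
  have key : ∀ (R : ℕ) (K : Fin n → Finset (Fin n)), (∀ u, u ∈ K u) →
      (∀ u, n ≤ (Finset.univ.filter fun v => u ∈ K v).card + R) →
      ev f R (fun v => flood R merge (agg (K v))) ≤ f fun _ => agg Finset.univ := by
    intro R
    induction R with
    | zero =>
      intro K _ hK
      have : ∀ v, K v = Finset.univ := by
        intro v
        refine Finset.eq_univ_iff_forall.2 fun u => ?_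
        have hu : (Finset.univ.filter fun v => u ∈ K v) = Finset.univ :=
          (Finset.card_eq_iff_eq_univ _).1
            (le_antisymm (Finset.card_le_univ _) (by simpa using hK u))
        have := Finset.mem_univ v
        rw [← hu] at this
        exact (Finset.mem_filter.1 this).2
      simp only [flood, iter, ev_done, this, le_refl]
    | succ R ih =>
      intro K hself hK
      simp only [flood, iter]
      rw [add_comm R 1]
      refine (ev_bind _ _ _ _ _).trans ?_
      rw [ev_exchange]
      refine iSup_le fun G => ?_
      have : (fun v => merge (agg (K v)) (neighbourValues G.1 (fun u => agg (K u)) v)) = fun v =>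
          agg (K v ∪ (Finset.univ.filter fun u => G.1.Adj v u).biUnion K) := by
        funext v
        rw [← h₂ _ _ _ ⟨v, hself v⟩ fun u => ⟨u, hself u⟩]
        rw [neighbourValues]
      rw [this]
      refine ih _ (fun u => Finset.mem_union_left _ (hself u)) fun u => ?_
      set D := Finset.univ.filter fun v => u ∈ K v with hD
      set D' := Finset.univ.filter fun v =>
        u ∈ K v ∪ (Finset.univ.filter fun u => G.1.Adj v u).biUnion K with hD'
      have hsub : D ⊆ D' := by
        intro v hv
        simp only [hD, hD', Finset.mem_filter, Finset.mem_univ, true_and, Finset.mem_union] at hv ⊢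
        exact Or.inl hv
      have hDn : n ≤ D.card + (R + 1) := by convert hK u
      by_cases hfull : D = Finset.univ
      · have : D' = Finset.univ := Finset.univ_subset_iff.1 (hfull ▸ hsub)
        change n ≤ D'.card + R
        rw [this]; simp
      · obtain ⟨v, w, hv, hw, hvw⟩ := exists_adj_of_connected G.2 (D := (D : Set (Fin n)))
          ⟨u, by simp [hD, hself]⟩ (by rwa [Ne, ← Finset.coe_univ, Finset.coe_inj])
        have hv' : v ∈ D' := by
          simp only [hD', Finset.mem_filter, Finset.mem_univ, true_and, Finset.mem_union,
            Finset.mem_biUnion]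
          exact Or.inr ⟨w, hvw, by simpa [hD] using hw⟩
        have := Finset.card_lt_card (Finset.ssubset_iff_subset_ne.2
          ⟨hsub, fun h => hv (by rw [h]; exact hv')⟩)
        change n ≤ D'.card + R
        omega
  have := key N (fun v => {v}) (by simp) fun u => by omega
  simpa only [h₁] using this

/-! ### Loops -/

section Loop

variable {S O : Type}

/-- The action in a loop that corresponds to a head. -/
def Head.act (body : S → Prog (S ⊕ O)) :
    Head (S ⊕ O) → Msg × (Multiset Msg → Prog (S ⊕ O))
  | Sum.inl a => ([], fun _ => settle body (done a))
  | Sum.inr c => (c.1, fun r => settle body (c.2 r))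

theorem act_eq_map_head (body : S → Prog (S ⊕ O)) (p : Prog (S ⊕ O)) :
    act body p = (head p).map (Head.act body) := by
  induction p with
  | done a => simp [act, head, PMF.pure_map, Head.act]
  | draw μ k ih => simp [act, head, ih, PMF.map_bind]
  | comm m k ih => simp [act, head, PMF.pure_map, Head.act]

/-- The program broadcasts at least once, and never draws right before it ends. -/
def Guarded {α : Type} : Prog α → Prop
  | done _ => False
  | draw _ k => ∀ x, Guarded (k x)
  | comm _ k => ∀ r, (∃ a, k r = done a) ∨ Guarded (k r)

/-- The program never draws right before it ends. -/
def Tight {α : Type} (p : Prog α) : Prop := (∃ a, p = done a) ∨ Guarded p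

theorem tight_done {α : Type} (a : α) : Tight (done a) := Or.inl ⟨a, rfl⟩

theorem guarded_bind_of_guarded_right {α β : Type} (p : Prog α) {k : α → Prog β}
    (hk : ∀ a, Guarded (k a)) : Guarded (p >>= k) := by
  induction p with
  | done a => exact hk a
  | draw μ q ih => exact fun x => ih x
  | comm m q ih => exact fun r => Or.inr (ih r)

theorem guarded_bind_of_guarded_left {α β : Type} {p : Prog α} (hp : Guarded p) {k : α → Prog β}
    (hk : ∀ a, Tight (k a)) : Guarded (p >>= k) := by
  induction p with
  | done a => exact hp.elim
  | draw μ q ih => exact fun x => ih x (hp x)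
  | comm m q ih =>
    intro r
    rcases hp r with ⟨a, ha⟩ | h
    · change (∃ b, (q r).bind k = done b) ∨ Guarded ((q r).bind k)
      rw [ha]
      exact hk a
    · exact Or.inr (ih r h)

theorem guarded_flood {X : Type} [Fintype X] {N : ℕ} (hN : N ≠ 0) (merge : X → Multiset X → X)
    (x : X) : Guarded (flood N merge x) := by
  have : ∀ N x, Tight (flood N merge x) := by
    intro N
    induction N with
    | zero => exact fun x => tight_done x
    | succ N ih =>
      intro x
      exact Or.inr fun r => ih _
  obtain ⟨N, rfl⟩ := Nat.exists_eq_succ_of_ne_zero hN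
  exact fun r => this N _

theorem exists_inr_of_guarded {α : Type} {p : Prog α} (hp : Guarded p) {h : Head α}
    (hh : head p h ≠ 0) : ∃ c, h = Sum.inr c ∧ ∀ r, Tight (c.2 r) := by
  induction p with
  | done a => exact hp.elim
  | draw μ q ih =>
    obtain ⟨x, -, hx⟩ := (PMF.mem_support_bind_iff _ _ _).1 ((PMF.mem_support_iff _ _).2 hh)
    exact ih x (hp x) hx
  | comm m q ih =>
    have := (PMF.mem_support_pure_iff _ _).1 ((PMF.mem_support_iff _ _).2 hh)
    exact ⟨_, this, hp⟩

theorem settle_of_guarded (body : S → Prog (S ⊕ O)) {p : Prog (S ⊕ O)} (hp : Guarded p) :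
    settle body p = p := by
  cases p with
  | done a => exact hp.elim
  | draw μ k => rfl
  | comm m k => rfl

/-- The supremum, over all adversaries, of the probability that after `t` more rounds some node has
not terminated. -/
def failure (body : S → Prog (S ⊕ O)) : ℕ → (Fin n → Prog (S ⊕ O)) → ℝ≥0∞
  | 0, q => open Classical in if ∀ v, (result (q v)).isSome then 0 else 1
  | t + 1, q => ⨆ G : Topology n, jointExpect n (fun v => act body (q v)) fun a =>
      failure body t fun v => (a v).2 (neighbourValues G.1 (fun u => (a u).1) v)

variable (body : S → Prog (S ⊕ O))

theorem failure_le_one (t : ℕ) (q : Fin n → Prog (S ⊕ O)) : failure body t q ≤ 1 := by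
  induction t generalizing q with
  | zero => simp only [failure]; split_ifs <;> simp
  | succ t ih =>
    exact iSup_le fun G => (jointExpect_mono fun a => ih _).trans (jointExpect_const _ _).le

theorem failure_done (t : ℕ) (o : Fin n → O) :
    failure body t (fun v => done (Sum.inr (o v))) = 0 := by
  induction t with
  | zero => simp [failure, result]
  | succ t ih => simp [failure, act, jointExpect_pure, settle, ih]

theorem failure_succ_le (t : ℕ) (q : Fin n → Prog (S ⊕ O)) :
    failure body (t + 1) q ≤ failure body t q := by
  induction t generalizing q with
  | zero =>
    by_cases h : ∀ v, (result (q v)).isSome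
    · have : ∃ o : Fin n → O, q = fun v => done (Sum.inr (o v)) := by
        have : ∀ v, ∃ o, q v = done (Sum.inr o) := by
          intro v
          have := h v
          cases hq : q v with
          | done a =>
            cases a with
            | inl s => simp [hq, result] at this
            | inr o => exact ⟨o, rfl⟩
          | draw μ k => simp [hq, result] at this
          | comm m k => simp [hq, result] at this
        choose o ho using this
        exact ⟨o, funext ho⟩
      obtain ⟨o, rfl⟩ := this
      rw [failure_done]
      exact zero_le
    · exact (failure_le_one _ _ _).trans (by simp [failure, h])
  | succ t ih => exact iSup_mono fun G => jointExpect_mono fun a => ih _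

theorem failure_antitone (q : Fin n → Prog (S ⊕ O)) : Antitone fun t => failure body t q :=
  antitone_nat_of_succ_le fun t => failure_succ_le body t q

theorem all_done_or_exists_guarded {α : Type} {p : Fin n → Prog α} (hp : ∀ v, Tight (p v)) :
    (∃ a : Fin n → α, p = fun v => done (a v)) ∨ ∃ u, Guarded (p u) := by
  by_contra hcon
  push Not at hcon
  choose a ha using fun v => (hp v).resolve_right (hcon.2 v)
  exact hcon.1 a (funext ha)

/-- The bridge from a loop to its body: one execution of the body is evaluated by `ev`, with payoff
the failure value of the next iteration at common states, `0` at common outputs and `⊤` if the nodes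
disagree on whether to stop. A body that ends early leaves more than `t` rounds, which is harmless
by `failure_antitone`. -/
theorem failure_settle_le (t T : ℕ) (p : Fin n → Prog (S ⊕ O)) (hp : ∀ v, Tight (p v)) :
    failure body (T + t) (fun v => settle body (p v)) ≤
      ev (joinHeads (fun s => failure body t fun v => body (s v)) fun _ => 0) T p := by
  have hdone : ∀ (T : ℕ) (a : Fin n → S ⊕ O),
      failure body (T + t) (fun v => settle body (done (a v))) ≤
        ev (joinHeads (fun s => failure body t fun v => body (s v)) fun _ => 0) T
          fun v => done (a v) := by
    intro T a
    rw [ev_done]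
    rcases joinHeads_cases (fun s => failure body t fun v => body (s v))
      (fun _ : Fin n → O => 0) a with ⟨s, rfl, h⟩ | ⟨o, rfl, h⟩ | h
    · rw [h]
      exact failure_antitone body _ (Nat.le_add_left t T)
    · rw [h]
      exact (failure_done body _ o).le
    · rw [h]; exact le_top
  induction T generalizing p with
  | zero =>
    rcases all_done_or_exists_guarded hp with ⟨a, rfl⟩ | ⟨u, hu⟩
    · exact hdone 0 a
    refine le_top.trans_eq (Eq.symm ?_)
    rw [ev]
    refine (jointExpect_congr_support fun x hx => ?_).trans
      (jointExpect_const (fun v => head (p v)) ⊤)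
    obtain ⟨c, hc, -⟩ := exists_inr_of_guarded hu (hx u)
    rcases joinHeads_cases (joinHeads (fun s => failure body t fun v => body (s v)) fun _ => 0)
      (fun _ : Fin n → Msg × (Multiset Msg → Prog (S ⊕ O)) => ⊤) x with
      ⟨a, rfl, h⟩ | ⟨b, rfl, h⟩ | h
    · cases hc
    · rw [h]
    · exact h
  | succ T ih =>
    rcases all_done_or_exists_guarded hp with ⟨a, rfl⟩ | ⟨u, hu⟩
    · exact hdone (T + 1) a
    rw [show T + 1 + t = (T + t) + 1 by omega]
    refine iSup_mono fun G => ?_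
    by_cases hall : ∀ v, Guarded (p v)
    · simp only [settle_of_guarded body (hall _), act_eq_map_head]
      rw [jointExpect_map]
      refine jointExpect_mono_support fun x hx => ?_
      choose c hc hc' using fun v => exists_inr_of_guarded (hall v) (hx v)
      obtain rfl : x = fun v => Sum.inr (c v) := funext hc
      rw [joinHeads_inr]
      exact ih _ fun v => hc' v _
    -- Node `w` has ended while node `u` still has to broadcast: the nodes are out of lockstep and
    -- the right-hand side is `⊤`.
    · obtain ⟨w, hw⟩ := not_forall.1 hall
      obtain ⟨a, ha⟩ := (hp w).resolve_right hw
      refine le_top.trans_eq (Eq.symm ?_)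
      refine (jointExpect_congr_support fun x hx => ?_).trans
        (jointExpect_const (fun v => head (p v)) ⊤)
      obtain ⟨c, hc, -⟩ := exists_inr_of_guarded hu (hx u)
      have hx' := hx w
      rw [ha] at hx'
      have := (PMF.mem_support_pure_iff _ _).1 ((PMF.mem_support_iff _ _).2 hx')
      exact joinHeads_eq_top _ _ _ this hc

end Loop

end Prog

/-! ### From demonic values to actual executions -/

namespace Prog

variable {n : ℕ} {I S O : Type} (start : I → S) (body : S → Prog (S ⊕ O))

/-- The probability of not having terminated is at most the demonic one. -/
theorem exec_loop_le_failure (input : Fin n → I) (adv : (loop start body).Adversary n)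
    (hadv : ∀ h σ, (adv h σ).Connected) (t : ℕ) :
    ((loop start body).exec input adv t).toOuterMeasure
      {x | ¬ ∀ v, ((loop start body).output (x.2 v)).isSome} ≤
      failure body t fun v => body (start (input v)) := by
  classical
  -- The last `r` rounds are played by the worst adversary and the first `t` by the given one.
  -- Moving one round across the border replaces the graph chosen by `adv` by a supremum.
  have key : ∀ t r, (((loop start body).exec input adv t).expect fun x =>
      failure body r x.2) ≤ failure body (t + r) fun v => body (start (input v)) := by
    intro t
    induction t with
    | zero =>
      intro r
      rw [Protocol.exec, PMF.expect_pure, zero_add]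
      exact le_rfl
    | succ t ih =>
      intro r
      rw [Protocol.exec, PMF.expect_bind, show t + 1 + r = t + (r + 1) by omega]
      refine le_trans (PMF.expect_mono fun x => ?_) (ih (r + 1))
      rw [PMF.expect_bind, expect_indepLaw]
      simp only [PMF.expect_pure]
      exact le_iSup (fun G : Topology n => jointExpect n (fun v => act body (x.2 v)) fun a =>
        failure body r fun v => (a v).2 (neighbourValues G.1 (fun u => (a u).1) v))
        ⟨adv x.1 x.2, hadv _ _⟩
  refine le_trans (le_of_eq ?_) (key t 0)
  rw [PMF.toOuterMeasure_apply, PMF.expect]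
  refine tsum_congr fun x => ?_
  by_cases hx : ∀ v, (result (x.2 v)).isSome
  · have : x ∉ {x : (loop start body).History n × (Fin n → (loop start body).State) |
        ¬ ∀ v, ((loop start body).output (x.2 v)).isSome} := fun h => h hx
    rw [Set.indicator_of_notMem this]
    simp [failure, hx]
  · have : x ∈ {x : (loop start body).History n × (Fin n → (loop start body).State) |
        ¬ ∀ v, ((loop start body).output (x.2 v)).isSome} := hx
    rw [Set.indicator_of_mem this]
    simp [failure, hx]

/-- If every execution of the body leads from `inv` to `inv` or to a good output at all nodes, then
all outputs are good. -/
theorem output_of_mem_support_exec [NeZero n] (inv : (Fin n → S) → Prop) (good : O → Prop) (T : ℕ)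
    (F : (Fin n → S ⊕ O) → ℝ≥0∞)
    (hF : ∀ a, F a = 0 → (∃ s : Fin n → S, a = (fun v => Sum.inl (s v)) ∧ inv s) ∨
      ∃ o : Fin n → O, a = (fun v => Sum.inr (o v)) ∧ ∀ v, good (o v))
    (hbody : ∀ s, inv s → ev F T (fun v => body (s v)) = 0)
    (hguard : ∀ s, Guarded (body s))
    (input : Fin n → I) (hinput : inv fun v => start (input v))
    (adv : (loop start body).Adversary n) (hadv : ∀ h σ, (adv h σ).Connected) (t : ℕ)
    (x : (loop start body).History n × (Fin n → (loop start body).State))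
    (hx : x ∈ ((loop start body).exec input adv t).support) (v : Fin n) (o : O)
    (ho : (loop start body).output (x.2 v) = some o) : good o := by
  -- The invariant of the running programs: all have stopped with good outputs, or the demonic value
  -- of a bad end of the current body is `0`. The budget `T + 1` ensures that this value is a
  -- supremum over graphs.
  let J : (Fin n → Prog (S ⊕ O)) → Prop := fun q =>
    (∃ o : Fin n → O, q = (fun v => done (Sum.inr (o v))) ∧ ∀ v, good (o v)) ∨
      ∃ T, (∀ v, Guarded (q v)) ∧ ev F (T + 1) q = 0
  have hev : ∀ T p, ev F T p = 0 → ev F (T + 1) p = 0 := fun T p h =>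
    le_antisymm ((ev_succ_le F T p).trans h.le) zero_le
  have hsettle : ∀ T (p : Fin n → Prog (S ⊕ O)), (∀ v, Tight (p v)) → ev F T p = 0 →
      J fun v => settle body (p v) := by
    intro T' p ht h0
    rcases all_done_or_exists_guarded ht with ⟨a, rfl⟩ | ⟨u, hu⟩
    · rw [ev_done] at h0
      rcases hF a h0 with ⟨s, rfl, hs⟩ | ⟨o, rfl, ho⟩
      · exact Or.inr ⟨T, fun v => hguard (s v), hev _ _ (hbody s hs)⟩
      · exact Or.inl ⟨o, rfl, ho⟩
    · have hg : ∀ w, Guarded (p w) := by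
        intro w
        rcases ht w with ⟨a, ha⟩ | hw
        · exfalso
          -- If some node had ended while `u` had not, every outcome of the draws would contribute
          -- `⊤`; one outcome of positive probability contradicts the value `0`.
          have h2 := (iSup_eq_bot.1 (hev _ _ h0)) (Classical.arbitrary _)
          choose y hy using fun v => (head (p v)).support_nonempty
          have h3 := eq_zero_of_jointExpect_eq_zero h2 y hy
          obtain ⟨c, hc, -⟩ := exists_inr_of_guarded hu (hy u)
          have hyw := hy w
          rw [ha] at hyw
          rw [joinHeads_eq_top _ _ _ ((PMF.mem_support_pure_iff _ _).1 hyw) hc] at h3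
          exact ENNReal.top_ne_zero h3
        · exact hw
      refine Or.inr ⟨T', ?_⟩
      simp only [settle_of_guarded body (hg _)]
      exact ⟨hg, hev _ _ h0⟩
  have hstep : ∀ (q : Fin n → Prog (S ⊕ O)) (G : Topology n)
      (a : Fin n → Msg × (Multiset Msg → Prog (S ⊕ O))), J q →
      (∀ v, a v ∈ (act body (q v)).support) →
      J fun v => (a v).2 (neighbourValues G.1 (fun u => (a u).1) v) := by
    rintro q G a (⟨o, rfl, ho⟩ | ⟨T', hg, h0⟩) ha
    · refine Or.inl ⟨o, ?_, ho⟩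
      funext v
      rw [(PMF.mem_support_pure_iff _ _).1 (ha v)]
      rfl
    · have : ∀ v, ∃ h, head (q v) h ≠ 0 ∧ a v = Head.act body h := by
        intro v
        have := ha v
        rw [act_eq_map_head, PMF.mem_support_map_iff] at this
        obtain ⟨h, hh, hh'⟩ := this
        exact ⟨h, hh, hh'.symm⟩
      choose h hh hah using this
      choose c hc hct using fun v => exists_inr_of_guarded (hg v) (hh v)
      have h2 := (iSup_eq_bot.1 h0) G
      have h3 := eq_zero_of_jointExpect_eq_zero h2 h hh
      rw [show h = fun v => Sum.inr (c v) from funext hc, joinHeads_inr] at h3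
      have h4 := hsettle _ _ (fun v => hct v _) h3
      have h5 : a = fun v => ((c v).1, fun r => settle body ((c v).2 r)) := funext fun v => by
        rw [hah, hc]; rfl
      rw [h5]
      exact h4
  have key : ∀ t, ∀ x ∈ ((loop start body).exec input adv t).support, J x.2 := by
    intro t
    induction t with
    | zero =>
      intro x hx
      rw [Protocol.exec, PMF.mem_support_pure_iff] at hx
      rw [hx]
      exact Or.inr ⟨T, fun v => hguard _, hev _ _ (hbody _ hinput)⟩
    | succ t ih =>
      intro x hx
      rw [Protocol.exec, PMF.mem_support_bind_iff] at hx
      obtain ⟨y, hy, hx⟩ := hx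
      rw [PMF.mem_support_bind_iff] at hx
      obtain ⟨a, ha, hx⟩ := hx
      rw [PMF.mem_support_pure_iff] at hx
      rw [hx]
      exact hstep y.2 ⟨adv y.1 y.2, hadv _ _⟩ a (ih y hy) fun v => mem_support_indepLaw ha v
  rcases key t x hx with ⟨o', hq, ho'⟩ | ⟨T', hg, -⟩
  · rw [hq] at ho
    change some (o' v) = some o at ho
    rw [← Option.some.inj ho]
    exact ho' v
  · have := hg v
    change result (x.2 v) = some o at ho
    cases hq : x.2 v with
    | done a => rw [hq] at this; exact this.elim
    | draw μ k => rw [hq] at ho; cases ho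
    | comm m k => rw [hq] at ho; cases ho

/-! ### Message sizes -/

/-- All messages have at most `B` bits. -/
def Short (B : ℕ) {α : Type} : Prog α → Prop
  | done _ => True
  | draw _ k => ∀ x, Short B (k x)
  | comm m k => m.length ≤ B ∧ ∀ r, Short B (k r)

theorem short_bind {B : ℕ} {α β : Type} {p : Prog α} (hp : Short B p) {k : α → Prog β}
    (hk : ∀ a, Short B (k a)) : Short B (p >>= k) := by
  induction p with
  | done a => exact hk a
  | draw μ q ih => exact fun x => ih x (hp x)
  | comm m q ih => exact ⟨hp.1, fun r => ih r (hp.2 r)⟩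

theorem short_iter {B : ℕ} {α : Type} {f : α → Prog α} (hf : ∀ a, Short B (f a)) (r : ℕ) (a : α) :
    Short B (iter f r a) := by
  induction r generalizing a with
  | zero => trivial
  | succ r ih => exact short_bind (hf a) fun b => ih b

theorem length_enc {X : Type} [Fintype X] (x : X) :
    (enc x).length = Nat.clog 2 (Fintype.card X) := by
  rw [enc, List.length_ofFn]

theorem short_exchange {B : ℕ} {X : Type} [Fintype X] (hX : Fintype.card X ≤ 2 ^ B) (x : X) :
    Short B (exchange x) :=
  ⟨(length_enc x).le.trans ((Nat.clog_le_iff_le_pow one_lt_two).2 hX), fun _ => trivial⟩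

theorem short_flood {B : ℕ} {X : Type} [Fintype X] (hX : Fintype.card X ≤ 2 ^ B) (r : ℕ)
    (merge : X → Multiset X → X) (x : X) : Short B (flood r merge x) :=
  short_iter (f := fun x => exchange x >>= fun r => pure (merge x r))
    (fun x => short_bind (short_exchange hX x) fun _ => trivial) r x

theorem length_le_of_mem_support_exec (B : ℕ) (hbody : ∀ s, Short B (body s))
    (input : Fin n → I) (adv : (loop start body).Adversary n) (t : ℕ)
    (x : (loop start body).History n × (Fin n → (loop start body).State))
    (hx : x ∈ ((loop start body).exec input adv t).support) (a : Fin n → (loop start body).Action)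
    (ha : a ∈ x.1) (v : Fin n) : (a v).1.length ≤ B := by
  have hsettle : ∀ p : Prog (S ⊕ O), Short B p → Short B (settle body p) := by
    intro p hp
    cases p with
    | done a =>
      cases a with
      | inl s => exact hbody s
      | inr o => trivial
    | draw μ k => exact hp
    | comm m k => exact hp
  have hact : ∀ p : Prog (S ⊕ O), Short B p → ∀ b ∈ (act body p).support,
      b.1.length ≤ B ∧ ∀ r, Short B (b.2 r) := by
    intro p hp b hb
    induction p with
    | done a =>
      rw [act, PMF.mem_support_pure_iff] at hb
      rw [hb]
      exact ⟨Nat.zero_le _, fun _ => hsettle _ hp⟩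
    | draw μ k ih =>
      rw [act, PMF.mem_support_bind_iff] at hb
      obtain ⟨y, -, hy⟩ := hb
      exact ih y (hp y) hy
    | comm m k ih =>
      rw [act, PMF.mem_support_pure_iff] at hb
      rw [hb]
      exact ⟨hp.1, fun r => hsettle _ (hp.2 r)⟩
  have key : ∀ t, ∀ x ∈ ((loop start body).exec input adv t).support,
      (∀ v, Short B (x.2 v : Prog (S ⊕ O))) ∧ ∀ a ∈ x.1, ∀ v, (a v).1.length ≤ B := by
    intro t
    induction t with
    | zero =>
      intro x hx
      rw [Protocol.exec, PMF.mem_support_pure_iff] at hx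
      rw [hx]
      exact ⟨fun v => hbody _, by simp⟩
    | succ t ih =>
      intro x hx
      rw [Protocol.exec, PMF.mem_support_bind_iff] at hx
      obtain ⟨y, hy, hx⟩ := hx
      rw [PMF.mem_support_bind_iff] at hx
      obtain ⟨a, ha, hx⟩ := hx
      rw [PMF.mem_support_pure_iff] at hx
      rw [hx]
      have ha' : ∀ v, a v ∈ (act body (y.2 v)).support := fun v => mem_support_indepLaw ha v
      refine ⟨fun v => (hact _ ((ih y hy).1 v) _ (ha' v)).2 _, fun b hb => ?_⟩
      rcases List.mem_cons.1 hb with rfl | hb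
      · exact fun v => (hact _ ((ih y hy).1 v) _ (ha' v)).1
      · exact (ih y hy).2 b hb
  exact (key t x hx).2 a ha v

end Prog

/-! ## Smallest elements -/

theorem mem_take_iff_of_sortedLT {α : Type*} [LinearOrder α] {l : List α} (hl : l.Pairwise (· < ·))
    (s : ℕ) (x : α) : x ∈ l.take s ↔ x ∈ l ∧ (l.filter fun y => decide (y < x)).length < s := by
  induction l generalizing s with
  | nil => simp
  | cons a l ih =>
    rw [List.pairwise_cons] at hl
    cases s with
    | zero => simp
    | succ s =>
      rw [List.take_succ_cons, List.mem_cons, ih hl.2, List.mem_cons]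
      by_cases hxa : x = a
      · subst hxa
        have : (l.filter fun y => decide (y < x)) = [] := by
          rw [List.filter_eq_nil_iff]
          intro y hy
          simpa using (hl.1 y hy).le
        simp [this]
      · by_cases hx : x ∈ l
        · simp [hxa, hx, hl.1 x hx]
        · simp [hxa, hx]

theorem mem_smallest {w : ℕ} {s : ℕ} {A : Finset (Word w)} {x : Word w} :
    x ∈ smallest s A ↔ x ∈ A ∧ (A.filter (· < x)).card < s := by
  rw [smallest, List.mem_toFinset, mem_take_iff_of_sortedLT (Finset.sortedLT_sort A).pairwise,
    Finset.mem_sort]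
  have : (A.filter (· < x)).card = ((A.sort (· ≤ ·)).filter fun y => decide (y < x)).length := by
    rw [← List.toFinset_card_of_nodup ((Finset.sort_nodup A _).filter _)]
    congr 1
    ext y
    simp
  rw [this]

theorem smallest_subset {w : ℕ} (s : ℕ) (A : Finset (Word w)) : smallest s A ⊆ A :=
  fun _ hx => (mem_smallest.1 hx).1

/-- Passing to a subset can only improve the rank. Hence a globally small element is never discarded
by a node that truncates its own list. -/
theorem mem_smallest_of_subset {w : ℕ} {s : ℕ} {A B : Finset (Word w)} (h : B ⊆ A) {x : Word w}
    (hx : x ∈ smallest s A) (hxB : x ∈ B) : x ∈ smallest s B :=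
  mem_smallest.2 ⟨hxB, (Finset.card_le_card (Finset.filter_subset_filter _ h)).trans_lt
    (mem_smallest.1 hx).2⟩

theorem smallest_eq_self {w : ℕ} {s : ℕ} {A : Finset (Word w)} (h : A.card ≤ s) :
    smallest s A = A := by
  rw [smallest, List.take_of_length_le (by rwa [Finset.length_sort]), Finset.sort_toFinset]

theorem card_smallest {w : ℕ} (s : ℕ) (A : Finset (Word w)) :
    (smallest s A).card = min s A.card := by
  rw [smallest, List.toFinset_card_of_nodup ((Finset.sort_nodup A _).sublist (List.take_sublist _ _)),
    List.length_take, Finset.length_sort]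

/-- The reason why flooding with truncated packets is exact: dropping elements outside the true
minimum does not change it. -/
theorem smallest_eq_of_subset {w : ℕ} {s : ℕ} {A B : Finset (Word w)} (h : B ⊆ A)
    (h' : smallest s A ⊆ B) : smallest s B = smallest s A := by
  symm
  refine Finset.eq_of_subset_of_card_le (fun x hx => mem_smallest_of_subset h hx (h' hx)) ?_
  rw [card_smallest, card_smallest]
  exact min_le_min le_rfl (Finset.card_le_card h)

theorem mem_unite {m w : ℕ} {r : Multiset (Packet m w)} {x : Word w} :
    x ∈ unite r ↔ ∃ B ∈ r, x ∈ B.1 := by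
  rw [unite]
  induction r using Multiset.induction_on with
  | empty => simp
  | cons a r ih => simp [ih]

theorem mem_unite_neighbourValues {n m w : ℕ} {G : SimpleGraph (Fin n)}
    {x : Fin n → Packet m w} {v : Fin n} {y : Word w} :
    y ∈ unite (neighbourValues G x v) ↔ ∃ u, G.Adj v u ∧ y ∈ (x u).1 := by
  classical
  simp [mem_unite, neighbourValues]

/-! ## Blocks -/

theorem length_blocks {w : ℕ} (m : ℕ) (A : Finset (Word w)) :
    (blocks m A).length = (A.card + m - 1) / m := by
  simp [blocks]

theorem getElem_blocks {w : ℕ} (m : ℕ) (A : Finset (Word w)) (i : ℕ)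
    (hi : i < (blocks m A).length) :
    (blocks m A)[i] = ((A.sort (· ≤ ·)).drop (i * m)).take m := by
  simp [blocks]

theorem length_le_of_mem_blocks {w m : ℕ} {A : Finset (Word w)} {B : List (Word w)}
    (hB : B ∈ blocks m A) : B.length ≤ m := by
  simp only [blocks, List.mem_map, List.mem_range] at hB
  obtain ⟨i, -, rfl⟩ := hB
  exact List.length_take_le _ _

theorem subset_of_mem_blocks {w m : ℕ} {A : Finset (Word w)} {B : List (Word w)}
    (hB : B ∈ blocks m A) : ∀ x ∈ B, x ∈ A := by
  simp only [blocks, List.mem_map, List.mem_range] at hB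
  obtain ⟨i, -, rfl⟩ := hB
  intro x hx
  exact (Finset.mem_sort _).1 (List.mem_of_mem_drop (List.mem_of_mem_take hx))

theorem exists_block {w m : ℕ} (hm : 0 < m) {A : Finset (Word w)} {x : Word w} (hx : x ∈ A) :
    ∃ i : Fin (blocks m A).length, x ∈ (blocks m A)[i] := by
  obtain ⟨j, hj, rfl⟩ := List.getElem_of_mem ((Finset.mem_sort (· ≤ ·)).2 hx)
  rw [Finset.length_sort] at hj
  have hi : j / m < (A.card + m - 1) / m := by
    rw [Nat.div_lt_iff_lt_mul hm]
    have h1 := Nat.div_add_mod (A.card + m - 1) m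
    have h2 := Nat.mod_lt (A.card + m - 1) hm
    rw [mul_comm] at h1
    omega
  refine ⟨⟨j / m, by rwa [length_blocks]⟩, ?_⟩
  simp only [Fin.getElem_fin, getElem_blocks]
  rw [List.mem_take_iff_getElem]
  have h1 := Nat.div_add_mod j m
  have h2 := Nat.mod_lt j hm
  rw [mul_comm] at h1
  refine ⟨j % m, ?_, ?_⟩
  · rw [List.length_drop, Finset.length_sort]
    omega
  · rw [List.getElem_drop]
    congr 1

theorem length_blocks_le_card {w m : ℕ} (hm : 0 < m) (A : Finset (Word w)) :
    (blocks m A).length ≤ A.card := by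
  rw [length_blocks]
  rcases Nat.eq_zero_or_pos A.card with h | h
  · rw [h, zero_add, Nat.div_eq_of_lt (by omega)]
  · rw [Nat.div_le_iff_le_mul_add_pred hm]
    have := Nat.le_mul_of_pos_left A.card hm
    omega

theorem length_blocks_mul_le {w : ℕ} (m : ℕ) (A : Finset (Word w)) :
    (blocks m A).length * m ≤ A.card + m := by
  rw [length_blocks]
  have := Nat.div_mul_le_self (A.card + m - 1) m
  omega

/-- The first `s` blocks of a set of at least `m s` words contain `m s` words. -/
theorem card_first_blocks {w m s : ℕ} {A : Finset (Word w)} (hA : m * s ≤ A.card) :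
    ((Finset.univ : Finset (Fin s)).biUnion fun i =>
      ((blocks m A)[i.val]?.getD []).toFinset) = smallest (m * s) A := by
  rcases Nat.eq_zero_or_pos m with rfl | hm
  · ext x
    simp [blocks, smallest]
  have hlen : s ≤ (blocks m A).length := by
    rw [length_blocks, Nat.le_div_iff_mul_le hm, mul_comm]
    omega
  ext x
  simp only [Finset.mem_biUnion, Finset.mem_univ, true_and, List.mem_toFinset, smallest]
  constructor
  · rintro ⟨i, hi⟩
    rw [List.getElem?_eq_getElem (i.isLt.trans_le hlen), Option.getD_some, getElem_blocks,
      List.mem_take_iff_getElem] at hi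
    obtain ⟨j, hj, rfl⟩ := hi
    rw [List.length_drop] at hj
    rw [List.getElem_drop, List.mem_take_iff_getElem]
    refine ⟨i * m + j, ?_, rfl⟩
    have : (i.val + 1) * m ≤ s * m := Nat.mul_le_mul_right _ i.isLt
    rw [Nat.add_mul, one_mul, mul_comm s m] at this
    omega
  · intro hx
    obtain ⟨j, hj, rfl⟩ := List.mem_take_iff_getElem.1 hx
    have hj' : j < m * s := by omega
    have h1 := Nat.div_add_mod j m
    have h2 := Nat.mod_lt j hm
    rw [mul_comm] at h1
    have h3 : j / m < s := Nat.div_lt_of_lt_mul hj'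
    refine ⟨⟨j / m, h3⟩, ?_⟩
    simp only
    rw [List.getElem?_eq_getElem (h3.trans_le hlen), Option.getD_some, getElem_blocks,
      List.mem_take_iff_getElem]
    refine ⟨j % m, ?_, ?_⟩
    · rw [List.length_drop]
      omega
    · rw [List.getElem_drop]
      congr 1

theorem wordVec_injective {w : ℕ} : Function.Injective (wordVec : Word w → _) := by
  intro x y h
  apply Fin.ext
  refine Nat.eq_of_testBit_eq fun i => ?_
  by_cases hi : i < w
  · have := congrFun h (Fin.succ ⟨i, hi⟩)
    simp only [wordVec, Fin.cons_succ] at this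
    by_cases h1 : x.val.testBit i <;> by_cases h2 : y.val.testBit i <;> simp_all
  · have := Nat.pow_le_pow_right (n := 2) (by norm_num) (not_lt.1 hi)
    rw [Nat.testBit_lt_two_pow (x.isLt.trans_le this),
      Nat.testBit_lt_two_pow (y.isLt.trans_le this)]

/-- The leading `1` of a word vector separates the word zero from an empty slot, so decoding yields
neither spurious nor missing words. -/
theorem exists_blockVec_eq {w m : ℕ} {B : List (Word w)} (hB : B.length ≤ m) (x : Word w) :
    (∃ j, blockVec m B j = wordVec x) ↔ x ∈ B := by
  constructor
  · rintro ⟨j, hj⟩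
    rw [blockVec] at hj
    cases h : B[j.val]? with
    | some y =>
      rw [h] at hj
      rw [← wordVec_injective hj]
      exact List.mem_of_getElem? h
    | none =>
      rw [h] at hj
      have := congrFun hj 0
      simp [wordVec] at this
  · intro hx
    obtain ⟨j, hj, rfl⟩ := List.getElem_of_mem hx
    refine ⟨⟨j, hj.trans_le hB⟩, ?_⟩
    simp [blockVec, List.getElem?_eq_getElem hj]

namespace PriorityForward

open Prog

variable (P : Params) {n : ℕ} [NeZero n]

/-! ## Applications of flooding -/

theorem ev_anyNode (hN : n ≤ P.N) (f : (Fin n → Bool) → ℝ≥0∞) (x : Fin n → Bool) :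
    ev f P.N (fun v => anyNode P (x v)) ≤ f fun _ => decide (∃ v, x v = true) := by
  have := ev_flood f hN (fun x r => x || decide (true ∈ r)) x
    (fun K => decide (∃ v ∈ K, x v = true)) (by simp) (by
      intro K₀ S K _ _
      rw [Bool.eq_iff_iff]
      simp only [Bool.or_eq_true, decide_eq_true_eq, Multiset.mem_map, Finset.mem_val,
        Finset.mem_union, Finset.mem_biUnion]
      constructor
      · rintro (⟨v, hv, h⟩ | ⟨u, hu, v, hv, h⟩)
        · exact ⟨v, Or.inl hv, h⟩
        · exact ⟨v, Or.inr ⟨u, hu, hv⟩, h⟩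
      · rintro ⟨v, hv | ⟨u, hu, hv⟩, h⟩
        · exact Or.inl ⟨v, hv, h⟩
        · exact Or.inr ⟨u, hu, v, hv, h⟩)
  simp only [Finset.mem_univ, true_and] at this
  exact this

theorem ev_maxKey (hN : n ≤ P.N) (f : (Fin n → P.Key) → ℝ≥0∞) (x : Fin n → P.Key) :
    ∃ v₀, (∀ v, x v ≤ x v₀) ∧ ev f P.N (fun v => maxKey P (x v)) ≤ f fun _ => x v₀ := by
  classical
  obtain ⟨v₀, -, hv₀⟩ := Finset.exists_max_image Finset.univ x Finset.univ_nonempty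
  refine ⟨v₀, fun v => hv₀ v (Finset.mem_univ v), ?_⟩
  have := ev_flood f hN
    (fun x r => (insert x r.toFinset).max' (Finset.insert_nonempty _ _)) x
    -- The value for the empty set is arbitrary; `ev_flood` merges only aggregates over nonempty
    -- sets of nodes.
    (fun K => if h : (K.image x).Nonempty then (K.image x).max' h else x v₀) (by simp) (by
      intro K₀ S K h₀ hK
      have hK₀ : (K₀.image x).Nonempty := h₀.image x
      have hu : ((K₀ ∪ S.biUnion K).image x).Nonempty :=
        (h₀.mono Finset.subset_union_left).image x
      simp only [dif_pos hK₀, dif_pos hu, dif_pos ((hK _).image x)]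
      apply le_antisymm
      · refine Finset.max'_le _ _ _ fun y hy => ?_
        rw [Finset.mem_insert, Multiset.mem_toFinset, Multiset.mem_map] at hy
        rcases hy with rfl | ⟨u, hu', rfl⟩
        · exact Finset.max'_le _ _ _ fun y hy => Finset.le_max' _ _
            (Finset.image_subset_image Finset.subset_union_left hy)
        · refine Finset.max'_le _ _ _ fun y hy => Finset.le_max' _ _
            (Finset.image_subset_image ?_ hy)
          exact (Finset.subset_biUnion_of_mem K hu').trans Finset.subset_union_right
      · refine Finset.max'_le _ _ _ fun y hy => ?_
        obtain ⟨v, hv, rfl⟩ := Finset.mem_image.1 hy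
        rcases Finset.mem_union.1 hv with hv | hv
        · exact (Finset.le_max' _ _ (Finset.mem_image_of_mem x hv)).trans
            (Finset.le_max' _ _ (Finset.mem_insert_self _ _))
        · obtain ⟨u, hu', hv⟩ := Finset.mem_biUnion.1 hv
          refine (Finset.le_max' _ _ (Finset.mem_image_of_mem x hv)).trans
            (Finset.le_max' _ _ (Finset.mem_insert_of_mem ?_))
          exact Multiset.mem_toFinset.2 (Multiset.mem_map.2 ⟨u, hu', rfl⟩))
  have hne : ((Finset.univ : Finset (Fin n)).image x).Nonempty := Finset.univ_nonempty.image x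
  simp only [dif_pos hne] at this
  refine this.trans (le_of_eq (congrArg f (funext fun _ => Eq.symm ?_)))
  refine le_antisymm (Finset.le_max' _ _ (Finset.mem_image_of_mem x (Finset.mem_univ v₀)))
    (Finset.max'_le _ _ _ fun y hy => ?_)
  obtain ⟨v, -, rfl⟩ := Finset.mem_image.1 hy
  exact hv₀ v (Finset.mem_univ v)

/-- Taking the `s'` smallest elements is a mergeable aggregate by `smallest_eq_of_subset`, so
truncation in every round loses nothing in the end. -/
theorem ev_floodIndex (hN : n ≤ P.N) (f : (Fin n → Finset P.Key) → ℝ≥0∞)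
    (K : Fin n → Finset P.Key) :
    ev f P.N (fun v => floodIndex P (K v)) ≤
      f fun _ => smallest P.s' (Finset.univ.biUnion K) := by
  classical
  have h := ev_flood (fun A : Fin n → Packet P.s' P.w => f fun v => (A v).1) hN
    (fun A r => packet P.s' (A.1 ∪ unite r)) (fun v => packet P.s' (K v))
    (fun S => packet P.s' (S.biUnion K)) (by simp) (by
      intro S₀ S T _ _
      apply Subtype.ext
      change smallest _ (smallest _ _ ∪ unite _) = smallest _ _
      refine smallest_eq_of_subset ?_ ?_
      · refine Finset.union_subset ((smallest_subset _ _).trans ?_) fun x hx => ?_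
        · exact Finset.biUnion_subset_biUnion_of_subset_left _ Finset.subset_union_left
        · obtain ⟨B, hB, hx⟩ := mem_unite.1 hx
          obtain ⟨u, hu, rfl⟩ := Multiset.mem_map.1 hB
          refine Finset.biUnion_subset_biUnion_of_subset_left _ ?_ (smallest_subset _ _ hx)
          exact (Finset.subset_biUnion_of_mem T hu).trans Finset.subset_union_right
      · intro x hx
        obtain ⟨v, hv, hxv⟩ := Finset.mem_biUnion.1 (smallest_subset _ _ hx)
        rcases Finset.mem_union.1 hv with hv | hv
        · exact Finset.mem_union_left _ (mem_smallest_of_subset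
            (Finset.biUnion_subset_biUnion_of_subset_left _ Finset.subset_union_left) hx
            (Finset.mem_biUnion.2 ⟨v, hv, hxv⟩))
        · obtain ⟨u, hu, hv⟩ := Finset.mem_biUnion.1 hv
          refine Finset.mem_union_right _ (mem_unite.2
            ⟨_, Multiset.mem_map.2 ⟨u, hu, rfl⟩, mem_smallest_of_subset
              (Finset.biUnion_subset_biUnion_of_subset_left _ ?_) hx
              (Finset.mem_biUnion.2 ⟨v, hv, hxv⟩)⟩)
          exact (Finset.subset_biUnion_of_mem T hu).trans Finset.subset_union_right)
  refine le_trans ?_ h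
  refine (ev_bind f P.N 0 _ _).trans (le_of_eq ?_)
  simp only [pure_def, ev_done]

end PriorityForward

/-! ## Spreading of information -/

open Classical in
/-- A weight that decreases by a factor of two whenever the set of informed nodes grows, and
vanishes when all nodes are informed. -/
def spreadWeight {n : ℕ} (D : Finset (Fin n)) : ℝ :=
  if D = Finset.univ then 0 else (1 / 2) ^ D.card

section spreadWeight

variable {n : ℕ} {D D' : Finset (Fin n)}

theorem spreadWeight_nonneg : 0 ≤ spreadWeight D := by
  rw [spreadWeight]; split_ifs <;> positivity

theorem spreadWeight_le_one : spreadWeight D ≤ 1 := by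
  rw [spreadWeight]; split_ifs
  · exact zero_le_one
  · exact pow_le_one₀ (by norm_num) (by norm_num)

theorem spreadWeight_anti (h : D ⊆ D') : spreadWeight D' ≤ spreadWeight D := by
  by_cases h' : D' = Finset.univ
  · rw [spreadWeight, if_pos h']; exact spreadWeight_nonneg
  · have : D ≠ Finset.univ := fun hD => h' (Finset.univ_subset_iff.1 (hD ▸ h))
    rw [spreadWeight, if_neg h', spreadWeight, if_neg this]
    exact pow_le_pow_of_le_one (by norm_num) (by norm_num) (Finset.card_le_card h)

theorem spreadWeight_of_ssubset (h : D ⊂ D') : spreadWeight D' ≤ spreadWeight D / 2 := by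
  by_cases h' : D' = Finset.univ
  · rw [spreadWeight, if_pos h']
    exact div_nonneg spreadWeight_nonneg (by norm_num)
  · have : D ≠ Finset.univ := fun hD => h' (Finset.univ_subset_iff.1 (hD ▸ h.1))
    rw [spreadWeight, if_neg h', spreadWeight, if_neg this]
    refine (pow_le_pow_of_le_one (by norm_num) (by norm_num) (Finset.card_lt_card h)).trans
      (le_of_eq ?_)
    rw [Nat.succ_eq_add_one, pow_succ]
    ring

/-- This turns the expected weight into a bound on the probability that some node is still
uninformed. -/
theorem one_le_mul_spreadWeight (h : D ≠ Finset.univ) : 1 ≤ 2 ^ n * spreadWeight D := by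
  rw [spreadWeight, if_neg h, one_div, inv_pow, ← div_eq_mul_inv, one_le_div (by positivity)]
  exact pow_le_pow_right₀ (by norm_num) (by simpa using Finset.card_le_univ D)

end spreadWeight

/-! ## Network coding -/

namespace PriorityForward

open Prog

variable {n : ℕ} [NeZero n] {s m w : ℕ}

/-- The linear form on the coefficient vectors with the values `μ` at the unit vectors. -/
def coeffForm (μ : Fin s → ZMod 2) : (Fin s → ZMod 2) →ₗ[ZMod 2] ZMod 2 :=
  Fintype.linearCombination (ZMod 2) μ

theorem coeffForm_single (μ : Fin s → ZMod 2) (i : Fin s) : coeffForm μ (Pi.single i 1) = μ i := by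
  rw [coeffForm, Fintype.linearCombination_apply_single, one_smul]

open Classical in
/-- The nodes that know a vector on which the form `μ` does not vanish. -/
def sensing (μ : Fin s → ZMod 2) (V : Fin n → Submodule (ZMod 2) (Coded s m w)) :
    Finset (Fin n) :=
  Finset.univ.filter fun v => ∃ x ∈ V v, coeffForm μ x.1 ≠ 0

theorem mem_sensing {μ : Fin s → ZMod 2} {V : Fin n → Submodule (ZMod 2) (Coded s m w)}
    {v : Fin n} : v ∈ sensing μ V ↔ ∃ x ∈ V v, coeffForm μ x.1 ≠ 0 := by
  simp [sensing]

theorem sensing_mono {μ : Fin s → ZMod 2} {V V' : Fin n → Submodule (ZMod 2) (Coded s m w)}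
    (h : ∀ v, V v ≤ V' v) : sensing μ V ⊆ sensing μ V' := by
  intro v hv
  obtain ⟨x, hx, hμ⟩ := mem_sensing.1 hv
  exact mem_sensing.2 ⟨x, h v hx, hμ⟩

/-- A random vector of a subspace avoids the kernel of a form with probability at least `1 / 2`. -/
theorem expect_randomVector_le (V : Submodule (ZMod 2) (Coded s m w)) (μ : Fin s → ZMod 2)
    (h : ∃ x ∈ V, coeffForm μ x.1 ≠ 0) {z : ℝ} (hz : 0 ≤ z) :
    ((randomVector V).expect fun x =>
      ENNReal.ofReal (if coeffForm μ x.1 ≠ 0 then z / 2 else z)) ≤ ENNReal.ofReal (3 / 4 * z) := by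
  classical
  obtain ⟨x₀, hx₀, hμ⟩ := h
  set W := Finset.univ.filter fun x => x ∈ V with hW
  have hWpos : 0 < W.card := Finset.card_pos.2 ⟨0, by simp [hW]⟩
  -- Translation by `x₀` embeds the vectors of `V` in the kernel into those outside it, so the
  -- latter are at least half of all.
  have hcard : (W.filter fun x => ¬ coeffForm μ x.1 ≠ 0).card ≤
      (W.filter fun x => coeffForm μ x.1 ≠ 0).card := by
    refine Finset.card_le_card_of_injOn (fun x => x + x₀) ?_ fun x _ y _ hxy =>
      add_right_cancel hxy
    intro x hx
    simp only [hW, Finset.coe_filter, Finset.mem_filter, Finset.mem_univ, true_and, not_not,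
      Set.mem_ofPred_eq] at hx ⊢
    refine ⟨V.add_mem hx.1 hx₀, ?_⟩
    rw [Prod.fst_add, map_add, hx.2, zero_add]
    exact hμ
  have hsum := Finset.card_filter_add_card_filter_not (s := W) (fun x => coeffForm μ x.1 ≠ 0)
  rw [show randomVector V = PMF.uniformOfFinset W (Finset.card_pos.1 hWpos) from rfl,
    PMF.expect_uniformOfFinset, ← ENNReal.ofReal_sum_of_nonneg (by
      intro x _; split_ifs <;> positivity), Finset.sum_ite, Finset.sum_const, Finset.sum_const]
  rw [mul_comm, ← div_eq_mul_inv]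
  refine ENNReal.div_le_of_le_mul ?_
  rw [← ENNReal.ofReal_natCast, ← ENNReal.ofReal_mul (by positivity)]
  refine ENNReal.ofReal_le_ofReal ?_
  simp only [nsmul_eq_mul]
  have h1 : ((W.filter fun x => ¬ coeffForm μ x.1 ≠ 0).card : ℝ) ≤
      (W.filter fun x => coeffForm μ x.1 ≠ 0).card := by exact_mod_cast hcard
  have h2 : ((W.filter fun x => coeffForm μ x.1 ≠ 0).card : ℝ) +
      (W.filter fun x => ¬ coeffForm μ x.1 ≠ 0).card = W.card := by exact_mod_cast hsum
  rw [← h2]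
  nlinarith

/-- One round of network coding: the subspaces after the round. -/
def codingStep (G : SimpleGraph (Fin n)) (V : Fin n → Submodule (ZMod 2) (Coded s m w))
    (x : Fin n → Coded s m w) (v : Fin n) : Submodule (ZMod 2) (Coded s m w) :=
  V v ⊔ Submodule.span (ZMod 2) {y | y ∈ neighbourValues G x v}

theorem mem_neighbourValues {X : Type*} {G : SimpleGraph (Fin n)} {x : Fin n → X} {v : Fin n}
    {y : X} : y ∈ neighbourValues G x v ↔ ∃ u, G.Adj v u ∧ x u = y := by
  classical
  simp [neighbourValues]

/-- Across one boundary edge, the sensing node sends a vector outside the kernel with probability at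
least 1/2, and then the sensing set grows and its weight halves: `3/4 = 1/2 * 1/2 + 1/2 * 1`. The
graph is fixed before the draws, so the edge does not depend on them. -/
theorem jointExpect_codingStep_le (G : Topology n)
    (V : Fin n → Submodule (ZMod 2) (Coded s m w)) (μ : Fin s → ZMod 2)
    (h : (sensing μ V).Nonempty) :
    (jointExpect n (fun v => randomVector (V v)) fun x =>
      ENNReal.ofReal (spreadWeight (sensing μ (codingStep G.1 V x)))) ≤
      ENNReal.ofReal (3 / 4) * ENNReal.ofReal (spreadWeight (sensing μ V)) := by
  classical
  have hmono : ∀ x, sensing μ V ⊆ sensing μ (codingStep G.1 V x) := fun x =>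
    sensing_mono fun v => le_sup_left
  rw [← ENNReal.ofReal_mul (by norm_num)]
  by_cases hfull : sensing μ V = Finset.univ
  · have : ∀ x, spreadWeight (sensing μ (codingStep G.1 V x)) = 0 := by
      intro x
      rw [spreadWeight, if_pos]
      exact Finset.univ_subset_iff.1 (hfull ▸ hmono x)
    simp [this, jointExpect_const]
  · obtain ⟨v, u, hv, hu, hvu⟩ := exists_adj_of_connected G.2
      (D := (sensing μ V : Set (Fin n))) (by exact_mod_cast h)
      (by rwa [Ne, ← Finset.coe_univ, Finset.coe_inj])
    refine le_trans (jointExpect_mono (g' := fun x => ENNReal.ofReal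
      (if coeffForm μ (x u).1 ≠ 0 then spreadWeight (sensing μ V) / 2
        else spreadWeight (sensing μ V))) fun x => ENNReal.ofReal_le_ofReal ?_) ?_
    · split_ifs with hx
      · refine spreadWeight_of_ssubset (Finset.ssubset_iff_subset_ne.2 ⟨hmono x, fun he => hv ?_⟩)
        rw [he]
        exact mem_sensing.2 ⟨x u, Submodule.mem_sup_right (Submodule.subset_span
          (mem_neighbourValues.2 ⟨u, hvu, rfl⟩)), hx⟩
      · exact spreadWeight_anti (hmono x)
    · rw [jointExpect_apply (fun v => randomVector (V v)) u fun x => ENNReal.ofReal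
        (if coeffForm μ x.1 ≠ 0 then spreadWeight (sensing μ V) / 2
        else spreadWeight (sensing μ V))]
      exact expect_randomVector_le _ _ (mem_sensing.1 hu) spreadWeight_nonneg

/-- A bound for the probability that network coding fails. -/
def codingError (n s R : ℕ) : ℝ≥0∞ := 2 ^ s * (2 ^ n * ENNReal.ofReal (3 / 4) ^ R)

/-- All known vectors lie on the graph of the map from coefficients to payloads, so the payload that
belongs to a unit coefficient vector is unique. -/
theorem decoded_eq {B : Fin s → List (Word w)} {V : Submodule (ZMod 2) (Coded s m w)}
    (hV : V ≤ (Fintype.linearCombination (ZMod 2) fun i => blockVec m (B i)).graph) {i : Fin s}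
    (hi : ∃ y, (Pi.single i 1, y) ∈ V) (hB : (B i).length ≤ m) :
    decoded V i = (B i).toFinset := by
  classical
  have huniq : ∀ y, (Pi.single i 1, y) ∈ V → y = blockVec m (B i) := by
    intro y hy
    have := (LinearMap.mem_graph_iff _ _).1 (hV hy)
    rwa [Fintype.linearCombination_apply_single, one_smul] at this
  obtain ⟨y, hy⟩ := hi
  ext x
  rw [decoded, Finset.mem_filter, List.mem_toFinset, ← exists_blockVec_eq hB]
  constructor
  · rintro ⟨-, y', hy', j, hj⟩
    exact ⟨j, by rw [← hj, huniq y' hy']⟩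
  · rintro ⟨j, hj⟩
    exact ⟨Finset.mem_univ _, y, hy, j, by rw [huniq y hy, hj]⟩

/-- Either all blocks are delivered to all nodes, or, with a small probability, the broadcast fails
at all nodes. -/
theorem ev_indexedBroadcast (P : Params) (hN : n ≤ P.N) (r : ℕ) (B : Fin s → List (Word w))
    (own : Fin n → Fin s → Option (List (Word w)))
    (hown : ∀ v i b, own v i = some b → b = B i)
    (hex : ∀ i : Fin s, i.val < r → ∃ v, own v i = some (B i))
    (hlen : ∀ i : Fin s, i.val < r → (B i).length ≤ m)
    (f : (Fin n → Option (Finset (Word w))) → ℝ≥0∞) :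
    ev f (P.κ * P.N + P.N) (fun v => indexedBroadcast P s m w r (own v)) ≤
      (f fun _ => some ((Finset.univ.filter fun i : Fin s => i.val < r).biUnion
        fun i => (B i).toFinset)) + codingError n s (P.κ * P.N) * ((f fun _ => none) -
        f fun _ => some ((Finset.univ.filter fun i : Fin s => i.val < r).biUnion
          fun i => (B i).toFinset)) := by
  classical
  set Λ := Fintype.linearCombination (ZMod 2) fun i => blockVec m (B i) with hΛ
  set a := f fun _ => some ((Finset.univ.filter fun i : Fin s => i.val < r).biUnion
        fun i => (B i).toFinset) with ha
  set b := (f fun _ => none) - a with hb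
  -- Only forms that are nonzero at some index below `r` matter; a block behind such an index has an
  -- owner, so somebody senses the form from the start.
  let forms : Finset (Fin s → ZMod 2) := Finset.univ.filter fun μ => ∃ i, i.val < r ∧ μ i ≠ 0
  let inv : (Fin n → Submodule (ZMod 2) (Coded s m w)) → Prop := fun V =>
    (∀ v, V v ≤ Λ.graph) ∧ ∀ μ ∈ forms, (sensing μ V).Nonempty
  -- A union bound over the forms, with the factor `3/4` for each remaining round. The value `⊤` off
  -- the invariant forces its preservation to be proved.
  let g : ℕ → (Fin n → Submodule (ZMod 2) (Coded s m w)) → ℝ≥0∞ := fun R V =>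
    if inv V then a + (∑ μ ∈ forms, 2 ^ n * (ENNReal.ofReal (3 / 4) ^ R *
      ENNReal.ofReal (spreadWeight (sensing μ V)))) * b else ⊤
  -- the check by flooding, and decoding
  have hcheck : ∀ V : Fin n → Submodule (ZMod 2) (Coded s m w), ev f P.N (fun v => do
      let failed ← anyNode P (decide (¬ ∀ i : Fin s, i.val < r → ∃ y, (Pi.single i 1, y) ∈ V v))
      if failed then return none
      else return some ((Finset.univ.filter fun i : Fin s => i.val < r).biUnion
        (decoded (V v)))) ≤ g 0 V := by
    intro V
    by_cases hV : inv V
    swap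
    · simp only [g, if_neg hV, le_top]
    simp only [g, if_pos hV]
    refine (ev_bind f P.N 0 _ _).trans ((ev_anyNode P hN _ _).trans ?_)
    by_cases hall : ∀ v, ∀ i : Fin s, i.val < r → ∃ y, (Pi.single i 1, y) ∈ V v
    · have : ¬ ∃ v, decide (¬ ∀ i : Fin s, i.val < r → ∃ y, (Pi.single i 1, y) ∈ V v) = true := by
        simpa using hall
      simp only [this, decide_false, Bool.false_eq_true, if_false, pure_def, ev_done]
      refine le_trans (le_of_eq ?_) le_self_add
      rw [ha]
      congr 1
      funext v
      congr 1
      refine Finset.biUnion_congr rfl fun i hi => ?_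
      have hi := (Finset.mem_filter.1 hi).2
      exact decoded_eq (hV.1 v) (hall v i hi) (hlen i hi)
    · have : ∃ v, decide (¬ ∀ i : Fin s, i.val < r → ∃ y, (Pi.single i 1, y) ∈ V v) = true := by
        simpa using hall
      simp only [this, decide_true, if_true, pure_def, ev_done]
      push Not at hall
      obtain ⟨v, i, hi, hy⟩ := hall
      -- A unit vector that cannot be decoded lies outside the coefficient space of `v`. A linear
      -- form separates them: it vanishes on all that `v` knows but not at index `i`, so `v` does
      -- not sense it.
      have hmem : (Pi.single i 1 : Fin s → ZMod 2) ∉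
          (V v).map (LinearMap.fst (ZMod 2) _ _) := by
        rintro ⟨⟨c, y⟩, hc, hc'⟩
        have hc' : c = Pi.single i 1 := hc'
        exact hy y (hc' ▸ hc)
      obtain ⟨φ, hφ, hker⟩ := Submodule.exists_le_ker_of_notMem hmem
      set μ : Fin s → ZMod 2 := fun j => φ (Pi.single j 1) with hμ
      have hφμ : φ = coeffForm μ := by
        refine LinearMap.pi_ext' fun j => LinearMap.ext_ring ?_
        simp only [LinearMap.comp_apply, LinearMap.coe_single, coeffForm_single, hμ]
      have hμf : μ ∈ forms := Finset.mem_filter.2 ⟨Finset.mem_univ _, i, hi, hφ⟩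
      have hns : sensing μ V ≠ Finset.univ := by
        intro h
        obtain ⟨x, hx, hx'⟩ := mem_sensing.1 (h ▸ Finset.mem_univ v : v ∈ sensing μ V)
        rw [← hφμ] at hx'
        exact hx' (hker ⟨x, hx, rfl⟩)
      refine (le_add_tsub (b := a)).trans (add_le_add_right ?_ a)
      refine le_trans (le_of_eq (one_mul b).symm) (mul_le_mul_left ?_ b)
      refine le_trans ?_ (Finset.single_le_sum (f := fun μ => 2 ^ n * (ENNReal.ofReal (3 / 4) ^ 0 *
        ENNReal.ofReal (spreadWeight (sensing μ V)))) (fun _ _ => zero_le) hμf)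
      rw [pow_zero, one_mul]
      have := ENNReal.ofReal_le_ofReal (one_le_mul_spreadWeight hns)
      rwa [ENNReal.ofReal_mul (by positivity), ENNReal.ofReal_pow (by norm_num),
        ENNReal.ofReal_one, ENNReal.ofReal_ofNat] at this
  -- the coding rounds
  have hstep : ∀ R (V : Fin n → Submodule (ZMod 2) (Coded s m w)), ev (g R) 1 (fun v => do
      let x ← sample (randomVector (V v))
      let R ← exchange x
      return V v ⊔ Submodule.span (ZMod 2) {y | y ∈ R}) ≤ g (R + 1) V := by
    intro R V
    by_cases hV : inv V
    swap
    · simp only [g, if_neg hV, le_top]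
    rw [ev_sample_exchange]
    refine iSup_le fun G => ?_
    have hinv : ∀ x : Fin n → Coded s m w, (∀ v, randomVector (V v) (x v) ≠ 0) →
        inv (codingStep G.1 V x) := by
      intro x hx
      have hxV : ∀ v, x v ∈ V v := by
        intro v
        have := (PMF.mem_support_uniformOfFinset_iff _ _).1 ((PMF.mem_support_iff _ _).2 (hx v))
        exact (Finset.mem_filter.1 this).2
      refine ⟨fun v => sup_le (hV.1 v) (Submodule.span_le.2 ?_), fun μ hμ =>
        (hV.2 μ hμ).mono (sensing_mono fun v => le_sup_left)⟩
      intro y hy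
      obtain ⟨u, -, rfl⟩ := mem_neighbourValues.1 hy
      exact hV.1 u (hxV u)
    refine le_trans (jointExpect_mono_support (g' := fun x => a + (∑ μ ∈ forms, 2 ^ n *
      (ENNReal.ofReal (3 / 4) ^ R *
        ENNReal.ofReal (spreadWeight (sensing μ (codingStep G.1 V x))))) * b) fun x hx => ?_) ?_
    · exact le_of_eq (if_pos (hinv x hx))
    · rw [jointExpect_add, jointExpect_const]
      simp only [g, if_pos hV]
      gcongr
      simp only [mul_comm _ b]
      rw [jointExpect_const_mul, jointExpect_sum]
      gcongr with μ hμ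
      rw [jointExpect_const_mul, jointExpect_const_mul, pow_succ, mul_assoc]
      gcongr
      exact jointExpect_codingStep_le G V μ (hV.2 μ hμ)
  set V₀ : Fin n → Submodule (ZMod 2) (Coded s m w) := fun v => Submodule.span (ZMod 2)
    {y | ∃ i, ∃ b, own v i = some b ∧ y = (Pi.single i 1, blockVec m b)} with hV₀
  have hinv₀ : inv V₀ := by
    refine ⟨fun v => Submodule.span_le.2 ?_, fun μ hμ => ?_⟩
    · rintro y ⟨i, b', hb', rfl⟩
      rw [hown v i b' hb', SetLike.mem_coe, LinearMap.mem_graph_iff]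
      simp [hΛ, Fintype.linearCombination_apply_single]
    · obtain ⟨-, i, hi, hμi⟩ := Finset.mem_filter.1 hμ
      obtain ⟨v, hv⟩ := hex i hi
      refine ⟨v, mem_sensing.2 ⟨_, Submodule.subset_span ⟨i, B i, hv, rfl⟩, ?_⟩⟩
      rwa [coeffForm_single]
  refine (ev_bind f _ _ _ _).trans ((ev_mono hcheck _ _).trans ((ev_iter g _ hstep _ V₀).trans ?_))
  simp only [g, if_pos hinv₀]
  gcongr
  refine (Finset.sum_le_card_nsmul _ _ (2 ^ n * ENNReal.ofReal (3 / 4) ^ (P.κ * P.N))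
    fun μ _ => ?_).trans ?_
  · gcongr
    exact (mul_le_of_le_one_right' (ENNReal.ofReal_le_one.2 spreadWeight_le_one))
  · rw [codingError, nsmul_eq_mul]
    gcongr
    have : forms.card ≤ 2 ^ s := (Finset.card_le_univ _).trans (by simp)
    exact_mod_cast this

end PriorityForward

/-! ## Products over random subsets -/

section ElementarySymmetric

variable {ι : Type*} [DecidableEq ι] (r : ι → ℝ)

/-- Elementary symmetric functions. -/
def esum (k : ℕ) (A : Finset ι) : ℝ := ∑ B ∈ A.powersetCard k, ∏ t ∈ B, r t

theorem esum_zero (A : Finset ι) : esum r 0 A = 1 := by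
  simp [esum]

theorem esum_nonneg {r : ι → ℝ} (hr : ∀ t, 0 ≤ r t) (k : ℕ) (A : Finset ι) : 0 ≤ esum r k A :=
  Finset.sum_nonneg fun _ _ => Finset.prod_nonneg fun t _ => hr t

theorem esum_succ_insert (k : ℕ) {A : Finset ι} {a : ι} (ha : a ∉ A) :
    esum r (k + 1) (insert a A) = esum r (k + 1) A + r a * esum r k A := by
  rw [esum, Finset.powersetCard_succ_insert ha, Finset.sum_union, Finset.sum_image, esum, esum,
    Finset.mul_sum]
  · congr 1
    refine Finset.sum_congr rfl fun B hB => ?_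
    rw [Finset.prod_insert fun h => ha ((Finset.mem_powersetCard.1 hB).1 h)]
  · intro B hB C hC h
    have hB' : a ∉ B := fun h => ha ((Finset.mem_powersetCard.1 hB).1 h)
    have hC' : a ∉ C := fun h => ha ((Finset.mem_powersetCard.1 hC).1 h)
    rw [← Finset.erase_insert hB', h, Finset.erase_insert hC']
  · rw [Finset.disjoint_left]
    intro B hB hB'
    obtain ⟨C, -, rfl⟩ := Finset.mem_image.1 hB'
    exact ha ((Finset.mem_powersetCard.1 hB).1 (Finset.mem_insert_self _ _))

/-- Double counting: each set of size `k + 1` arises by adding any one of its members to the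
remaining `k`. -/
theorem sum_mul_esum_erase (k : ℕ) (A : Finset ι) :
    ∑ t ∈ A, r t * esum r k (A.erase t) = (k + 1) * esum r (k + 1) A := by
  have h1 : ((k : ℝ) + 1) * esum r (k + 1) A =
      ∑ B ∈ A.powersetCard (k + 1), ∑ t ∈ B, ∏ u ∈ B, r u := by
    rw [esum, Finset.mul_sum]
    refine Finset.sum_congr rfl fun B hB => ?_
    rw [Finset.sum_const, (Finset.mem_powersetCard.1 hB).2, nsmul_eq_mul]
    push_cast
    rfl
  rw [h1]
  simp only [esum, Finset.mul_sum]
  rw [Finset.sum_sigma', Finset.sum_sigma']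
  refine Finset.sum_bij' (fun p _ => ⟨insert p.1 p.2, p.1⟩) (fun p _ => ⟨p.2, p.1.erase p.2⟩)
    ?_ ?_ ?_ ?_ ?_
  · rintro ⟨t, B⟩ h
    simp only [Finset.mem_sigma, Finset.mem_powersetCard] at h ⊢
    have ht : t ∉ B := fun h' => Finset.notMem_erase _ _ (h.2.1 h')
    refine ⟨⟨Finset.insert_subset h.1 (h.2.1.trans (Finset.erase_subset _ _)), ?_⟩,
      Finset.mem_insert_self _ _⟩
    rw [Finset.card_insert_of_notMem ht, h.2.2]
  · rintro ⟨B, t⟩ h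
    simp only [Finset.mem_sigma, Finset.mem_powersetCard] at h ⊢
    refine ⟨h.1.1 h.2, Finset.erase_subset_erase _ h.1.1, ?_⟩
    rw [Finset.card_erase_of_mem h.2, h.1.2, Nat.add_sub_cancel]
  · rintro ⟨t, B⟩ h
    simp only [Finset.mem_sigma, Finset.mem_powersetCard] at h
    have ht : t ∉ B := fun h' => Finset.notMem_erase _ _ (h.2.1 h')
    simp only [Finset.erase_insert ht]
  · rintro ⟨B, t⟩ h
    simp only [Finset.mem_sigma, Finset.mem_powersetCard] at h
    simp only [Finset.insert_erase h.2]
  · rintro ⟨t, B⟩ h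
    simp only [Finset.mem_sigma, Finset.mem_powersetCard] at h
    have ht : t ∉ B := fun h' => Finset.notMem_erase _ _ (h.2.1 h')
    simp only [Finset.prod_insert ht]

/-- Double counting: each `k`-subset survives the removal of any element outside it. -/
theorem sum_esum_erase (k : ℕ) (A : Finset ι) :
    ∑ t ∈ A, esum r k (A.erase t) = (A.card - k) * esum r k A := by
  have h1 : ((A.card : ℝ) - k) * esum r k A =
      ∑ B ∈ A.powersetCard k, ∑ t ∈ A \ B, ∏ u ∈ B, r u := by
    rw [esum, Finset.mul_sum]
    refine Finset.sum_congr rfl fun B hB => ?_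
    obtain ⟨h, rfl⟩ := Finset.mem_powersetCard.1 hB
    rw [Finset.sum_const, nsmul_eq_mul, Finset.card_sdiff_of_subset h,
      Nat.cast_sub (Finset.card_le_card h)]
  rw [h1]
  simp only [esum]
  refine Finset.sum_comm' fun t B => ?_
  simp only [Finset.mem_powersetCard, Finset.mem_sdiff]
  constructor
  · rintro ⟨ht, h, rfl⟩
    exact ⟨⟨ht, fun h' => Finset.notMem_erase _ _ (h h')⟩, h.trans (Finset.erase_subset _ _), rfl⟩
  · rintro ⟨⟨ht, h'⟩, h, rfl⟩
    exact ⟨ht, Finset.subset_erase.2 ⟨h, h'⟩, rfl⟩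

/-- The mean of a product over random subsets of size `k` is at most the `k`-th power of the
mean. -/
theorem esum_le {r : ι → ℝ} (hr : ∀ t, 0 ≤ r t) {A : Finset ι} (hA : A.Nonempty) (k : ℕ) :
    esum r k A ≤ A.card.choose k * ((∑ t ∈ A, r t) / A.card) ^ k := by
  have hcard : (0 : ℝ) < A.card := by exact_mod_cast hA.card_pos
  induction k with
  | zero => simp [esum_zero]
  | succ k ih =>
    -- Removing a larger weight leaves a smaller elementary symmetric function. Chebyshev's sum
    -- inequality for the two opposite orders then gives the induction step.
    have hanti : AntivaryOn r (fun t => esum r k (A.erase t)) A := by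
      intro i hi j hj hij
      by_contra hcon
      push Not at hcon
      have hne : i ≠ j := by rintro rfl; exact lt_irrefl _ hcon
      refine absurd hij (not_lt.2 ?_)
      have hi' : i ∉ (A.erase i).erase j := by simp
      have hj' : j ∉ (A.erase i).erase j := by simp
      have e1 : A.erase j = insert i ((A.erase i).erase j) := by
        rw [Finset.erase_right_comm, Finset.insert_erase (Finset.mem_erase.2 ⟨hne, hi⟩)]
      have e2 : A.erase i = insert j ((A.erase i).erase j) := by
        rw [Finset.insert_erase (Finset.mem_erase.2 ⟨hne.symm, hj⟩)]
      cases k with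
      | zero => simp [esum_zero]
      | succ k =>
        change esum r (k + 1) (A.erase j) ≤ esum r (k + 1) (A.erase i)
        generalize (A.erase i).erase j = C at hi' hj' e1 e2
        rw [e1, e2, esum_succ_insert r k hi', esum_succ_insert r k hj']
        have := esum_nonneg hr k C
        nlinarith
    have h1 := hanti.card_mul_sum_le_sum_mul_sum
    rw [sum_mul_esum_erase, sum_esum_erase] at h1
    rcases lt_or_ge k A.card with hk | hk
    · have h2 : (A.card.choose (k + 1) : ℝ) * (k + 1) = A.card.choose k * (A.card - k) := by
        have := Nat.choose_succ_right_eq A.card k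
        rw [← Nat.cast_sub hk.le]
        exact_mod_cast this
      have hS : 0 ≤ ∑ t ∈ A, r t := Finset.sum_nonneg fun t _ => hr t
      have hk' : (0 : ℝ) ≤ A.card - k := by
        rw [sub_nonneg]; exact_mod_cast hk.le
      have hk1 : (0 : ℝ) < (k + 1) * A.card := by positivity
      refine le_of_mul_le_mul_left ?_ hk1
      calc ((k : ℝ) + 1) * A.card * esum r (k + 1) A
          = A.card * ((k + 1) * esum r (k + 1) A) := by ring
        _ ≤ (∑ t ∈ A, r t) * ((A.card - k) * esum r k A) := h1
        _ ≤ (∑ t ∈ A, r t) * ((A.card - k) *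
              (A.card.choose k * ((∑ t ∈ A, r t) / A.card) ^ k)) := by gcongr
        _ = (A.card.choose k * (A.card - k)) * A.card * ((∑ t ∈ A, r t) / A.card) ^ (k + 1) := by
            rw [pow_succ]; field_simp
        _ = (k + 1) * A.card *
              (A.card.choose (k + 1) * ((∑ t ∈ A, r t) / A.card) ^ (k + 1)) := by
            rw [← h2]; ring
    · rw [esum, Finset.powersetCard_eq_empty.2 (by omega), Finset.sum_empty,
        Nat.choose_eq_zero_of_lt (by omega)]
      simp

theorem exp_neg_le_one_sub_half {z : ℝ} (h0 : 0 ≤ z) (h1 : z ≤ 1) : Real.exp (-z) ≤ 1 - z / 2 := by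
  rw [Real.exp_neg]
  have h2 := Real.add_one_le_exp z
  rw [inv_le_iff_one_le_mul₀ (Real.exp_pos z)]
  nlinarith

/-- Halving the weights of the members of a random subset of size `k`. -/
theorem sum_powersetCard_prod_le {A T : Finset ι} (hT : T ⊆ A) (hA : A.Nonempty) {k : ℕ}
    (hk : k ≤ A.card) {y : ι → ℝ} (hy : ∀ t, 0 ≤ y t) {p : ℝ} (hp : 4 * p * A.card ≤ k) :
    ∑ B ∈ A.powersetCard k, ∏ t ∈ T, (if t ∈ B then 1 + y t / 2 else 1 + y t) ≤
      A.card.choose k * ∏ t ∈ T, (1 + (1 - p) * y t) := by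
  have hcard : (0 : ℝ) < A.card := by exact_mod_cast hA.card_pos
  -- The relative loss of a factor that is hit: `(1 + y) (1 - x) = 1 + y / 2`. Members of `A`
  -- outside `T` receive weight `1` below, so they are neutral in products.
  set x : ι → ℝ := fun t => y t / 2 / (1 + y t) with hx
  have hx0 : ∀ t, 0 ≤ x t := fun t => by have := hy t; positivity
  have hx1 : ∀ t, x t ≤ 1 / 2 := fun t => by
    have := hy t
    rw [hx, div_le_iff₀ (by positivity)]
    linarith
  set r : ι → ℝ := fun t => if t ∈ T then 1 - x t else 1 with hr
  have hr0 : ∀ t, 0 ≤ r t := fun t => by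
    simp only [hr]; split_ifs
    · linarith [hx1 t]
    · exact zero_le_one
  have hprod : ∀ B ∈ A.powersetCard k,
      ∏ t ∈ T, (if t ∈ B then 1 + y t / 2 else 1 + y t) =
        (∏ t ∈ T, (1 + y t)) * ∏ t ∈ B, r t := by
    intro B _
    have e1 : ∏ t ∈ B, r t = ∏ t ∈ T, if t ∈ B then 1 - x t else 1 := by
      simp only [hr]
      rw [← Finset.prod_filter, ← Finset.prod_filter, Finset.filter_mem_eq_inter,
        Finset.filter_mem_eq_inter, Finset.inter_comm]
    rw [e1, ← Finset.prod_mul_distrib]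
    refine Finset.prod_congr rfl fun t _ => ?_
    split_ifs
    · have := hy t
      simp only [hx]
      field_simp
      ring
    · ring
  rw [Finset.sum_congr rfl hprod, ← Finset.mul_sum]
  have h1 := esum_le hr0 hA k
  have hsum : (∑ t ∈ A, r t) / A.card = 1 - (∑ t ∈ T, x t) / A.card := by
    have : ∑ t ∈ A, r t = A.card - ∑ t ∈ T, x t := by
      have : ∀ t, r t = 1 - if t ∈ T then x t else 0 := fun t => by
        simp only [hr]; split_ifs <;> ring
      rw [Finset.sum_congr rfl fun t _ => this t, Finset.sum_sub_distrib, Finset.sum_const,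
        nsmul_eq_mul, mul_one, Finset.sum_ite_mem, Finset.inter_eq_right.2 hT]
    rw [this]
    field_simp
  have hq1 : (k : ℝ) / A.card ≤ 1 := (div_le_one hcard).2 (by exact_mod_cast hk)
  -- Exponentials turn the power of the mean back into a product over `T`, as if each word were hit
  -- independently at rate `k / |A|`.
  have hpow : ((∑ t ∈ A, r t) / A.card) ^ k ≤ ∏ t ∈ T, Real.exp (-(k / A.card * x t)) := by
    calc ((∑ t ∈ A, r t) / A.card) ^ k
        ≤ Real.exp (-((∑ t ∈ T, x t) / A.card)) ^ k := by
          refine pow_le_pow_left₀ (div_nonneg (Finset.sum_nonneg fun t _ => hr0 t) hcard.le) ?_ _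
          rw [hsum]
          exact Real.one_sub_le_exp_neg _
      _ = ∏ t ∈ T, Real.exp (-(k / A.card * x t)) := by
          rw [← Real.exp_nat_mul, ← Real.exp_sum, Finset.sum_neg_distrib, ← Finset.mul_sum]
          congr 1
          ring
  have hY : 0 ≤ ∏ t ∈ T, (1 + y t) := Finset.prod_nonneg fun t _ => by linarith [hy t]
  calc (∏ t ∈ T, (1 + y t)) * ∑ B ∈ A.powersetCard k, ∏ t ∈ B, r t
      ≤ (∏ t ∈ T, (1 + y t)) *
          (A.card.choose k * ∏ t ∈ T, Real.exp (-(k / A.card * x t))) := by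
        refine mul_le_mul_of_nonneg_left (h1.trans ?_) hY
        exact mul_le_mul_of_nonneg_left hpow (by positivity)
    _ = A.card.choose k * ∏ t ∈ T, ((1 + y t) * Real.exp (-(k / A.card * x t))) := by
        rw [Finset.prod_mul_distrib]; ring
    _ ≤ A.card.choose k * ∏ t ∈ T, (1 + (1 - p) * y t) := by
        refine mul_le_mul_of_nonneg_left (Finset.prod_le_prod (fun t _ => ?_) fun t _ => ?_)
          (by positivity)
        · have := hy t; positivity
        · have hq0 : (0 : ℝ) ≤ k / A.card := by positivity
          have hz := exp_neg_le_one_sub_half (mul_nonneg hq0 (hx0 t))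
            (by nlinarith [hx0 t, hx1 t])
          have hyt := hy t
          have hpq : 4 * p ≤ k / A.card := (le_div_iff₀ hcard).2 hp
          have hxy : (1 + y t) * x t = y t / 2 := by
            simp only [hx]; field_simp
          calc (1 + y t) * Real.exp (-(k / A.card * x t))
              ≤ (1 + y t) * (1 - k / A.card * x t / 2) := by gcongr
            _ = 1 + y t - k / A.card * ((1 + y t) * x t) / 2 := by ring
            _ ≤ 1 + (1 - p) * y t := by rw [hxy]; nlinarith

end ElementarySymmetric

/-! ## Random forwarding -/

namespace PriorityForward

open Prog

variable {n : ℕ} [NeZero n] {w : ℕ}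

/-- The nodes that know the word `t`. -/
def knowers (A : Fin n → Finset (Word w)) (t : Word w) : Finset (Fin n) :=
  Finset.univ.filter fun v => t ∈ A v

theorem mem_knowers {A : Fin n → Finset (Word w)} {t : Word w} {v : Fin n} :
    v ∈ knowers A t ↔ t ∈ A v := by
  simp [knowers]

/-- The number of rounds of random forwarding is controlled by this product over the words in `T`,
as long as no node knows more than `M` words. -/
def forwardWeight (M : ℕ) (T : Finset (Word w)) (α : ℝ) (A : Fin n → Finset (Word w)) : ℝ≥0∞ :=
  if ∀ v, (A v).card ≤ M then
    ENNReal.ofReal (∏ t ∈ T, (1 + α * spreadWeight (knowers A t))) else 0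

theorem mem_randomSubset {m : ℕ} {A B : Finset (Word w)} (h : randomSubset m A B ≠ 0) :
    B ⊆ A ∧ B.card ≤ m := by
  have := Finset.mem_powersetCard.1 ((PMF.mem_support_uniformOfFinset_iff _ _).1
    ((PMF.mem_support_iff _ _).2 h))
  exact ⟨this.1, this.2.le.trans (min_le_left _ _)⟩

theorem expect_randomSubset_le {m M : ℕ} {p : ℝ}
    (hp : ∀ j : ℕ, j ≤ M → 4 * p * j ≤ min m j) {A T : Finset (Word w)} (hT : T ⊆ A)
    (hA : A.card ≤ M) {y : Word w → ℝ} (hy : ∀ t, 0 ≤ y t) :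
    ((randomSubset m A).expect fun B => ENNReal.ofReal
      (∏ t ∈ T, (if t ∈ B then 1 + y t / 2 else 1 + y t))) ≤
      ENNReal.ofReal (∏ t ∈ T, (1 + (1 - p) * y t)) := by
  rcases A.eq_empty_or_nonempty with rfl | hne
  · rw [Finset.subset_empty.1 hT]
    simp [PMF.expect_const]
  rw [randomSubset, PMF.expect_uniformOfFinset, ← ENNReal.ofReal_sum_of_nonneg (by
      intro B _
      refine Finset.prod_nonneg fun t _ => ?_
      have := hy t
      split_ifs <;> positivity), mul_comm, ← div_eq_mul_inv]
  refine ENNReal.div_le_of_le_mul ?_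
  rw [mul_comm, ← ENNReal.ofReal_natCast, ← ENNReal.ofReal_mul (by positivity),
    Finset.card_powersetCard]
  refine ENNReal.ofReal_le_ofReal (sum_powersetCard_prod_le hT hne (min_le_right _ _) hy ?_)
  exact_mod_cast hp _ hA

/-- One round of random forwarding: the sets after the round. -/
def forwardStep (m : ℕ) (keep : Finset (Word w) → Finset (Word w)) (G : SimpleGraph (Fin n))
    (A B : Fin n → Finset (Word w)) (v : Fin n) : Finset (Word w) :=
  keep (A v ∪ unite (neighbourValues G (fun u => packet m (B u)) v))

theorem mem_unite_packet {m : ℕ} {G : SimpleGraph (Fin n)} {B : Fin n → Finset (Word w)}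
    (hB : ∀ v, (B v).card ≤ m) {v : Fin n} {x : Word w} :
    x ∈ unite (neighbourValues G (fun u => packet m (B u)) v) ↔ ∃ u, G.Adj v u ∧ x ∈ B u := by
  simp only [mem_unite_neighbourValues, packet, smallest_eq_self (hB _)]

/-- Random forwarding preserves `inv`, and it spreads the words in `T`, which are never
discarded. -/
theorem ev_randomForward (P : Params) {m M : ℕ} {keep : Finset (Word w) → Finset (Word w)}
    {T : Finset (Word w)} {p : ℝ} (hp1 : p ≤ 1)
    (hp : ∀ j : ℕ, j ≤ M → 4 * p * j ≤ min m j)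
    (inv : (Fin n → Finset (Word w)) → Prop)
    (hinv : ∀ A X : Fin n → Finset (Word w), inv A → (∀ v, ∀ x ∈ X v, ∃ u, x ∈ A u) →
      inv (fun v => keep (A v ∪ X v)) ∧
      (∀ v, ∀ t ∈ T, t ∈ A v ∪ X v → t ∈ keep (A v ∪ X v)) ∧
      (∀ v, M < (A v).card → M < (keep (A v ∪ X v)).card))
    (hT : ∀ A, inv A → ∀ t ∈ T, ∃ v, t ∈ A v)
    {α : ℝ} (hα : 0 ≤ α) (c : ℝ≥0∞) (F : (Fin n → Finset (Word w)) → ℝ≥0∞) (b : ℝ≥0∞)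
    (hF : ∀ A, inv A → F A ≤ b + c * forwardWeight M T α A)
    (A : Fin n → Finset (Word w)) (hA : inv fun v => keep (A v)) :
    ev F (P.κ * P.N) (fun v => randomForward P m keep (A v)) ≤
      b + c * forwardWeight M T (α * (1 - p) ^ (P.κ * P.N)) fun v => keep (A v) := by
  classical
  let g : ℕ → (Fin n → Finset (Word w)) → ℝ≥0∞ := fun R A =>
    if inv A then b + c * forwardWeight M T (α * (1 - p) ^ R) A else ⊤
  have hstep : ∀ R (A : Fin n → Finset (Word w)), ev (g R) 1 (fun v => do
      let B ← sample (randomSubset m (A v))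
      let r ← exchange (packet m B)
      return keep (A v ∪ unite r)) ≤ g (R + 1) A := by
    intro R A
    by_cases hA : inv A
    swap
    · simp only [g, if_neg hA, le_top]
    rw [ev_sample_exchange]
    refine iSup_le fun G => ?_
    have hsub : ∀ B : Fin n → Finset (Word w), (∀ v, randomSubset m (A v) (B v) ≠ 0) →
        ∀ v, ∀ x ∈ unite (neighbourValues G.1 (fun u => packet m (B u)) v), ∃ u, x ∈ A u := by
      intro B hB v x hx
      obtain ⟨u, -, hu⟩ := (mem_unite_packet fun v => (mem_randomSubset (hB v)).2).1 hx
      exact ⟨u, (mem_randomSubset (hB u)).1 hu⟩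
    refine le_trans (jointExpect_mono_support (g' := fun B => b + c *
      forwardWeight M T (α * (1 - p) ^ R) (forwardStep m keep G.1 A B)) fun B hB => ?_) ?_
    · exact le_of_eq (if_pos (hinv A _ hA (hsub B hB)).1)
    rw [jointExpect_add, jointExpect_const, jointExpect_const_mul]
    simp only [g, if_pos hA]
    gcongr
    by_cases hM : ∀ v, (A v).card ≤ M
    swap
    -- A node with more than `M` words keeps more than `M`, so the potential is zero from then on.
    · refine le_trans (jointExpect_mono_support (g' := fun _ => 0) fun B hB => ?_)
        ((jointExpect_const _ _).le.trans zero_le)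
      rw [forwardWeight, if_neg]
      push Not at hM ⊢
      obtain ⟨v, hv⟩ := hM
      exact ⟨v, (hinv A _ hA (hsub B hB)).2.2 v hv⟩
    set β := α * (1 - p) ^ R with hβ
    have hβ0 : 0 ≤ β := mul_nonneg hα (pow_nonneg (by linarith) _)
    set y : Word w → ℝ := fun t => β * spreadWeight (knowers A t) with hy
    have hy0 : ∀ t, 0 ≤ y t := fun t => mul_nonneg hβ0 spreadWeight_nonneg
    -- every word has a node that may forward it to an uninformed neighbour
    have hsend : ∀ t, ∃ u, t ∈ T → t ∈ A u ∧ ∀ B : Fin n → Finset (Word w),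
        (∀ v, randomSubset m (A v) (B v) ≠ 0) →
        spreadWeight (knowers (forwardStep m keep G.1 A B) t) ≤
          if t ∈ B u then spreadWeight (knowers A t) / 2 else spreadWeight (knowers A t) := by
      intro t
      by_cases ht : t ∈ T
      swap
      · exact ⟨0, fun h => absurd h ht⟩
      have hmono : ∀ B : Fin n → Finset (Word w), (∀ v, randomSubset m (A v) (B v) ≠ 0) →
          knowers A t ⊆ knowers (forwardStep m keep G.1 A B) t := by
        intro B hB v hv
        exact mem_knowers.2 ((hinv A _ hA (hsub B hB)).2.1 v t ht
          (Finset.mem_union_left _ (mem_knowers.1 hv)))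
      obtain ⟨v₀, hv₀⟩ := hT A hA t ht
      by_cases hfull : knowers A t = Finset.univ
      · refine ⟨v₀, fun _ => ⟨hv₀, fun B hB => ?_⟩⟩
        rw [spreadWeight, if_pos (Finset.univ_subset_iff.1 (hfull ▸ hmono B hB))]
        have := spreadWeight_nonneg (D := knowers A t)
        split_ifs <;> positivity
      · obtain ⟨v, u, hv, hu, hvu⟩ := exists_adj_of_connected G.2
          (D := (knowers A t : Set (Fin n))) ⟨v₀, by simpa [knowers] using hv₀⟩
          (by rwa [Ne, ← Finset.coe_univ, Finset.coe_inj])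
        refine ⟨u, fun _ => ⟨mem_knowers.1 (by exact_mod_cast hu), fun B hB => ?_⟩⟩
        split_ifs with htB
        · refine spreadWeight_of_ssubset
            (Finset.ssubset_iff_subset_ne.2 ⟨hmono B hB, fun he => hv ?_⟩)
          rw [he]
          refine mem_knowers.2 ((hinv A _ hA (hsub B hB)).2.1 v t ht (Finset.mem_union_right _ ?_))
          exact (mem_unite_packet fun v => (mem_randomSubset (hB v)).2).2 ⟨u, hvu, htB⟩
        · exact spreadWeight_anti (hmono B hB)
    choose u hu using hsend
    -- Each word of `T` is charged to one sender `u t`. Grouping the words by sender makes the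
    -- potential a product of functions of the individual draws, so independence applies and each
    -- factor is a single random subset.
    calc (jointExpect n (fun v => randomSubset m (A v)) fun B =>
          forwardWeight M T β (forwardStep m keep G.1 A B))
        ≤ jointExpect n (fun v => randomSubset m (A v)) fun B => ∏ v,
            ENNReal.ofReal (∏ t ∈ T with u t = v,
              (if t ∈ B v then 1 + y t / 2 else 1 + y t)) := by
          refine jointExpect_mono_support fun B hB => ?_
          rw [forwardWeight]
          split_ifs
          swap
          · exact zero_le
          rw [← ENNReal.ofReal_prod_of_nonneg]
          · refine ENNReal.ofReal_le_ofReal ?_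
            rw [show (∏ v, ∏ t ∈ T with u t = v, (if t ∈ B v then 1 + y t / 2 else 1 + y t)) =
              ∏ t ∈ T, (if t ∈ B (u t) then 1 + y t / 2 else 1 + y t) by
                rw [← Finset.prod_fiberwise T u]
                refine Finset.prod_congr rfl fun v _ => Finset.prod_congr rfl fun t ht => ?_
                rw [(Finset.mem_filter.1 ht).2]]
            refine Finset.prod_le_prod (fun t _ => ?_) fun t ht => ?_
            · have := mul_nonneg hβ0
                (spreadWeight_nonneg (D := knowers (forwardStep m keep G.1 A B) t))
              positivity
            · have := (hu t ht).2 B hB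
              split_ifs at this ⊢
              · simp only [hy]; nlinarith
              · simp only [hy]; nlinarith
          · intro v _
            refine Finset.prod_nonneg fun t _ => ?_
            have := hy0 t
            split_ifs <;> positivity
      _ = ∏ v, (randomSubset m (A v)).expect fun B => ENNReal.ofReal
            (∏ t ∈ T with u t = v, (if t ∈ B then 1 + y t / 2 else 1 + y t)) :=
          jointExpect_prod _ fun v B => ENNReal.ofReal
            (∏ t ∈ T with u t = v, (if t ∈ B then 1 + y t / 2 else 1 + y t))
      _ ≤ ∏ v, ENNReal.ofReal (∏ t ∈ T with u t = v, (1 + (1 - p) * y t)) := by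
          refine Finset.prod_le_prod' fun v _ => ?_
          refine expect_randomSubset_le hp ?_ (hM v) hy0
          intro t ht
          obtain ⟨htT, rfl⟩ := Finset.mem_filter.1 ht
          exact (hu t htT).1
      _ = forwardWeight M T (α * (1 - p) ^ (R + 1)) A := by
          have h1 : 0 ≤ 1 - p := by linarith
          rw [← ENNReal.ofReal_prod_of_nonneg, Finset.prod_fiberwise, forwardWeight, if_pos hM]
          · congr 1
            refine Finset.prod_congr rfl fun t _ => ?_
            simp only [hy, hβ]
            ring
          · intro v _
            refine Finset.prod_nonneg fun t _ => ?_
            have := mul_nonneg h1 (hy0 t)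
            positivity
  refine (ev_mono (g := g 0) (fun A => ?_) _ _).trans
    ((ev_iter g _ hstep _ fun v => keep (A v)).trans ?_)
  · by_cases hA : inv A
    · simp only [g, if_pos hA, pow_zero, mul_one]
      exact hF A hA
    · simp only [g, if_neg hA, le_top]
  · simp only [g, if_pos hA, le_refl]

end PriorityForward

/-! ## Uniform random functions -/

theorem uniformOfFintype_fin_succ (W : Type) [Fintype W] [Nonempty W] (k : ℕ) :
    PMF.uniformOfFintype (Fin (k + 1) → W) = (PMF.uniformOfFintype W).bind fun x =>
      (PMF.uniformOfFintype (Fin k → W)).map fun ρ => Fin.cons x ρ := by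
  classical
  ext f
  rw [PMF.bind_apply, tsum_eq_single (f 0), PMF.map_apply, tsum_eq_single fun i => f i.succ]
  · rw [if_pos (show f = Fin.cons (f 0) fun i => f i.succ from (Fin.cons_self_tail f).symm)]
    simp only [PMF.uniformOfFintype_apply, Fintype.card_fun, Fintype.card_fin, Nat.cast_pow]
    rw [pow_succ', ENNReal.mul_inv (by left; simp) (by left; simp)]
  · intro ρ hρ
    rw [if_neg]
    intro h
    refine hρ (funext fun i => ?_)
    rw [h, Fin.cons_succ]
  · intro x hx
    rw [PMF.map_apply]
    simp only [mul_eq_zero, ENNReal.tsum_eq_zero]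
    right
    intro ρ
    rw [if_neg]
    rintro rfl
    exact hx (by simp)

/-- Successive independent uniform draws form one uniform random function; together with
`jointExpect_uniform` and `expect_uniform_curry` this gives a single uniform function on all blocks
of the network, the sample space of the lottery. -/
theorem Prog.head_mapM_sample {W β γ : Type} [Fintype W] [Nonempty W] (g : W → β → γ) (l : List β) :
    Prog.head (l.mapM fun b => Prog.sample (PMF.uniformOfFintype W) >>= fun ρ =>
      (pure (g ρ b) : Prog γ)) = (PMF.uniformOfFintype (Fin l.length → W)).map fun ρ =>
        Sum.inl (List.ofFn fun i => g (ρ i) l[i]) := by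
  induction l with
  | nil =>
    simp only [List.mapM_nil, Prog.pure_def, Prog.head]
    rw [show (fun ρ : Fin ([] : List β).length → W => (Sum.inl (List.ofFn fun i : Fin ([] : List β).length
      => g (ρ i) ([] : List β)[i]) : Prog.Head (List γ))) = fun _ => Sum.inl [] from rfl]
    exact (PMF.map_const _ _).symm
  | cons a l ih =>
    rw [List.mapM_cons]
    simp only [Prog.bind_def, Prog.pure_def, Prog.sample, Prog.bind, Prog.head]
    simp only [Prog.bind_def, Prog.pure_def, Prog.sample, Prog.bind] at ih
    simp only [Prog.head_bind, ih]
    rw [show PMF.uniformOfFintype (Fin (a :: l).length → W) = _ from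
      uniformOfFintype_fin_succ W l.length, PMF.map_bind]
    congr 1
    funext x
    rw [PMF.map_comp, PMF.bind_map, PMF.map]
    congr 1
    funext ρ
    simp only [Function.comp_apply, Prog.Head.bind, Prog.head]
    rw [List.ofFn_succ]
    rfl

theorem jointExpect_uniform {γ : Type*} {n : ℕ} (T : Fin n → Type) [∀ v, Fintype (T v)]
    [∀ v, Nonempty (T v)] (j : ∀ v, T v → γ) (g : (Fin n → γ) → ℝ≥0∞) :
    jointExpect n (fun v => (PMF.uniformOfFintype (T v)).map (j v)) g =
      (PMF.uniformOfFintype (∀ v, T v)).expect fun ρ => g fun v => j v (ρ v) := by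
  induction n with
  | zero =>
    rw [jointExpect, PMF.expect_uniformOfFintype]
    simp
    exact congrArg g (Subsingleton.elim _ _)
  | succ n ih =>
    simp only [jointExpect]
    rw [PMF.expect_map]
    simp only [ih (fun v => T v.succ) (fun v => j v.succ), PMF.expect_uniformOfFintype]
    rw [← (Fin.consEquiv T).sum_comp, Fintype.sum_prod_type, ← Finset.mul_sum, ← mul_assoc]
    have hcard : Fintype.card (∀ v, T v) =
        Fintype.card (T 0) * Fintype.card (∀ v : Fin n, T v.succ) := by
      rw [Fintype.card_pi, Fin.prod_univ_succ, Fintype.card_pi]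
    rw [hcard, Nat.cast_mul, ENNReal.mul_inv (by left; simp) (by left; simp)]
    congr 1
    refine Finset.sum_congr rfl fun x _ => Finset.sum_congr rfl fun ρ _ => congrArg g ?_
    funext v
    refine Fin.cases ?_ (fun i => ?_) v
    · simp [Fin.consEquiv]
    · simp [Fin.consEquiv]

theorem expect_uniform_curry {ι : Type} [Fintype ι] (κ : ι → Type) [∀ i, Fintype (κ i)]
    [DecidableEq ι] [∀ i, DecidableEq (κ i)]
    (W : Type) [Fintype W] [Nonempty W] (g : (∀ i, κ i → W) → ℝ≥0∞) :
    (PMF.uniformOfFintype (∀ i, κ i → W)).expect g =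
      (PMF.uniformOfFintype ((Σ i, κ i) → W)).expect fun ρ => g fun i k => ρ ⟨i, k⟩ := by
  rw [PMF.expect_uniformOfFintype, PMF.expect_uniformOfFintype,
    ← (Equiv.piCurry fun (i : ι) (_ : κ i) => W).sum_comp,
    Fintype.card_congr (Equiv.piCurry fun (i : ι) (_ : κ i) => W).symm]
  rfl

/-! ## The lottery -/

section Lottery

variable {ι : Type} [Fintype ι] [DecidableEq ι]

/-- Independence of the draws as a count without division; only sets `J` of one or two elements are
needed, for the first two moments. -/
theorem card_filter_forall_lt (H θ : ℕ) (hθ : θ ≤ H) (J : Finset ι) :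
    ((Finset.univ.filter fun ρ : ι → Fin H => ∀ i ∈ J, (ρ i).val < θ).card) * H ^ J.card =
      θ ^ J.card * H ^ Fintype.card ι := by
  have h1 : (Finset.univ.filter fun ρ : ι → Fin H => ∀ i ∈ J, (ρ i).val < θ) =
      Fintype.piFinset fun i => if i ∈ J then Finset.univ.filter fun x : Fin H => x.val < θ
        else Finset.univ := by
    ext ρ
    simp only [Finset.mem_filter, Finset.mem_univ, true_and, Fintype.mem_piFinset]
    refine forall_congr' fun i => ?_
    split_ifs with h <;> simp [h]
  have h2 : (Finset.univ.filter fun x : Fin H => x.val < θ).card = θ := by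
    rw [Fin.card_filter_val_lt, min_eq_right hθ]
  rw [h1, Fintype.card_piFinset]
  simp only [apply_ite Finset.card, h2, Finset.card_univ, Fintype.card_fin]
  rw [Finset.prod_ite, Finset.prod_const, Finset.prod_const, Finset.filter_mem_eq_inter,
    Finset.univ_inter, mul_assoc, ← pow_add]
  congr 2
  have := Finset.card_filter_add_card_filter_not (s := (Finset.univ : Finset ι)) (fun i => i ∈ J)
  rw [Finset.filter_mem_eq_inter, Finset.univ_inter, Finset.card_univ] at this
  omega

/-- The position of a number in the order of random numbers, where ties count as lost. -/
def lotteryRank {H : ℕ} (ρ : ι → Fin H) (q : ι) : ℕ :=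
  (Finset.univ.filter fun q' => q' ≠ q ∧ ρ q' ≤ ρ q).card

/-- A second moment argument with threshold `θ`, where `p = θ / H`: some member of `C` should fall
below it, while at most `s` numbers do so in total. Collisions within `C` cost `|C| p`, and
overcrowding costs `|ι| p / s`. -/
theorem sum_lottery_ge {H θ s : ℕ} (hs : 0 < s) (hH : 0 < H) (hθ : θ ≤ H) (C : Finset ι) :
    (H : ℝ) ^ Fintype.card ι * (C.card * (θ / H : ℝ) *
      (1 - C.card * (θ / H : ℝ) - Fintype.card ι * (θ / H : ℝ) / s)) ≤
      ∑ ρ : ι → Fin H, if ∃ q ∈ C, lotteryRank ρ q < s then (1 : ℝ) else 0 := by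
  have hs' : (0 : ℝ) < s := by exact_mod_cast hs
  have hH' : (0 : ℝ) < H := by exact_mod_cast hH
  set p : ℝ := θ / H with hp
  have hp0 : 0 ≤ p := by positivity
  set X : ι → (ι → Fin H) → ℝ := fun q ρ => if (ρ q).val < θ then 1 else 0 with hX
  have hcount : ∀ J : Finset ι, ∑ ρ : ι → Fin H, (if ∀ i ∈ J, (ρ i).val < θ then (1 : ℝ) else 0) =
      (H : ℝ) ^ Fintype.card ι * p ^ J.card := by
    intro J
    rw [Finset.sum_boole, hp, div_pow]
    have := card_filter_forall_lt H θ hθ J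
    have h' : (((Finset.univ.filter fun ρ : ι → Fin H => ∀ i ∈ J, (ρ i).val < θ).card : ℕ) : ℝ) *
        H ^ J.card = θ ^ J.card * H ^ Fintype.card ι := by exact_mod_cast this
    field_simp
    linarith
  have hX1 : ∀ q, ∑ ρ, X q ρ = (H : ℝ) ^ Fintype.card ι * p := by
    intro q
    have := hcount {q}
    simpa [hX] using this
  have hX2 : ∀ q q', q' ≠ q → ∑ ρ, X q ρ * X q' ρ = (H : ℝ) ^ Fintype.card ι * p ^ 2 := by
    intro q q' hne
    have := hcount {q, q'}
    rw [Finset.card_pair hne.symm] at this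
    rw [← this]
    refine Finset.sum_congr rfl fun ρ _ => ?_
    by_cases h1 : (ρ q).val < θ <;> by_cases h2 : (ρ q').val < θ <;> simp [hX, h1, h2]
  -- With `Z` and `Y` the sets of numbers below the threshold in `C` and overall, the left side is
  -- `|Z| (1 - (|Z| - 1) - (|Y| - 1) / s)`. It is at most zero unless `|Z| = 1`, and then it is
  -- positive only if `|Y| ≤ s`, in which case the single member of `Z` wins.
  have hpoint : ∀ ρ : ι → Fin H, ∑ q ∈ C, (X q ρ - (∑ q' ∈ C.erase q, X q ρ * X q' ρ) -
      (∑ q' ∈ Finset.univ.erase q, X q ρ * X q' ρ) / s) ≤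
      if ∃ q ∈ C, lotteryRank ρ q < s then (1 : ℝ) else 0 := by
    intro ρ
    set Z := C.filter fun q => (ρ q).val < θ with hZ
    set Y := Finset.univ.filter fun q => (ρ q).val < θ with hY
    have hZY : Z ⊆ Y := fun q hq => by
      simp only [hZ, hY, Finset.mem_filter, Finset.mem_univ, true_and] at hq ⊢
      exact hq.2
    have hsum : ∀ D : Finset ι, ∑ q ∈ D, X q ρ = ((D.filter fun q => (ρ q).val < θ).card : ℝ) := by
      intro D; simp [hX]
    have hterm : ∀ q ∈ C, X q ρ - (∑ q' ∈ C.erase q, X q ρ * X q' ρ) -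
        (∑ q' ∈ Finset.univ.erase q, X q ρ * X q' ρ) / s =
        X q ρ * (1 - (Z.card - 1) - (Y.card - 1) / s) := by
      intro q hq
      rw [← Finset.mul_sum, ← Finset.mul_sum]
      by_cases h : (ρ q).val < θ
      · have h1 : X q ρ = 1 := by simp [hX, h]
        have e1 := Finset.add_sum_erase C (fun q => X q ρ) hq
        have e2 := Finset.add_sum_erase Finset.univ (fun q => X q ρ) (Finset.mem_univ q)
        have e3 := hsum C
        have e4 := hsum Finset.univ
        rw [← hZ] at e3
        rw [← hY] at e4
        rw [h1, ← e3, ← e4, ← e1, ← e2, h1]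
        ring
      · have h1 : X q ρ = 0 := by simp [hX, h]
        rw [h1]; ring
    rw [Finset.sum_congr rfl hterm, ← Finset.sum_mul, hsum, ← hZ]
    have hYZ : (Z.card : ℝ) ≤ Y.card := by exact_mod_cast Finset.card_le_card hZY
    rcases Nat.lt_trichotomy Z.card 1 with h | h | h
    · have : Z.card = 0 := by omega
      rw [this]
      simp only [Nat.cast_zero, zero_mul]
      split_ifs <;> norm_num
    · rw [h] at hYZ ⊢
      push_cast at hYZ ⊢
      have hY1 : 0 ≤ ((Y.card : ℝ) - 1) / s := div_nonneg (by linarith) hs'.le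
      split_ifs with hc
      · linarith
      · have hYs : s < Y.card := by
          by_contra hcon
          push Not at hcon
          obtain ⟨q, hq⟩ := Finset.card_eq_one.1 h
          have hqZ : q ∈ Z := by rw [hq]; simp
          refine hc ⟨q, (Finset.mem_filter.1 hqZ).1, ?_⟩
          have hsub : (Finset.univ.filter fun q' => q' ≠ q ∧ ρ q' ≤ ρ q) ⊆ Y.erase q := by
            intro q' hq'
            simp only [Finset.mem_filter, Finset.mem_univ, true_and] at hq'
            refine Finset.mem_erase.2 ⟨hq'.1, Finset.mem_filter.2 ⟨Finset.mem_univ _, ?_⟩⟩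
            exact lt_of_le_of_lt (Fin.le_def.1 hq'.2) (Finset.mem_filter.1 hqZ).2
          have := Finset.card_le_card hsub
          rw [Finset.card_erase_of_mem (hZY hqZ)] at this
          have hpos := Finset.card_pos.2 ⟨q, hZY hqZ⟩
          rw [lotteryRank]
          omega
        have : (s : ℝ) + 1 ≤ Y.card := by exact_mod_cast hYs
        have : 1 ≤ ((Y.card : ℝ) - 1) / s := (one_le_div hs').2 (by linarith)
        linarith
    · have hZ2 : (2 : ℝ) ≤ Z.card := by exact_mod_cast h
      have hY1 : 0 ≤ ((Y.card : ℝ) - 1) / s := div_nonneg (by linarith) hs'.le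
      have : (Z.card : ℝ) * (1 - (Z.card - 1) - (Y.card - 1) / s) ≤ 0 :=
        mul_nonpos_of_nonneg_of_nonpos (by linarith) (by linarith)
      refine this.trans ?_
      split_ifs <;> norm_num
  refine le_trans ?_ (Finset.sum_le_sum fun ρ _ => hpoint ρ)
  rw [Finset.sum_comm]
  have hE : ∀ q ∈ C, ∑ ρ : ι → Fin H, (X q ρ - (∑ q' ∈ C.erase q, X q ρ * X q' ρ) -
      (∑ q' ∈ Finset.univ.erase q, X q ρ * X q' ρ) / s) =
      (H : ℝ) ^ Fintype.card ι * (p - (C.card - 1) * p ^ 2 - (Fintype.card ι - 1) * p ^ 2 / s) := by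
    intro q hq
    rw [Finset.sum_sub_distrib, Finset.sum_sub_distrib, ← Finset.sum_div, hX1, Finset.sum_comm,
      Finset.sum_congr rfl fun q' hq' => hX2 q q' (Finset.ne_of_mem_erase hq'),
      Finset.sum_comm (t := Finset.univ.erase q),
      Finset.sum_congr rfl fun q' hq' => hX2 q q' (Finset.ne_of_mem_erase hq'),
      Finset.sum_const, Finset.sum_const, Finset.card_erase_of_mem hq,
      Finset.card_erase_of_mem (Finset.mem_univ q), nsmul_eq_mul, nsmul_eq_mul,
      Nat.cast_sub (Finset.card_pos.2 ⟨q, hq⟩),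
      Nat.cast_sub (Finset.card_pos.2 ⟨q, Finset.mem_univ q⟩), Finset.card_univ]
    push_cast
    ring
  rw [Finset.sum_congr rfl hE, Finset.sum_const, nsmul_eq_mul]
  have hHQ : (0 : ℝ) < (H : ℝ) ^ Fintype.card ι := by positivity
  have hC0 : (0 : ℝ) ≤ C.card := by positivity
  have e : (C.card : ℝ) * ((H : ℝ) ^ Fintype.card ι *
      (p - (C.card - 1) * p ^ 2 - (Fintype.card ι - 1) * p ^ 2 / s)) =
      (H : ℝ) ^ Fintype.card ι * (C.card * p * (1 - C.card * p - Fintype.card ι * p / s)) +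
      (H : ℝ) ^ Fintype.card ι * C.card * (p ^ 2 + p ^ 2 / s) := by
    field_simp
    ring
  rw [e]
  have : 0 ≤ (H : ℝ) ^ Fintype.card ι * C.card * (p ^ 2 + p ^ 2 / s) := by positivity
  linarith

/-- If every participant draws a random number, then some member of `C` is among the first `s`
with probability at least `min 1 (s |C| / |ι|) / 32`. -/
theorem expect_lottery_le {H s : ℕ} [NeZero H] (hs : 0 < s) (hH : 8 * Fintype.card ι ≤ H)
    {C : Finset ι} (hC : C.Nonempty) (f : (ι → Fin H) → ℝ≥0∞) {a : ℝ} (ha0 : 0 ≤ a) (ha : a ≤ 1)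
    (hf : ∀ ρ, (∃ q ∈ C, lotteryRank ρ q < s) → f ρ ≤ ENNReal.ofReal (1 - a))
    (hf' : ∀ ρ, f ρ ≤ 1) :
    (PMF.uniformOfFintype (ι → Fin H)).expect f ≤
      ENNReal.ofReal (1 - a * (min 1 ((s : ℝ) * C.card / Fintype.card ι) / 32)) := by
  set Q := Fintype.card ι with hQ
  have hQpos : 0 < Q := Fintype.card_pos_iff.2 ⟨hC.choose⟩
  have hQ' : (0 : ℝ) < Q := by exact_mod_cast hQpos
  have hs' : (0 : ℝ) < s := by exact_mod_cast hs
  have hHpos : 0 < H := Nat.pos_of_ne_zero (NeZero.ne H)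
  have hH' : (0 : ℝ) < H := by exact_mod_cast hHpos
  set η : ℝ := min 1 ((s : ℝ) * C.card / Q) / 32 with hη
  have hη1 : η ≤ 1 / 32 := div_le_div_of_nonneg_right (min_le_left _ _) (by norm_num)
  -- enough winning outcomes
  have key : (H : ℝ) ^ Q * η ≤
      ∑ ρ : ι → Fin H, if ∃ q ∈ C, lotteryRank ρ q < s then (1 : ℝ) else 0 := by
    rcases le_or_gt Q s with hQs | hQs
    · have : ∀ ρ : ι → Fin H, ∃ q ∈ C, lotteryRank ρ q < s := by
        intro ρ
        obtain ⟨q, hq⟩ := hC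
        refine ⟨q, hq, lt_of_lt_of_le ?_ hQs⟩
        rw [lotteryRank, hQ, ← Finset.card_univ]
        exact Finset.card_lt_card (Finset.ssubset_univ_iff.2 fun h => by
          have := h ▸ Finset.mem_univ q
          simp at this)
      simp only [this, if_true, Finset.sum_const, Finset.card_univ, Fintype.card_fun,
        Fintype.card_fin, nsmul_eq_mul, mul_one]
      push_cast
      rw [← hQ]
      have : (0 : ℝ) < (H : ℝ) ^ Q := by positivity
      nlinarith
    -- Thinning `C` to at most `Q / s` members keeps the collision term below `1/4` when `C` is very
    -- large.
    · set c := min C.card (Q / s) with hc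
      obtain ⟨C', hC', hcard⟩ := Finset.exists_subset_card_eq (show c ≤ C.card from min_le_left _ _)
      -- About `s / 4` numbers are expected below this threshold. The assumption `8 Q ≤ H` controls
      -- the rounding: `p` lies between `s / (8 Q)` and `s / (4 Q)`.
      set θ := H * s / (4 * Q) with hθ
      have hθH : θ ≤ H := by
        rw [hθ]
        refine Nat.div_le_of_le_mul ?_
        nlinarith
      have hsum := sum_lottery_ge hs hHpos hθH C'
      have hle : (∑ ρ : ι → Fin H, if ∃ q ∈ C', lotteryRank ρ q < s then (1 : ℝ) else 0) ≤
          ∑ ρ : ι → Fin H, if ∃ q ∈ C, lotteryRank ρ q < s then (1 : ℝ) else 0 := by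
        refine Finset.sum_le_sum fun ρ _ => ?_
        by_cases h : ∃ q ∈ C', lotteryRank ρ q < s
        · obtain ⟨q, hq, hr⟩ := h
          rw [if_pos ⟨q, hq, hr⟩, if_pos ⟨q, hC' hq, hr⟩]
        · rw [if_neg h]; split_ifs <;> norm_num
      refine le_trans ?_ (hsum.trans hle)
      rw [hcard, ← hQ]
      refine mul_le_mul_of_nonneg_left ?_ (by positivity)
      set p : ℝ := θ / H with hp
      have hp0 : 0 ≤ p := by positivity
      have hpu : p * (4 * Q) ≤ s := by
        have h1 : θ * (4 * Q) ≤ H * s := Nat.div_mul_le_self _ _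
        have h2 : (θ : ℝ) * (4 * Q) ≤ H * s := by exact_mod_cast h1
        rw [hp, div_mul_eq_mul_div, div_le_iff₀ hH']
        linarith
      have hpl : (s : ℝ) ≤ p * (8 * Q) := by
        have h1 : H * s < (θ + 1) * (4 * Q) := by
          rw [hθ]
          exact Nat.lt_mul_of_div_lt (Nat.lt_succ_self _) (by omega)
        have h2 : (H : ℝ) * s ≤ (θ + 1) * (4 * Q) := by exact_mod_cast h1.le
        have h3 : (8 : ℝ) * Q ≤ H * s := by
          have : 8 * Q ≤ H * s := hH.trans (Nat.le_mul_of_pos_right H hs)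
          exact_mod_cast this
        rw [hp, div_mul_eq_mul_div, le_div_iff₀ hH']
        linarith
      have hcs : (c : ℝ) * s ≤ Q := by
        have : c * s ≤ Q := (Nat.mul_le_mul_right s (min_le_right _ _)).trans (Nat.div_mul_le_self _ _)
        exact_mod_cast this
      have hcl : η * 16 * Q ≤ c * s := by
        rcases le_total C.card (Q / s) with h | h
        · rw [hc, min_eq_left h]
          have h1 : η * 32 ≤ s * C.card / Q := by
            rw [hη]; linarith [min_le_right (1 : ℝ) (s * C.card / Q)]
          rw [le_div_iff₀ hQ'] at h1
          have : (0 : ℝ) ≤ C.card * s := by positivity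
          nlinarith
        · rw [hc, min_eq_right h]
          have h1 : 1 ≤ Q / s := (Nat.one_le_div_iff hs).2 hQs.le
          have h2 : Q < (Q / s + 1) * s := Nat.lt_mul_of_div_lt (Nat.lt_succ_self _) hs
          have h3 : Q ≤ 2 * (Q / s * s) := by nlinarith
          have h4 : (Q : ℝ) ≤ 2 * (((Q / s : ℕ) : ℝ) * s) := by exact_mod_cast h3
          nlinarith
      have hcp : (c : ℝ) * p ≤ 1 / 4 := by
        have : (c : ℝ) * (p * (4 * Q)) ≤ c * s := mul_le_mul_of_nonneg_left hpu (by positivity)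
        nlinarith
      have hQp : (Q : ℝ) * p / s ≤ 1 / 4 := by
        rw [div_le_iff₀ hs']
        linarith
      have hcp0 : 0 ≤ (c : ℝ) * p := by positivity
      have h5 : η ≤ c * p / 2 := by
        have : (c : ℝ) * s ≤ c * (p * (8 * Q)) := mul_le_mul_of_nonneg_left hpl (by positivity)
        nlinarith
      nlinarith
  rw [PMF.expect_uniformOfFintype]
  have hbound : ∀ ρ, f ρ ≤ ENNReal.ofReal
      (1 - a * if ∃ q ∈ C, lotteryRank ρ q < s then (1 : ℝ) else 0) := by
    intro ρ
    split_ifs with h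
    · rw [mul_one]; exact hf ρ h
    · simpa using hf' ρ
  refine (mul_le_mul_right (Finset.sum_le_sum fun ρ _ => hbound ρ) _).trans ?_
  rw [← ENNReal.ofReal_sum_of_nonneg (by intro ρ _; split_ifs <;> linarith), mul_comm,
    ← div_eq_mul_inv]
  refine ENNReal.div_le_of_le_mul ?_
  rw [← ENNReal.ofReal_natCast, mul_comm, ← ENNReal.ofReal_mul (by positivity)]
  refine ENNReal.ofReal_le_ofReal ?_
  rw [Finset.sum_sub_distrib, ← Finset.mul_sum]
  simp only [Finset.sum_const, Finset.card_univ, Fintype.card_fun, Fintype.card_fin, nsmul_eq_mul,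
    mul_one]
  push_cast
  rw [← hQ]
  nlinarith

end Lottery

/-! ### Standing assumptions and the priorities of blocks -/

namespace PriorityForward

open Prog

/-- What the nodes may rely on. -/
structure Setting (P : Params) (n : ℕ) (uid : Fin n → ℕ) : Prop where
  two_le : 2 ≤ n
  le_N : n ≤ P.N
  N_le : P.N ≤ 2 * n
  injective : Function.Injective uid
  uid_lt : ∀ v, uid v < n ^ P.a
  one_le_b : 1 ≤ P.b
  d_le : P.d ≤ P.b
  L_cube_le : P.L ^ 3 ≤ 64 * P.b
  le_κ : 64 ≤ P.κ

variable {P : Params} {n : ℕ} [NeZero n] {uid : Fin n → ℕ}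

theorem N_lt (P : Params) : P.N < 2 ^ P.L := Nat.lt_pow_succ_log_self one_lt_two P.N

theorem Setting.uid_lt_two_pow (S : Setting P n uid) (v : Fin n) : uid v < 2 ^ (P.a * P.L) := by
  refine (S.uid_lt v).trans_le ?_
  rw [mul_comm, pow_mul]
  exact Nat.pow_le_pow_left (S.le_N.trans (N_lt P).le) _

/-! ## Priorities -/

/-- The priority of block number `i` of a node, with the random bits `ρ`. -/
def prioKey (P : Params) (uid i : ℕ) (ρ : Word (8 * P.L)) : P.Key :=
  P.key ((ρ.val * 2 ^ (P.a * P.L) + uid) * 2 ^ P.L + i)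

theorem val_prioKey {u i : ℕ} (hu : u < 2 ^ (P.a * P.L)) (hi : i < 2 ^ P.L)
    (ρ : Word (8 * P.L)) :
    (prioKey P u i ρ).val = (ρ.val * 2 ^ (P.a * P.L) + u) * 2 ^ P.L + i := by
  rw [prioKey, Params.key, Fin.val_ofNat, Nat.mod_eq_of_lt]
  have h1 : ρ.val * 2 ^ (P.a * P.L) + u < 2 ^ (8 * P.L) * 2 ^ (P.a * P.L) := by
    have := Nat.mul_le_mul_right (2 ^ (P.a * P.L)) (Nat.succ_le_of_lt ρ.isLt)
    rw [Nat.succ_eq_add_one, Nat.add_mul, one_mul] at this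
    omega
  rw [Params.w, pow_add, pow_add]
  have := Nat.mul_le_mul_right (2 ^ P.L) (Nat.succ_le_of_lt h1)
  rw [Nat.succ_eq_add_one, Nat.add_mul _ 1, one_mul] at this
  omega

theorem prioKey_lt {u i u' i' : ℕ} (hu : u < 2 ^ (P.a * P.L)) (hi : i < 2 ^ P.L)
    (hu' : u' < 2 ^ (P.a * P.L)) (hi' : i' < 2 ^ P.L) {ρ ρ' : Word (8 * P.L)} (h : ρ < ρ') :
    prioKey P u i ρ < prioKey P u' i' ρ' := by
  rw [Fin.lt_def, val_prioKey hu hi, val_prioKey hu' hi']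
  have h1 := Nat.mul_le_mul_right (2 ^ (P.a * P.L)) (Nat.succ_le_of_lt (Fin.lt_def.1 h))
  rw [Nat.succ_eq_add_one, Nat.add_mul, one_mul] at h1
  have h2 : ρ.val * 2 ^ (P.a * P.L) + u + 1 ≤ ρ'.val * 2 ^ (P.a * P.L) + u' := by omega
  have h3 := Nat.mul_le_mul_right (2 ^ P.L) h2
  rw [Nat.add_mul _ 1, one_mul] at h3
  omega

/-- Identifier and position are the low-order digits of the key, so distinct blocks have distinct
priorities even when their random bits agree. -/
theorem prioKey_inj {u i u' i' : ℕ} (hu : u < 2 ^ (P.a * P.L)) (hi : i < 2 ^ P.L)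
    (hu' : u' < 2 ^ (P.a * P.L)) (hi' : i' < 2 ^ P.L) {ρ ρ' : Word (8 * P.L)}
    (h : prioKey P u i ρ = prioKey P u' i' ρ') : u = u' ∧ i = i' := by
  have h := congrArg Fin.val h
  rw [val_prioKey hu hi, val_prioKey hu' hi'] at h
  have h1 := congrArg (· % 2 ^ P.L) h
  have h2 := congrArg (· / 2 ^ P.L) h
  simp only [Nat.mul_add_mod_self_right, Nat.mod_eq_of_lt hi,
    Nat.mod_eq_of_lt hi'] at h1
  have hd : ∀ x j, j < 2 ^ P.L → (x * 2 ^ P.L + j) / 2 ^ P.L = x := fun x j hj => by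
    rw [mul_comm, Nat.mul_add_div (by positivity), Nat.div_eq_of_lt hj, add_zero]
  simp only [hd _ _ hi, hd _ _ hi'] at h2
  have h3 := congrArg (· % 2 ^ (P.a * P.L)) h2
  simp only [Nat.mul_add_mod_self_right, Nat.mod_eq_of_lt hu, Nat.mod_eq_of_lt hu'] at h3
  exact ⟨h3, h1⟩

section Keyed

variable {w : ℕ} (bs : Fin n → List (List (Word w)))

/-- The blocks of all nodes. -/
abbrev BlockIndex : Type := Σ v : Fin n, Fin (bs v).length

/-- The random bits of the priorities of all blocks. -/
abbrev Draws (P : Params) : Type := BlockIndex bs → Word (8 * P.L)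

variable (P uid) in
/-- The priority of a block. -/
def keyOf (ρ : Draws bs P) (q : BlockIndex bs) : P.Key := prioKey P (uid q.1) q.2 (ρ q)

/-- The contents of a block. -/
def blockOf (q : BlockIndex bs) : List (Word w) := (bs q.1)[q.2]

variable (P uid) in
/-- The blocks of a node with their priorities. -/
def keyedBlocks (ρ : Draws bs P) (v : Fin n) : List (P.Key × List (Word w)) :=
  List.ofFn fun i => (keyOf P uid bs ρ ⟨v, i⟩, blockOf bs ⟨v, i⟩)

variable (P uid) in
/-- The words in the blocks whose priorities are in `c`. -/
def delivered (ρ : Draws bs P) (c : Finset P.Key) : Finset (Word w) :=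
  (Finset.univ.filter fun q => keyOf P uid bs ρ q ∈ c).biUnion fun q => (blockOf bs q).toFinset

variable (P uid) in
/-- All priorities. -/
def allKeys (ρ : Draws bs P) : Finset P.Key := Finset.univ.image (keyOf P uid bs ρ)

variable {bs}

theorem mem_delivered {ρ : Draws bs P} {c : Finset P.Key} {x : Word w} :
    x ∈ delivered P uid bs ρ c ↔ ∃ q, keyOf P uid bs ρ q ∈ c ∧ x ∈ blockOf bs q := by
  simp [delivered]

theorem mem_keyedBlocks {ρ : Draws bs P} {v : Fin n} {B : P.Key × List (Word w)} :
    B ∈ keyedBlocks P uid bs ρ v ↔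
      ∃ i, B = (keyOf P uid bs ρ ⟨v, i⟩, blockOf bs ⟨v, i⟩) := by
  simp [keyedBlocks, List.mem_ofFn, eq_comm]

theorem biUnion_keyedBlocks (ρ : Draws bs P) :
    (Finset.univ.biUnion fun v => ((keyedBlocks P uid bs ρ v).map Prod.fst).toFinset) =
      allKeys P uid bs ρ := by
  ext k
  simp only [Finset.mem_biUnion, Finset.mem_univ, true_and, List.mem_toFinset, List.mem_map,
    mem_keyedBlocks, allKeys, Finset.mem_image]
  constructor
  · rintro ⟨v, B, ⟨i, rfl⟩, rfl⟩
    exact ⟨⟨v, i⟩, rfl⟩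
  · rintro ⟨⟨v, i⟩, rfl⟩
    exact ⟨v, _, ⟨i, rfl⟩, rfl⟩

theorem ev_assignPriorities (f : (Fin n → List (P.Key × List (Word w))) → ℝ≥0∞) :
    ev f 0 (fun v => assignPriorities P (uid v) (bs v)) =
      (PMF.uniformOfFintype (Draws bs P)).expect fun ρ => f (keyedBlocks P uid bs ρ) := by
  have h : ∀ v, head (assignPriorities P (uid v) (bs v)) =
      (PMF.uniformOfFintype (Fin (bs v).length → Word (8 * P.L))).map fun ρ =>
        Sum.inl (List.ofFn fun i => (prioKey P (uid v) i (ρ i), (bs v)[i])) := by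
    intro v
    have := head_mapM_sample (W := Word (8 * P.L))
      (fun ρ (B : List (Word w) × ℕ) => (prioKey P (uid v) B.2 ρ, B.1)) (bs v).zipIdx
    refine this.trans ?_
    have hl : (bs v).zipIdx.length = (bs v).length := by simp
    have hgen : ∀ (k : ℕ) (hk : k = (bs v).length),
        (PMF.uniformOfFintype (Fin k → Word (8 * P.L))).map (fun ρ => (Sum.inl (List.ofFn
          fun i : Fin k => (prioKey P (uid v) i (ρ i), (bs v)[i.val])) :
            Head (List (P.Key × List (Word w))))) =
        (PMF.uniformOfFintype (Fin (bs v).length → Word (8 * P.L))).map fun ρ =>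
          Sum.inl (List.ofFn fun i => (prioKey P (uid v) i (ρ i), (bs v)[i])) := by
      rintro k rfl
      rfl
    rw [← hgen _ hl]
    simp
  simp only [ev, h]
  rw [jointExpect_uniform (fun v => Fin (bs v).length → Word (8 * P.L)), expect_uniform_curry]
  simp only [joinHeads_inl]
  rfl

theorem keyOf_injective (S : Setting P n uid) (hbs : ∀ v, (bs v).length ≤ P.N)
    (ρ : Draws bs P) : Function.Injective (keyOf P uid bs ρ) := by
  rintro ⟨v, i⟩ ⟨v', i'⟩ h
  have hi : i.val < 2 ^ P.L := (i.isLt.trans_le (hbs v)).trans (N_lt P)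
  have hi' : i'.val < 2 ^ P.L := (i'.isLt.trans_le (hbs v')).trans (N_lt P)
  obtain ⟨h1, h2⟩ := prioKey_inj (S.uid_lt_two_pow v) hi (S.uid_lt_two_pow v') hi' h
  obtain rfl := S.injective h1
  obtain rfl := Fin.ext h2
  rfl

/-- The lottery counts every tie as lost, whereas the keys break ties by identifier and position;
the true rank is therefore at most the lottery rank. -/
theorem mem_smallest_of_lotteryRank_lt (S : Setting P n uid) (hbs : ∀ v, (bs v).length ≤ P.N)
    {ρ : Draws bs P} {q : BlockIndex bs} {s : ℕ}
    (h : lotteryRank ρ q < s) : keyOf P uid bs ρ q ∈ smallest s (allKeys P uid bs ρ) := by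
  refine mem_smallest.2 ⟨Finset.mem_image_of_mem _ (Finset.mem_univ q), lt_of_le_of_lt ?_ h⟩
  rw [lotteryRank]
  refine (Finset.card_le_card (t := (Finset.univ.filter fun q' =>
    q' ≠ q ∧ ρ q' ≤ ρ q).image (keyOf P uid bs ρ)) fun k hk => ?_).trans Finset.card_image_le
  obtain ⟨hk, hlt⟩ := Finset.mem_filter.1 hk
  obtain ⟨q', -, rfl⟩ := Finset.mem_image.1 hk
  refine Finset.mem_image_of_mem _ (Finset.mem_filter.2 ⟨Finset.mem_univ _, ?_, ?_⟩)
  · rintro rfl; exact lt_irrefl _ hlt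
  · by_contra hcon
    have hi : ∀ q : BlockIndex bs, q.2.val < 2 ^ P.L := fun q =>
      (q.2.isLt.trans_le (hbs q.1)).trans (N_lt P)
    exact lt_asymm hlt (prioKey_lt (S.uid_lt_two_pow _) (hi _) (S.uid_lt_two_pow _) (hi _)
      (not_le.1 hcon))

/-- One iteration: the blocks selected by the indexing scheme are delivered to all nodes, up to a
small probability of failure. -/
theorem ev_select_broadcast (S : Setting P n uid) (hbs : ∀ v, (bs v).length ≤ P.N)
    {s m : ℕ} (hlen : ∀ v, ∀ B ∈ bs v, B.length ≤ m)
    (index : Fin n → Finset P.Key → Prog (Finset P.Key)) (T : ℕ)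
    (f : (Fin n → Option (Finset (Word w))) → ℝ≥0∞) (X : Draws bs P → ℝ≥0∞)
    (hX : ∀ (ρ : Draws bs P) (h : (Fin n → Finset P.Key) → ℝ≥0∞),
      (∀ c ⊆ allKeys P uid bs ρ, c.card ≤ s → (h fun _ => c) ≤
        (f fun _ => some (delivered P uid bs ρ c)) +
          codingError n s (P.κ * P.N) * ((f fun _ => none) -
            f fun _ => some (delivered P uid bs ρ c))) →
      ev h T (fun v => index v ((keyedBlocks P uid bs ρ v).map Prod.fst).toFinset) ≤ X ρ) :
    ev f (T + (P.κ * P.N + P.N)) (fun v => do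
      let bs ← assignPriorities P (uid v) (bs v)
      let chosen ← index v (bs.map Prod.fst).toFinset
      indexedBroadcast P s m w chosen.card fun i =>
        (chosen.sort (· ≤ ·))[i.val]?.bind fun q => (bs.find? fun B => B.1 = q).map Prod.snd) ≤
      (PMF.uniformOfFintype (Draws bs P)).expect X := by
  classical
  rw [← zero_add (T + _)]
  refine (ev_bind _ _ _ _ _).trans ?_
  rw [ev_assignPriorities]
  refine PMF.expect_mono fun ρ => ?_
  refine (ev_bind _ _ _ _ _).trans (hX ρ _ fun c hc hcs => ?_)
  have hinj := keyOf_injective S hbs ρ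
  -- the contents of the block with index `i`
  let B : Fin s → List (Word w) := fun i => match (c.sort (· ≤ ·))[i.val]? with
    | some k => if h : ∃ q, keyOf P uid bs ρ q = k then blockOf bs h.choose else []
    | none => []
  have hB : ∀ (i : Fin s) (q : BlockIndex bs),
      (c.sort (· ≤ ·))[i.val]? = some (keyOf P uid bs ρ q) → B i = blockOf bs q := by
    intro i q hq
    have hex : ∃ q', keyOf P uid bs ρ q' = keyOf P uid bs ρ q := ⟨q, rfl⟩
    simp only [B, hq, dif_pos hex]
    rw [hinj hex.choose_spec]
  have hsort : ∀ i : Fin s, i.val < c.card → ∃ q, keyOf P uid bs ρ q ∈ c ∧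
      (c.sort (· ≤ ·))[i.val]? = some (keyOf P uid bs ρ q) := by
    intro i hi
    have hi' : i.val < (c.sort (· ≤ ·)).length := by rwa [Finset.length_sort]
    have hmem : (c.sort (· ≤ ·))[i.val] ∈ c := (Finset.mem_sort _).1 (List.getElem_mem hi')
    obtain ⟨q, -, hq⟩ := Finset.mem_image.1 (hc hmem)
    exact ⟨q, hq ▸ hmem, by rw [List.getElem?_eq_getElem hi', hq]⟩
  -- Keys determine blocks across the whole network, so whatever a node finds under the selected key
  -- is the intended block.
  have hown : ∀ (v : Fin n) (i : Fin s) (b : List (Word w)),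
      ((c.sort (· ≤ ·))[i.val]?.bind fun q =>
        ((keyedBlocks P uid bs ρ v).find? fun B => B.1 = q).map Prod.snd) = some b → b = B i := by
    intro v i b hb
    obtain ⟨k, hk, hb⟩ := Option.bind_eq_some_iff.1 hb
    obtain ⟨⟨k', b'⟩, hf, rfl⟩ := Option.map_eq_some_iff.1 hb
    obtain ⟨j, hj⟩ := mem_keyedBlocks.1 (List.mem_of_find?_eq_some hf)
    have hkk : k' = k := by simpa using List.find?_some hf
    obtain ⟨rfl, rfl⟩ := Prod.mk.inj hj
    exact (hB i ⟨v, j⟩ (by rw [hk, hkk])).symm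
  have key := ev_indexedBroadcast (m := m) P S.le_N c.card B
    (fun v i => (c.sort (· ≤ ·))[i.val]?.bind fun q =>
        ((keyedBlocks P uid bs ρ v).find? fun B => B.1 = q).map Prod.snd) hown ?_ ?_ f
  · refine key.trans (le_of_eq ?_)
    have hset : ((Finset.univ.filter fun i : Fin s => i.val < c.card).biUnion fun i =>
        (B i).toFinset) = delivered P uid bs ρ c := ?_
    · rw [hset]
    ext x
    simp only [Finset.mem_biUnion, Finset.mem_filter, Finset.mem_univ, true_and, List.mem_toFinset,
      mem_delivered]
    constructor
    · rintro ⟨i, hi, hx⟩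
      obtain ⟨q, hq, hq'⟩ := hsort i hi
      exact ⟨q, hq, hB i q hq' ▸ hx⟩
    · rintro ⟨q, hq, hx⟩
      obtain ⟨i, hi, hi'⟩ := List.getElem_of_mem ((Finset.mem_sort (· ≤ ·)).2 hq)
      have hic : i < c.card := by rwa [Finset.length_sort] at hi
      refine ⟨⟨i, hic.trans_le hcs⟩, hic, ?_⟩
      rw [hB ⟨i, hic.trans_le hcs⟩ q (by rw [List.getElem?_eq_getElem hi, hi'])]
      exact hx
  · intro i hi
    obtain ⟨⟨v, j⟩, -, hq⟩ := hsort i hi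
    refine ⟨v, ?_⟩
    have hsome : ((c.sort (· ≤ ·))[i.val]?.bind fun q =>
        ((keyedBlocks P uid bs ρ v).find? fun B => B.1 = q).map Prod.snd).isSome := by
      rw [hq]
      simp only [Option.bind_some, Option.isSome_map, List.find?_isSome]
      exact ⟨_, mem_keyedBlocks.2 ⟨j, rfl⟩, by simp⟩
    obtain ⟨b, hb⟩ := Option.isSome_iff_exists.1 hsome
    exact hb.trans (congrArg some (hown v i b hb))
  · intro i hi
    obtain ⟨⟨v, j⟩, -, hq⟩ := hsort i hi
    rw [hB i _ hq]
    exact hlen v _ (List.getElem_mem _)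

end Keyed

end PriorityForward

namespace PriorityForward

open Prog

variable {P : Params} {n : ℕ} [NeZero n] {uid : Fin n → ℕ}

/-! ## The parameters -/

theorem Setting.m_pos (S : Setting P n uid) : 0 < P.m := by
  have h1 := S.one_le_b
  have h2 := S.d_le
  exact Nat.div_pos (max_le h2 h1) (by omega)

theorem Setting.N_pos (S : Setting P n uid) : 0 < P.N := by
  have h1 := S.two_le
  have h2 := S.le_N
  omega

theorem Setting.s_pos (S : Setting P n uid) : 0 < P.s := lt_min S.one_le_b S.N_pos

theorem s_le_N (P : Params) : P.s ≤ P.N := min_le_right _ _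

theorem m'_pos (P : Params) : 0 < P.m' := lt_of_lt_of_le one_pos (le_max_left _ _)

theorem Setting.s'_pos (S : Setting P n uid) : 0 < P.s' := lt_min (m'_pos P) S.N_pos

theorem s'_le_N (P : Params) : P.s' ≤ P.N := min_le_right _ _

theorem b_le (P : Params) : P.b ≤ 2 * P.m' * P.L := by
  have hL : 0 < P.L := Nat.succ_pos _
  have h1 : P.b < (P.b / P.L + 1) * P.L := by
    have := Nat.lt_div_mul_add (a := P.b) hL
    rw [Nat.add_mul, one_mul]
    exact this
  have h2 : P.b / P.L + 1 ≤ 2 * P.m' := by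
    have h3 : P.b / P.L ≤ P.m' := le_max_right _ _
    have h4 := m'_pos P
    omega
  exact h1.le.trans (Nat.mul_le_mul_right _ h2)

/-- Here `b ≥ log³ n` enters the round bound: `b ≤ 2 m' L` and `L³ ≤ 64 b` give `b³ ≤ 512 m'³ b`. -/
theorem Setting.s_sq_le (S : Setting P n uid) : P.s ^ 2 ≤ 512 * P.m' ^ 3 := by
  have hb : 0 < P.b := S.one_le_b
  refine (Nat.pow_le_pow_left (min_le_left _ _ : P.s ≤ P.b) 2).trans ?_
  refine Nat.le_of_mul_le_mul_right (c := P.b) ?_ hb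
  calc P.b ^ 2 * P.b = P.b ^ 3 := by ring
    _ ≤ (2 * P.m' * P.L) ^ 3 := Nat.pow_le_pow_left (b_le P) 3
    _ = 8 * P.m' ^ 3 * P.L ^ 3 := by ring
    _ ≤ 8 * P.m' ^ 3 * (64 * P.b) := Nat.mul_le_mul_left _ S.L_cube_le
    _ = 512 * P.m' ^ 3 * P.b := by ring

/-- Enough copies of a priority suffice for the naive indexing of the blocks of priorities. -/
theorem Setting.blocks_le_copies (S : Setting P n uid) {c Q : ℕ}
    (hc : n * min P.m' P.s ≤ c * P.s) (hQ : Q * P.m' ≤ n * (P.s + P.m')) :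
    Q ≤ 1024 * (P.s' * c) := by
  have hm := m'_pos P
  have hs := S.s_pos
  have hs' := S.s'_pos
  -- If all `s` considered priorities fit into one message, the hypothesis gives at least `n`
  -- copies, and each node accounts for at most two blocks.
  rcases le_total P.s P.m' with h | h
  · rw [min_eq_right h] at hc
    have hc' : n ≤ c := Nat.le_of_mul_le_mul_right hc hs
    have : Q * P.m' ≤ (2 * n) * P.m' := by nlinarith
    have h2 := Nat.le_of_mul_le_mul_right this hm
    nlinarith
  -- Otherwise `Q` is at most `2 n s / m'` and `c` at least `n m' / s`; the quotient is controlled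
  -- by `s² ≤ 512 s' m'²`.
  · rw [min_eq_left h] at hc
    have hsm : P.s ^ 2 ≤ 512 * (P.s' * P.m' ^ 2) := by
      rcases le_total P.m' P.N with h' | h'
      · rw [Params.s', min_eq_left h']
        have := S.s_sq_le
        nlinarith
      · rw [Params.s', min_eq_right h']
        have := s_le_N P
        nlinarith
    refine Nat.le_of_mul_le_mul_right (c := P.m' * P.s) ?_ (by positivity)
    have h1 : P.s + P.m' ≤ 2 * P.s := by omega
    refine Nat.le_of_mul_le_mul_right (c := P.m') ?_ hm
    calc Q * (P.m' * P.s) * P.m' = (Q * P.m') * (P.s * P.m') := by ring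
      _ ≤ (n * (2 * P.s)) * (P.s * P.m') :=
        Nat.mul_le_mul_right _ (hQ.trans (Nat.mul_le_mul_left _ h1))
      _ = 2 * (n * P.m') * P.s ^ 2 := by ring
      _ ≤ 2 * (c * P.s) * (512 * (P.s' * P.m' ^ 2)) := by gcongr
      _ = 1024 * (P.s' * c) * (P.m' * P.s) * P.m' := by ring

/-- Since `s, n ≤ N` and `κ ≥ 64`, the error is at most `(4 (3/4)^64)^N`, and already the base is
below `2^(-18)`. -/
theorem Setting.codingError_le (S : Setting P n uid) {s : ℕ} (hs : s ≤ P.N) :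
    codingError n s (P.κ * P.N) ≤ ENNReal.ofReal (1 / 2 ^ 18) := by
  have h1 : (2 : ℝ≥0∞) = ENNReal.ofReal 2 := by simp
  rw [codingError, h1, ← ENNReal.ofReal_pow (by norm_num), ← ENNReal.ofReal_pow (by norm_num),
    ← ENNReal.ofReal_pow (by norm_num), ← ENNReal.ofReal_mul (by positivity),
    ← ENNReal.ofReal_mul (by positivity)]
  refine ENNReal.ofReal_le_ofReal ?_
  calc (2 : ℝ) ^ s * (2 ^ n * (3 / 4) ^ (P.κ * P.N))
      ≤ 2 ^ P.N * (2 ^ P.N * (3 / 4) ^ (64 * P.N)) := by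
        gcongr ?_ * (?_ * ?_)
        · exact pow_le_pow_right₀ (by norm_num) hs
        · exact pow_le_pow_right₀ (by norm_num) S.le_N
        · exact pow_le_pow_of_le_one (by norm_num) (by norm_num) (Nat.mul_le_mul_right _ S.le_κ)
    _ = (2 * 2 * (3 / 4) ^ 64) ^ P.N := by rw [pow_mul, mul_pow, mul_pow, mul_assoc]
    _ ≤ (2 * 2 * (3 / 4) ^ 64) ^ 1 :=
        pow_le_pow_of_le_one (by norm_num) (by norm_num) S.N_pos
    _ ≤ 1 / 2 ^ 18 := by norm_num

/-! ## One iteration -/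

section Iteration

variable {w : ℕ} {A : Fin n → Finset (Word w)} {s m : ℕ}

/-- The total number of blocks. -/
def blockCount (m : ℕ) (A : Fin n → Finset (Word w)) : ℕ := ∑ v, (blocks m (A v)).length

theorem delivered_subset {ρ : Draws (fun v => blocks m (A v)) P} {c : Finset P.Key} :
    delivered P uid (fun v => blocks m (A v)) ρ c ⊆ Finset.univ.biUnion A := by
  intro x hx
  obtain ⟨q, -, hx⟩ := mem_delivered.1 hx
  exact Finset.mem_biUnion.2 ⟨q.1, Finset.mem_univ _, subset_of_mem_blocks (List.getElem_mem _) _ hx⟩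

/-- Truncated subtraction makes `a + e (b - a)` an upper bound for a mixture of `a` and `b` with
weight at most `e` on `b`; it never exceeds their maximum. -/
theorem add_mul_tsub_le {a b e B : ℝ≥0∞} (ha : a ≤ B) (hb : b ≤ B) (he : e ≤ 1) :
    a + e * (b - a) ≤ B := by
  rcases le_total b a with h | h
  · simpa [tsub_eq_zero_of_le h] using ha
  · calc a + e * (b - a) ≤ a + 1 * (b - a) := by gcongr
      _ = b := by rw [one_mul, add_tsub_cancel_of_le h]
      _ ≤ B := hb

/-- A property of all results of an iteration. -/
theorem ev_iteration_le_of_forall (S : Setting P n uid) (hm : 0 < m) (hs : s ≤ P.N)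
    (hA : ∀ v, (A v).card ≤ P.N) {index : Fin n → Finset P.Key → Prog (Finset P.Key)} {T : ℕ}
    {B : ℝ≥0∞}
    (hindex : ∀ (K : Fin n → Finset P.Key) (h : (Fin n → Finset P.Key) → ℝ≥0∞),
      (∀ c ⊆ Finset.univ.biUnion K, c.card ≤ s → (h fun _ => c) ≤ B) →
        ev h T (fun v => index v (K v)) ≤ B)
    {f : (Fin n → Option (Finset (Word w))) → ℝ≥0∞} (hnone : (f fun _ => none) ≤ B)
    (hsome : ∀ R ⊆ Finset.univ.biUnion A, (f fun _ => some R) ≤ B) :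
    ev f (T + (P.κ * P.N + P.N)) (fun v => iteration P s m w (index v) (uid v) (A v)) ≤ B := by
  refine (ev_select_broadcast (bs := fun v => blocks m (A v)) S
    (fun v => (length_blocks_le_card hm _).trans (hA v)) (m := m) (s := s)
    (fun v B hB => length_le_of_mem_blocks hB) index T f (fun _ => B) fun ρ h hh => ?_).trans
    (PMF.expect_const _ _).le
  refine hindex _ _ fun c hc hcs => (hh c ?_ hcs).trans
    (add_mul_tsub_le (hsome _ delivered_subset) hnone
      ((S.codingError_le hs).trans (ENNReal.ofReal_le_one.2 (by norm_num))))
  rwa [biUnion_keyedBlocks] at hc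

/-- The probability that a certain word is delivered by an iteration. -/
theorem ev_iteration_le (S : Setting P n uid) (hm : 0 < m) (hs0 : 0 < s) (hs : s ≤ P.N)
    (hA : ∀ v, (A v).card ≤ P.N) {index : Fin n → Finset P.Key → Prog (Finset P.Key)} {T : ℕ}
    {e : ℝ≥0∞} {a : ℝ} (ha0 : 0 ≤ a) (ha1 : a ≤ 1)
    (hindex : ∀ (K : Fin n → Finset P.Key) (h : (Fin n → Finset P.Key) → ℝ≥0∞),
      (∀ c ⊆ Finset.univ.biUnion K, c.card ≤ s → (h fun _ => c) ≤ 1) →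
        ev h T (fun v => index v (K v)) ≤ 1)
    (hindex' : ∀ (K : Fin n → Finset P.Key) (h : (Fin n → Finset P.Key) → ℝ≥0∞),
      (∀ c ⊆ Finset.univ.biUnion K, c.card ≤ s → (h fun _ => c) ≤ 1) →
      ∀ q ∈ smallest s (Finset.univ.biUnion K),
      (∀ c ⊆ Finset.univ.biUnion K, c.card ≤ s → q ∈ c →
        (h fun _ => c) ≤ e + codingError n s (P.κ * P.N)) →
        ev h T (fun v => index v (K v)) ≤ ENNReal.ofReal (1 - a))
    {f : (Fin n → Option (Finset (Word w))) → ℝ≥0∞} (hnone : (f fun _ => none) ≤ 1)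
    (hsome : ∀ R ⊆ Finset.univ.biUnion A, (f fun _ => some R) ≤ 1)
    {t : Word w} (ht : t ∈ Finset.univ.biUnion A)
    (hsome' : ∀ R ⊆ Finset.univ.biUnion A, t ∈ R → (f fun _ => some R) ≤ e) :
    ev f (T + (P.κ * P.N + P.N)) (fun v => iteration P s m w (index v) (uid v) (A v)) ≤
      ENNReal.ofReal
        (1 - a * (min 1 ((s : ℝ) * (knowers A t).card / blockCount m A) / 32)) := by
  classical
  have hlen : ∀ v, (blocks m (A v)).length ≤ P.N := fun v =>
    (length_blocks_le_card hm _).trans (hA v)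
  let bs : Fin n → List (List (Word w)) := fun v => blocks m (A v)
  have herr := (S.codingError_le hs).trans (ENNReal.ofReal_le_one.2 (by norm_num))
  have hcard : Fintype.card (BlockIndex bs) = blockCount m A := by
    simp [blockCount, BlockIndex, bs]
  let C : Finset (BlockIndex bs) := Finset.univ.filter fun q => t ∈ blockOf bs q
  -- Every node that knows `t` contributes at least one block with `t`: one lottery ticket per copy.
  have hC : (knowers A t).card ≤ C.card := by
    refine Finset.card_le_card_of_surjOn (fun q => q.1) fun v hv => ?_
    obtain ⟨i, hi⟩ := exists_block hm (mem_knowers.1 (Finset.mem_coe.1 hv))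
    exact ⟨⟨v, i⟩, Finset.mem_coe.2 (Finset.mem_filter.2 ⟨Finset.mem_univ _, hi⟩), rfl⟩
  have hne : 0 < (knowers A t).card := by
    obtain ⟨v, -, hv⟩ := Finset.mem_biUnion.1 ht
    exact Finset.card_pos.2 ⟨v, mem_knowers.2 hv⟩
  refine (ev_select_broadcast (bs := bs) S hlen (m := m) (s := s)
    (fun v B hB => length_le_of_mem_blocks hB) index T f
    (fun ρ => min 1 (if ∃ q ∈ C, lotteryRank ρ q < s then ENNReal.ofReal (1 - a) else 1))
    fun ρ h hh => ?_).trans ?_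
  · have h1 : ∀ c ⊆ allKeys P uid bs ρ, c.card ≤ s → (h fun _ => c) ≤ 1 := fun c hc hcs =>
      (hh c hc hcs).trans (add_mul_tsub_le (hsome _ delivered_subset) hnone herr)
    have hU := biUnion_keyedBlocks (P := P) (uid := uid) (bs := bs) ρ
    refine le_min (hindex _ _ (by rwa [hU])) ?_
    split_ifs with hq
    · obtain ⟨q, hqC, hq⟩ := hq
      refine hindex' _ _ (by rwa [hU]) (keyOf P uid bs ρ q) (by
        rw [hU]; exact mem_smallest_of_lotteryRank_lt S hlen hq) ?_
      rw [hU]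
      intro c hc hcs hqc
      refine (hh c hc hcs).trans (add_le_add (hsome' _ delivered_subset
        (mem_delivered.2 ⟨q, hqc, (Finset.mem_filter.1 hqC).2⟩)) ?_)
      calc _ ≤ codingError n s (P.κ * P.N) * 1 := by
            gcongr
            exact tsub_le_self.trans hnone
        _ = _ := mul_one _
    · exact hindex _ _ (by rwa [hU])
  -- There are at most `n N ≤ 2^(2L)` blocks and `8 ≤ 2^(3L)`, so `8 L` random bits are ample.
  · have hH : 8 * Fintype.card (BlockIndex bs) ≤ 2 ^ (8 * P.L) := by
      have h1 : Fintype.card (BlockIndex bs) ≤ n * P.N := by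
        rw [hcard, blockCount]
        refine (Finset.sum_le_card_nsmul _ _ P.N fun v _ => hlen v).trans ?_
        simp
      have h2 := N_lt P
      have h3 : 2 ≤ 2 ^ P.L := by
        calc 2 = 2 ^ 1 := rfl
          _ ≤ 2 ^ P.L := Nat.pow_le_pow_right (by norm_num) (Nat.succ_pos _)
      calc 8 * Fintype.card (BlockIndex bs) ≤ 2 ^ 3 * (2 ^ P.L * 2 ^ P.L) := by
            have h4 : n * P.N ≤ 2 ^ P.L * 2 ^ P.L :=
              Nat.mul_le_mul (S.le_N.trans h2.le) h2.le
            omega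
        _ ≤ (2 ^ P.L) ^ 3 * (2 ^ P.L * 2 ^ P.L) :=
            Nat.mul_le_mul_right _ (Nat.pow_le_pow_left h3 3)
        _ = (2 ^ P.L) ^ 5 := by ring
        _ = 2 ^ (5 * P.L) := by rw [← pow_mul, mul_comm]
        _ ≤ 2 ^ (8 * P.L) := Nat.pow_le_pow_right (by norm_num) (by omega)
    refine (expect_lottery_le hs0 hH (C := C) (Finset.card_pos.1 (hne.trans_le hC)) _ ha0 ha1
      (fun ρ hρ => (min_le_right _ _).trans (by rw [if_pos hρ])) fun ρ => min_le_left _ _).trans ?_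
    rw [hcard]
    refine ENNReal.ofReal_le_ofReal ?_
    gcongr

end Iteration

end PriorityForward

namespace PriorityForward

open Prog

variable {P : Params} {n : ℕ} [NeZero n] {uid : Fin n → ℕ}

/-! ## The recursive indexing -/

section RecursiveIndex

theorem ev_floodIndex_le_of_forall (S : Setting P n uid) {B : ℝ≥0∞} (K : Fin n → Finset P.Key)
    (h : (Fin n → Finset P.Key) → ℝ≥0∞)
    (hB : ∀ c ⊆ Finset.univ.biUnion K, c.card ≤ P.s' → (h fun _ => c) ≤ B) :
    ev h P.N (fun v => floodIndex P (K v)) ≤ B :=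
  (ev_floodIndex P S.le_N h K).trans (hB _ (smallest_subset _ _) (card_smallest_le _ _))

/-- The priorities considered by the nodes during the forwarding of the priorities in `U`. -/
def Considered (P : Params) (U : Finset P.Key) (A : Fin n → Finset P.Key) : Prop :=
  ∀ v, A v ⊆ U ∧ (A v).card ≤ P.s

theorem considered_step {U : Finset P.Key} {A X : Fin n → Finset P.Key} (hA : Considered P U A)
    (hX : ∀ v, ∀ x ∈ X v, ∃ u, x ∈ A u) :
    Considered P U fun v => smallest P.s (A v ∪ X v) := by
  refine fun v => ⟨(smallest_subset _ _).trans (Finset.union_subset (hA v).1 fun x hx => ?_),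
    card_smallest_le _ _⟩
  obtain ⟨u, hu⟩ := hX v x hx
  exact (hA u).1 hu

theorem considered_smallest (K : Fin n → Finset P.Key) :
    Considered P (Finset.univ.biUnion K) fun v => smallest P.s (K v) := fun v =>
  ⟨(smallest_subset _ _).trans (Finset.subset_biUnion_of_mem K (Finset.mem_univ v)),
    card_smallest_le _ _⟩

theorem Considered.biUnion_subset {U : Finset P.Key} {A : Fin n → Finset P.Key}
    (hA : Considered P U A) : Finset.univ.biUnion A ⊆ U :=
  Finset.biUnion_subset.2 fun v _ => (hA v).1

/-- Only the invariant of random forwarding is used, with no words to track and zero potential: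
whatever happens, all nodes select the same set of at most `s` genuine priorities. -/
theorem ev_recursiveIndex_le_of_forall (S : Setting P n uid) {B : ℝ≥0∞}
    (K : Fin n → Finset P.Key) (h : (Fin n → Finset P.Key) → ℝ≥0∞)
    (hB : ∀ c ⊆ Finset.univ.biUnion K, c.card ≤ P.s → (h fun _ => c) ≤ B) :
    ev h (P.κ * P.N + (P.N + (P.κ * P.N + P.N)))
      (fun v => recursiveIndex P (uid v) (K v)) ≤ B := by
  refine (ev_bind _ _ _ _ _).trans ?_
  refine (ev_randomForward (M := 0) (T := ∅) P (p := 0) zero_le_one (by simp)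
    (Considered P (Finset.univ.biUnion K)) (fun A X hA hX => ⟨considered_step hA hX, by simp,
      fun v hv => ?_⟩) (by simp) (α := 0) le_rfl 0 _ B (fun A hA => ?_) K
      (considered_smallest K)).trans (by simp)
  · rw [card_smallest]
    exact lt_min S.s_pos (hv.trans_le (Finset.card_le_card Finset.subset_union_left))
  · rw [zero_mul, add_zero]
    have hN : ∀ v, (A v).card ≤ P.N := fun v => (hA v).2.trans (s_le_N P)
    refine (ev_bind _ (P.N + (P.κ * P.N + P.N)) 0 _ _).trans ?_
    simp only [pure_def, ev_done]
    refine ev_iteration_le_of_forall S (m'_pos P) (s'_le_N P) hN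
      (ev_floodIndex_le_of_forall S) (hB _ ?_ (card_smallest_le _ _))
      fun R hR => hB _ ((smallest_subset _ _).trans (hR.trans hA.biUnion_subset))
        (card_smallest_le _ _)
    exact (smallest_subset _ _).trans (Finset.empty_subset _)

theorem blockCount_mul_le {w m M : ℕ} {A : Fin n → Finset (Word w)} (hA : ∀ v, (A v).card ≤ M) :
    blockCount m A * m ≤ n * (M + m) := by
  rw [blockCount, Finset.sum_mul]
  refine (Finset.sum_le_card_nsmul _ _ (M + m) fun v _ =>
    (length_blocks_mul_le m (A v)).trans (Nat.add_le_add_right (hA v) _)).trans ?_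
  simp

theorem blockCount_pos {w m : ℕ} (hm : 0 < m) {A : Fin n → Finset (Word w)} {t : Word w}
    {v : Fin n} (ht : t ∈ A v) : 0 < blockCount m A := by
  obtain ⟨i, -⟩ := exists_block hm ht
  exact Finset.sum_pos' (fun _ _ => Nat.zero_le _) ⟨v, Finset.mem_univ _, i.pos⟩

/-- The priorities of small rank are likely to be selected. -/
theorem ev_recursiveIndex_le (S : Setting P n uid) (K : Fin n → Finset P.Key)
    (h : (Fin n → Finset P.Key) → ℝ≥0∞)
    (h1 : ∀ c ⊆ Finset.univ.biUnion K, c.card ≤ P.s → (h fun _ => c) ≤ 1)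
    (q : P.Key) (hq : q ∈ smallest P.s (Finset.univ.biUnion K))
    (hqc : ∀ c ⊆ Finset.univ.biUnion K, c.card ≤ P.s → q ∈ c →
        (h fun _ => c) ≤ ENNReal.ofReal (1 / 2 ^ 18)) :
    ev h (P.κ * P.N + (P.N + (P.κ * P.N + P.N)))
      (fun v => recursiveIndex P (uid v) (K v)) ≤ ENNReal.ofReal (1 - 1 / 2 ^ 17) := by
  set U := Finset.univ.biUnion K with hU
  set μ := min P.m' P.s with hμ
  have hμ0 : 0 < μ := lt_min (m'_pos P) S.s_pos
  have hs0 : (0 : ℝ) < P.s := by exact_mod_cast S.s_pos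
  have hμs : (μ : ℝ) ≤ P.s := by exact_mod_cast (min_le_right _ _ : μ ≤ P.s)
  have hμ0' : (1 : ℝ) ≤ μ := by exact_mod_cast hμ0
  have hNs : (P.s : ℝ) ≤ P.N := by exact_mod_cast s_le_N P
  have hnN : (n : ℝ) ≤ P.N := by exact_mod_cast S.le_N
  -- A node considers at most `s` priorities and sends up to `m'` of them, so each is sent with
  -- probability at least `μ / s`; the `4` is required by `ev_randomForward`.
  set p : ℝ := μ / (4 * P.s) with hp
  have hp1 : p ≤ 1 := by
    rw [hp, div_le_one (by positivity)]; linarith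
  -- The number of copies of `q` that forwarding is meant to create.
  set x : ℝ := n * μ / P.s with hx
  -- the weight of `q` becomes small
  have hα : 8 * Real.exp x * (1 - p) ^ (P.κ * P.N) ≤ 1 / 8 := by
    have h2 : (1 - p) ^ (P.κ * P.N) ≤ Real.exp (-(16 * (P.N * μ / P.s))) := by
      calc (1 - p) ^ (P.κ * P.N) ≤ (1 - p) ^ (64 * P.N) :=
            pow_le_pow_of_le_one (by linarith) (by rw [hp]; linarith [show 0 ≤ p by positivity])
              (Nat.mul_le_mul_right _ S.le_κ)
        _ ≤ (Real.exp (-p)) ^ (64 * P.N) :=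
            pow_le_pow_left₀ (by linarith) (Real.one_sub_le_exp_neg p) _
        _ = Real.exp (-(16 * (P.N * μ / P.s))) := by
            rw [← Real.exp_nat_mul]
            congr 1
            rw [hp]
            push_cast
            field_simp
            ring
    have h3 : x ≤ P.N * μ / P.s := by rw [hx]; gcongr
    have h4 : (1 : ℝ) ≤ P.N * μ / P.s := by
      rw [one_le_div hs0]; nlinarith
    calc 8 * Real.exp x * (1 - p) ^ (P.κ * P.N)
        ≤ 8 * Real.exp x * Real.exp (-(16 * (P.N * μ / P.s))) := by gcongr
      _ = 8 * Real.exp (x - 16 * (P.N * μ / P.s)) := by rw [mul_assoc, ← Real.exp_add]; rfl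
      _ ≤ 8 * Real.exp (-15) := by gcongr; linarith
      _ ≤ 1 / 8 := by
          have h5 : (2 : ℝ) ≤ Real.exp 1 := by linarith [Real.add_one_le_exp (1 : ℝ)]
          have h6 : (2 : ℝ) ^ 15 ≤ Real.exp 15 := by
            calc (2 : ℝ) ^ 15 ≤ Real.exp 1 ^ 15 := pow_le_pow_left₀ (by norm_num) h5 _
              _ = Real.exp 15 := by rw [← Real.exp_nat_mul]; norm_num
          rw [Real.exp_neg, ← div_eq_mul_inv, div_le_div_iff₀ (Real.exp_pos _) (by norm_num)]
          norm_num at h6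
          linarith
  refine (ev_bind _ _ _ _ _).trans ?_
  refine (ev_randomForward (M := P.s) (T := {q}) P hp1 (fun j hj => ?_)
    (fun A => Considered P U A ∧ ∃ v, q ∈ A v) (fun A X hA hX => ?_) (by simp)
    -- With at most `x` copies the weight of `q` is at least `exp (-x)`, so the potential is at
    -- least `1 + 8`; the coefficient `2^(-16) / 9` then raises the bound to 1. At the start the
    -- potential is at most `9/8`, which costs only `2^(-19)`.
    (α := 8 * Real.exp x) (by positivity) (ENNReal.ofReal (1 / 2 ^ 16 / 9)) _
    (ENNReal.ofReal (1 - 1 / 2 ^ 16)) (fun A hA => ?_) K ⟨considered_smallest K, ?_⟩).trans ?_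
  · have hj' : (j : ℝ) ≤ P.s := by exact_mod_cast hj
    have e : 4 * p * j = μ * (j / P.s) := by rw [hp]; field_simp
    rw [e]
    push_cast
    refine le_min ?_ ?_
    · have h2 : (j : ℝ) / P.s ≤ 1 := (div_le_one hs0).2 hj'
      have h3 : (μ : ℝ) ≤ P.m' := by exact_mod_cast (min_le_left _ _ : μ ≤ P.m')
      nlinarith
    · rw [mul_div_assoc', div_le_iff₀ hs0]
      have : (0 : ℝ) ≤ j := by positivity
      nlinarith
  · have hc := considered_step hA.1 hX
    have hkeep : ∀ v, q ∈ A v ∪ X v → q ∈ smallest P.s (A v ∪ X v) := fun v hv => by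
      refine mem_smallest_of_subset (A := U) (Finset.union_subset (hA.1 v).1 fun y hy => ?_) hq hv
      obtain ⟨u, hu⟩ := hX v y hy
      exact (hA.1 u).1 hu
    refine ⟨⟨hc, ?_⟩, ?_, ?_⟩
    · obtain ⟨v, hv⟩ := hA.2
      exact ⟨v, hkeep v (Finset.mem_union_left _ hv)⟩
    · intro v t ht htv
      rw [Finset.mem_singleton] at ht
      exact ht ▸ hkeep v (ht ▸ htv)
    · intro v hv
      exact absurd (hA.1 v).2 (not_le.2 hv)
  · obtain ⟨hA, v₀, hv₀⟩ := hA
    have hN : ∀ v, (A v).card ≤ P.N := fun v => (hA v).2.trans (s_le_N P)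
    have hsub : ∀ R ⊆ Finset.univ.biUnion A, R ⊆ U := fun R hR => hR.trans hA.biUnion_subset
    refine (ev_bind _ (P.N + (P.κ * P.N + P.N)) 0 _ _).trans ?_
    simp only [pure_def, ev_done]
    have hnone : (h fun _ => smallest P.s ((none : Option (Finset P.Key)).getD ∅)) ≤ 1 :=
      h1 _ ((smallest_subset _ _).trans (Finset.empty_subset _)) (card_smallest_le _ _)
    have hsome : ∀ R ⊆ Finset.univ.biUnion A, (h fun _ => smallest P.s ((some R).getD ∅)) ≤ 1 :=
      fun R hR => h1 _ ((smallest_subset _ _).trans (hsub R hR)) (card_smallest_le _ _)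
    -- With enough copies, a block containing `q` wins the second lottery with probability at least
    -- `1 / (1024 * 32)`; together with the factor `1/2` from `hind` this gives `2^(-16)`. With too
    -- few copies the trivial bound 1 is paid by the potential.
    by_cases hbig : n * μ ≤ (knowers A q).card * P.s
    · refine le_trans ?_ le_self_add
      have hind : ∀ (K : Fin n → Finset P.Key) (h : (Fin n → Finset P.Key) → ℝ≥0∞),
          (∀ c ⊆ Finset.univ.biUnion K, c.card ≤ P.s' → (h fun _ => c) ≤ 1) →
          ∀ q ∈ smallest P.s' (Finset.univ.biUnion K),
          (∀ c ⊆ Finset.univ.biUnion K, c.card ≤ P.s' → q ∈ c →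
            (h fun _ => c) ≤ ENNReal.ofReal (1 / 2 ^ 18) + codingError n P.s' (P.κ * P.N)) →
            ev h P.N (fun v => floodIndex P (K v)) ≤ ENNReal.ofReal (1 - 1 / 2) := by
        intro K h _ q hq hqc
        refine (ev_floodIndex P S.le_N h K).trans
          ((hqc _ (smallest_subset _ _) (card_smallest_le _ _) hq).trans ?_)
        refine (add_le_add le_rfl (S.codingError_le (s'_le_N P))).trans ?_
        rw [← ENNReal.ofReal_add (by norm_num) (by norm_num)]
        exact ENNReal.ofReal_le_ofReal (by norm_num)
      refine (ev_iteration_le S (m'_pos P) S.s'_pos (s'_le_N P) hN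
        (e := ENNReal.ofReal (1 / 2 ^ 18)) (a := 1 / 2) (by norm_num) (by norm_num)
        (ev_floodIndex_le_of_forall S) hind hnone hsome (t := q)
        (Finset.mem_biUnion.2 ⟨v₀, Finset.mem_univ _, hv₀⟩) fun R hR hqR =>
          hqc _ ((smallest_subset _ _).trans (hsub R hR)) (card_smallest_le _ _)
            (mem_smallest_of_subset (hsub R hR) hq hqR)).trans ?_
      refine ENNReal.ofReal_le_ofReal ?_
      have hQ := S.blocks_le_copies hbig (blockCount_mul_le fun v => (hA v).2)
      have hQ0 : (0 : ℝ) < blockCount P.m' A := by exact_mod_cast blockCount_pos (m'_pos P) hv₀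
      have hQ' : (blockCount P.m' A : ℝ) ≤ 1024 * (P.s' * (knowers A q).card) := by
        exact_mod_cast hQ
      have : 1 / 1024 ≤ min 1 ((P.s' : ℝ) * (knowers A q).card / blockCount P.m' A) := by
        refine le_min (by norm_num) ?_
        rw [div_le_div_iff₀ (by norm_num) hQ0]
        linarith
      rw [show (1 : ℝ) / 2 ^ 16 = 1 / 2 * (1 / 1024 / 32) by norm_num]
      linarith
    · have hF : (1 : ℝ≥0∞) ≤ ENNReal.ofReal (1 - 1 / 2 ^ 16) +
          ENNReal.ofReal (1 / 2 ^ 16 / 9) * forwardWeight P.s {q} (8 * Real.exp x) A := by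
        have hc : ((knowers A q).card : ℝ) ≤ x := by
          rw [hx, le_div_iff₀ hs0]
          exact_mod_cast (not_le.1 hbig).le
        have hne : knowers A q ≠ Finset.univ := by
          intro hk
          rw [hk, Finset.card_univ, Fintype.card_fin] at hbig
          exact hbig (Nat.mul_le_mul_left _ (min_le_right _ _))
        have hw : Real.exp (-x) ≤ spreadWeight (knowers A q) := by
          rw [spreadWeight, if_neg hne]
          calc Real.exp (-x) ≤ Real.exp (-((knowers A q).card : ℝ)) := by gcongr
            _ = Real.exp (-1) ^ (knowers A q).card := by rw [← Real.exp_nat_mul]; ring_nf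
            _ ≤ (1 / 2) ^ (knowers A q).card := by
                gcongr
                rw [Real.exp_neg, one_div]
                have := Real.add_one_le_exp (1 : ℝ)
                gcongr
                linarith
        rw [forwardWeight, if_pos fun v => (hA v).2, Finset.prod_singleton,
          ← ENNReal.ofReal_mul (by norm_num), ← ENNReal.ofReal_add (by norm_num)
            (by have := spreadWeight_nonneg (D := knowers A q); positivity),
          ← ENNReal.ofReal_one]
        refine ENNReal.ofReal_le_ofReal ?_
        have h8 : 8 ≤ 8 * Real.exp x * spreadWeight (knowers A q) := by
          calc (8 : ℝ) = 8 * Real.exp x * Real.exp (-x) := by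
                rw [mul_assoc, ← Real.exp_add]; simp
            _ ≤ _ := by gcongr
        linarith
      refine le_trans ?_ hF
      exact ev_iteration_le_of_forall S (m'_pos P) (s'_le_N P) hN
        (ev_floodIndex_le_of_forall S) hnone hsome
  · have hqU := (mem_smallest.1 hq).1
    obtain ⟨v, -, hv⟩ := Finset.mem_biUnion.1 hqU
    exact ⟨v, mem_smallest_of_subset (Finset.subset_biUnion_of_mem K (Finset.mem_univ v)) hq hv⟩
  · rw [forwardWeight, if_pos fun v => card_smallest_le _ _, Finset.prod_singleton,
      ← ENNReal.ofReal_mul (by norm_num)]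
    have h0 : 0 ≤ (1 - p) ^ (P.κ * P.N) := pow_nonneg (by linarith) _
    have hsw := spreadWeight_le_one (D := knowers (fun v => smallest P.s (K v)) q)
    have hsw0 := spreadWeight_nonneg (D := knowers (fun v => smallest P.s (K v)) q)
    rw [← ENNReal.ofReal_add (by norm_num) (by positivity)]
    refine ENNReal.ofReal_le_ofReal ?_
    have : 8 * Real.exp x * (1 - p) ^ (P.κ * P.N) *
        spreadWeight (knowers (fun v => smallest P.s (K v)) q) ≤ 1 / 8 * 1 := by gcongr
    linarith

end RecursiveIndex

/-! ## The iteration on the tokens -/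

section PriorityIteration

variable {w : ℕ} {A : Fin n → Finset (Word w)} {m : ℕ}

/-- The number of rounds of an iteration with recursive indexing. -/
def iterationRounds (P : Params) : ℕ :=
  P.κ * P.N + (P.N + (P.κ * P.N + P.N)) + (P.κ * P.N + P.N)

theorem ev_priorityIteration_le_of_forall (S : Setting P n uid) (hm : 0 < m)
    (hA : ∀ v, (A v).card ≤ P.N) {B : ℝ≥0∞} {f : (Fin n → Option (Finset (Word w))) → ℝ≥0∞}
    (hnone : (f fun _ => none) ≤ B)
    (hsome : ∀ R ⊆ Finset.univ.biUnion A, (f fun _ => some R) ≤ B) :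
    ev f (iterationRounds P)
      (fun v => iteration P P.s m w (recursiveIndex P (uid v)) (uid v) (A v)) ≤ B :=
  ev_iteration_le_of_forall S hm (s_le_N P) hA
    (index := fun v => recursiveIndex P (uid v)) (ev_recursiveIndex_le_of_forall S) hnone hsome

/-- The lottery puts a block with `t` among the `s` smallest at the cost of a factor `1/32`, and
`ev_recursiveIndex_le` selects it with probability at least `2^(-17)`, coding errors included:
`2^(-22)` in total. -/
theorem ev_priorityIteration_le (S : Setting P n uid) (hm : 0 < m) (hA : ∀ v, (A v).card ≤ P.N)
    {f : (Fin n → Option (Finset (Word w))) → ℝ≥0∞}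
    (hnone : (f fun _ => none) ≤ 1)
    (hsome : ∀ R ⊆ Finset.univ.biUnion A, (f fun _ => some R) ≤ 1)
    {t : Word w} (ht : t ∈ Finset.univ.biUnion A)
    (hsome' : ∀ R ⊆ Finset.univ.biUnion A, t ∈ R → (f fun _ => some R) = 0) :
    ev f (iterationRounds P)
      (fun v => iteration P P.s m w (recursiveIndex P (uid v)) (uid v) (A v)) ≤
      ENNReal.ofReal
        (1 - 1 / 2 ^ 22 * min 1 ((P.s : ℝ) * (knowers A t).card / blockCount m A)) := by
  refine (ev_iteration_le S hm S.s_pos (s_le_N P) hA (e := 0) (a := 1 / 2 ^ 17) (by norm_num)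
    (by norm_num) (index := fun v => recursiveIndex P (uid v)) (ev_recursiveIndex_le_of_forall S)
    (fun K h h1 q hq hqc => ev_recursiveIndex_le S K h h1 q hq fun c hc hcs hqc' =>
      (hqc c hc hcs hqc').trans (by rw [zero_add]; exact S.codingError_le (s_le_N P)))
    hnone hsome ht fun R hR htR => (hsome' R hR htR).le).trans (ENNReal.ofReal_le_ofReal ?_)
  apply le_of_eq
  ring

end PriorityIteration

end PriorityForward

namespace PriorityForward

open Prog

variable {P : Params} {n : ℕ} [NeZero n] {uid : Fin n → ℕ}

/-! ## The steps of the algorithm -/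

variable (P uid) in
/-- The states between two steps: the nodes agree on the stage and on the finished tokens. -/
def states (g : Bool) (A : Fin n → Finset (Word P.d)) (D : Finset (Word P.d)) :
    Fin n → NodeState P := fun v => ⟨uid v, g, A v, D⟩

/-- The part of `greedyStep` that follows `randomForward`. -/
def greedyTail (P : Params) (σ : NodeState P) (A : Finset (Word P.d)) : Prog (NodeState P) := do
  let σ := { σ with active := A }
  let own := P.key (A.card * 2 ^ (P.a * P.L) + σ.uid)
  let top ← maxKey P own
  if top.val / 2 ^ (P.a * P.L) < P.m * P.s then
    return { σ with greedy := false }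
  else do
    let R ← indexedBroadcast P P.s P.m P.d P.s fun i =>
      if own = top then some ((blocks P.m A)[i.val]?.getD []) else none
    return σ.remove R

theorem greedyStep_eq (σ : NodeState P) :
    greedyStep P σ = randomForward P P.m id σ.active >>= greedyTail P σ := rfl

theorem val_key_card {c u : ℕ} (hc : c ≤ P.N) (hu : u < 2 ^ (P.a * P.L)) :
    (P.key (c * 2 ^ (P.a * P.L) + u)).val = c * 2 ^ (P.a * P.L) + u := by
  rw [Params.key, Fin.val_ofNat, Nat.mod_eq_of_lt]
  have h1 := N_lt P
  calc c * 2 ^ (P.a * P.L) + u < (c + 1) * 2 ^ (P.a * P.L) := by rw [Nat.add_mul]; omega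
    _ ≤ 2 ^ P.L * 2 ^ (P.a * P.L) := Nat.mul_le_mul_right _ (by omega)
    _ = 2 ^ (P.L + P.a * P.L) := (pow_add _ _ _).symm
    _ ≤ 2 ^ P.w := Nat.pow_le_pow_right (by norm_num) (by rw [Params.w]; omega)

/-- After the forwarding of the greedy stage, either this stage ends or `m s` tokens are broadcast,
up to a small probability of failure. -/
theorem ev_greedyTail (S : Setting P n uid) (A₀ A : Fin n → Finset (Word P.d))
    (D : Finset (Word P.d)) (hA : ∀ v, (A v).card ≤ P.N) (f : (Fin n → NodeState P) → ℝ≥0∞)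
    {B : ℝ≥0∞}
    (hend : (∀ v, (A v).card < P.m * P.s) → f (states P uid false A D) ≤ B)
    (hgo : ∀ R ⊆ Finset.univ.biUnion A, R.card = P.m * P.s →
      f (states P uid true (fun v => A v \ R) (D ∪ R)) + codingError n P.s (P.κ * P.N) *
        (f (states P uid true A D) - f (states P uid true (fun v => A v \ R) (D ∪ R))) ≤ B) :
    ev f (P.N + (P.κ * P.N + P.N))
      (fun v => greedyTail P (states P uid true A₀ D v) (A v)) ≤ B := by
  let x : Fin n → P.Key := fun v => P.key ((A v).card * 2 ^ (P.a * P.L) + uid v)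
  have hx : ∀ v, (x v).val = (A v).card * 2 ^ (P.a * P.L) + uid v := fun v =>
    val_key_card (hA v) (S.uid_lt_two_pow v)
  have hdiv : ∀ v, (x v).val / 2 ^ (P.a * P.L) = (A v).card := fun v => by
    rw [hx, mul_comm, Nat.mul_add_div (by positivity), Nat.div_eq_of_lt (S.uid_lt_two_pow v),
      add_zero]
  -- The identifier in the low-order digits makes the maximum unique, so exactly one node acts as
  -- the source of the broadcast.
  have hinj : Function.Injective x := fun u v h => by
    have h := congrArg Fin.val h
    rw [hx, hx] at h
    have h := congrArg (· % 2 ^ (P.a * P.L)) h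
    simp only [Nat.mul_add_mod_self_right, Nat.mod_eq_of_lt (S.uid_lt_two_pow _)] at h
    exact S.injective h
  refine (ev_bind _ _ _ (fun v => maxKey P (x v)) _).trans ?_
  obtain ⟨v₀, hmax, hev⟩ := ev_maxKey P S.le_N
    (fun top : Fin n → P.Key => ev f (P.κ * P.N + P.N) fun v =>
      (if (top v).val / 2 ^ (P.a * P.L) < P.m * P.s then
        pure { states P uid true A D v with greedy := false }
      else do
        let R ← indexedBroadcast P P.s P.m P.d P.s fun i =>
          if x v = top v then some ((blocks P.m (A v))[i.val]?.getD []) else none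
        return (states P uid true A D v).remove R : Prog (NodeState P))) x
  refine hev.trans ?_
  by_cases hv₀ : (A v₀).card < P.m * P.s
  · simp only [hdiv, if_pos hv₀, pure_def, ev_done]
    refine hend fun v => lt_of_le_of_lt ?_ hv₀
    rw [← hdiv, ← hdiv]
    exact Nat.div_le_div_right (hmax v)
  · simp only [hdiv, if_neg hv₀]
    refine (ev_bind _ (P.κ * P.N + P.N) 0 _ _).trans ?_
    simp only [pure_def, ev_done]
    refine (ev_indexedBroadcast P S.le_N P.s
      (fun i : Fin P.s => (blocks P.m (A v₀))[i.val]?.getD []) _ ?_ ?_ ?_ _).trans ?_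
    · intro v i b hb
      split_ifs at hb with h
      obtain rfl := hinj h
      exact (Option.some.inj hb).symm
    · intro i _
      exact ⟨v₀, if_pos rfl⟩
    · intro i _
      rcases h : (blocks P.m (A v₀))[i.val]? with _ | b
      · simp
      · exact length_le_of_mem_blocks (List.mem_of_getElem? h)
    · have hcard : P.m * P.s ≤ (A v₀).card := not_lt.1 hv₀
      have hR : ((Finset.univ.filter fun i : Fin P.s => i.val < P.s).biUnion fun i =>
          ((blocks P.m (A v₀))[i.val]?.getD []).toFinset) = smallest (P.m * P.s) (A v₀) := by
        rw [← card_first_blocks hcard, Finset.filter_true_of_mem fun i _ => i.isLt]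
      rw [hR]
      have := hgo (smallest (P.m * P.s) (A v₀)) ((smallest_subset _ _).trans
        (Finset.subset_biUnion_of_mem A (Finset.mem_univ v₀))) (by
          rw [card_smallest, min_eq_left hcard])
      have hrem : ∀ R : Option (Finset (Word P.d)),
          (fun v => (states P uid true A D v).remove R) =
            states P uid true (fun v => A v \ R.getD ∅) (D ∪ R.getD ∅) := fun R => rfl
      simpa only [hrem, Option.getD_some, Option.getD_none, Finset.sdiff_empty,
        Finset.union_empty] using this

/-- The number of rounds of a greedy step. -/
def greedyRounds (P : Params) : ℕ := P.κ * P.N + (P.N + (P.κ * P.N + P.N))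

/-- A greedy step ends the greedy stage, in which case random forwarding has spread the tokens in
`T`, or it broadcasts `m s` tokens, up to a small probability of failure. -/
theorem ev_greedyStep (S : Setting P n uid) (A₀ : Fin n → Finset (Word P.d))
    (D : Finset (Word P.d)) (hA₀ : (Finset.univ.biUnion A₀).card ≤ P.N)
    {T : Finset (Word P.d)} (hT : T ⊆ Finset.univ.biUnion A₀)
    (f : (Fin n → NodeState P) → ℝ≥0∞) {B c : ℝ≥0∞} {α : ℝ} (hα : 0 ≤ α)
    (hend : ∀ A, (∀ v, A₀ v ⊆ A v ∧ A v ⊆ Finset.univ.biUnion A₀) →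
      (∀ v, (A v).card < P.m * P.s) →
      f (states P uid false A D) ≤ B + c * forwardWeight (P.m * P.s) T α A)
    (hgo : ∀ A, (∀ v, A₀ v ⊆ A v ∧ A v ⊆ Finset.univ.biUnion A₀) →
      ∀ R ⊆ Finset.univ.biUnion A₀, R.card = P.m * P.s →
      f (states P uid true (fun v => A v \ R) (D ∪ R)) + codingError n P.s (P.κ * P.N) *
        (f (states P uid true A D) - f (states P uid true (fun v => A v \ R) (D ∪ R))) ≤ B) :
    ev f (greedyRounds P) (fun v => greedyStep P (states P uid true A₀ D v)) ≤
      B + c * forwardWeight (P.m * P.s) T (α * (1 - 1 / (4 * P.s)) ^ (P.κ * P.N)) A₀ := by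
  have hs : (1 : ℝ) ≤ P.s := by exact_mod_cast S.s_pos
  simp only [greedyStep_eq]
  refine (ev_bind _ _ _ _ _).trans ?_
  refine ev_randomForward (M := P.m * P.s) (keep := id) (T := T) P
    (by rw [div_le_one (by positivity)]; linarith) (fun j hj => ?_)
    (fun A => ∀ v, A₀ v ⊆ A v ∧ A v ⊆ Finset.univ.biUnion A₀) (fun A X hA hX => ?_)
    (fun A hA t ht => ?_) hα c _ B (fun A hA => ?_) A₀ (fun v => ?_)
  -- A node with `j ≤ m s` tokens sends each with probability at least `1 / s`.
  · have hj' : (j : ℝ) ≤ P.m * P.s := by exact_mod_cast hj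
    have e : 4 * (1 / (4 * (P.s : ℝ))) * j = j / P.s := by field_simp
    rw [e]
    push_cast
    refine le_min ?_ (div_le_self (by positivity) hs)
    rw [div_le_iff₀ (by positivity)]
    exact hj'
  · refine ⟨fun v => ⟨(hA v).1.trans Finset.subset_union_left,
      Finset.union_subset (hA v).2 fun y hy => ?_⟩, fun _ _ _ h => h, fun v hv =>
      hv.trans_le (Finset.card_le_card Finset.subset_union_left)⟩
    obtain ⟨u, hu⟩ := hX v y hy
    exact (hA u).2 hu
  · obtain ⟨v, -, hv⟩ := Finset.mem_biUnion.1 (hT ht)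
    exact ⟨v, (hA v).1 hv⟩
  · have hU : Finset.univ.biUnion A ⊆ Finset.univ.biUnion A₀ :=
      Finset.biUnion_subset.2 fun v _ => (hA v).2
    exact ev_greedyTail S A₀ A D (fun v => (Finset.card_le_card (hA v).2).trans hA₀) f
      (hend A hA) fun R hR hRc => (hgo A hA R (hR.trans hU) hRc).trans le_self_add
  · exact ⟨subset_rfl, Finset.subset_biUnion_of_mem A₀ (Finset.mem_univ v)⟩

theorem ev_priorityStep (g : Bool) (A : Fin n → Finset (Word P.d)) (D : Finset (Word P.d))
    (f : (Fin n → NodeState P) → ℝ≥0∞) :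
    ev f (iterationRounds P) (fun v => priorityStep P (states P uid g A D v)) ≤
      ev (fun R => f fun v => (states P uid g A D v).remove (R v)) (iterationRounds P)
        (fun v => iteration P P.s P.m P.d (recursiveIndex P (uid v)) (uid v) (A v)) := by
  refine (ev_bind _ (iterationRounds P) 0 _ _).trans ?_
  simp only [pure_def, ev_done]
  exact le_rfl

/-- The number of rounds of a step. -/
def stepRounds (P : Params) : ℕ := P.N + iterationRounds P

theorem ev_body_of_empty (S : Setting P n uid) (g : Bool) (D : Finset (Word P.d))
    (f : (Fin n → NodeState P ⊕ Finset (Word P.d)) → ℝ≥0∞) :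
    ev f (stepRounds P) (fun v => body P (states P uid g (fun _ => ∅) D v)) ≤
      f fun _ => Sum.inr D := by
  refine (ev_bind _ _ _ _ _).trans ((ev_anyNode P S.le_N _ _).trans ?_)
  simp [states, pure_def, ev_done]

theorem ev_body (S : Setting P n uid) (g : Bool) {A : Fin n → Finset (Word P.d)}
    (hA : (Finset.univ.biUnion A).Nonempty) (D : Finset (Word P.d))
    (f : (Fin n → NodeState P ⊕ Finset (Word P.d)) → ℝ≥0∞) :
    ev f (stepRounds P) (fun v => body P (states P uid g A D v)) ≤
      ev (fun σ => f fun v => Sum.inl (σ v)) (iterationRounds P) (fun v =>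
        if g then greedyStep P (states P uid g A D v) else priorityStep P (states P uid g A D v)) := by
  refine (ev_bind _ _ _ _ _).trans ((ev_anyNode P S.le_N _ _).trans ?_)
  obtain ⟨x, hx⟩ := hA
  obtain ⟨v, -, hv⟩ := Finset.mem_biUnion.1 hx
  have h : ∃ v, decide (states P uid g A D v).active.Nonempty = true :=
    ⟨v, decide_eq_true ⟨x, hv⟩⟩
  simp only [decide_eq_true h, if_true]
  cases g
  · refine (ev_bind f (iterationRounds P) 0 (fun v => priorityStep P (states P uid false A D v))
      fun _ σ => pure (Sum.inl σ)).trans ?_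
    simp only [pure_def, ev_done]
    exact le_rfl
  · refine (ev_bind f (iterationRounds P) 0 (fun v => greedyStep P (states P uid true A D v))
      fun _ σ => pure (Sum.inl σ)).trans ?_
    simp only [pure_def, ev_done]
    exact le_rfl

theorem greedyRounds_le (P : Params) : greedyRounds P ≤ iterationRounds P :=
  Nat.le_add_right _ _

/-- The initial check and every subroutine that may end the body finish with flooding, hence with a
broadcast; no random draw can be last. -/
theorem guarded_body (hN : P.N ≠ 0) (σ : NodeState P) : Guarded (body P σ) := by
  have hrc : ∀ (s m w r : ℕ) own, Guarded (indexedBroadcast P s m w r own) := fun s m w r own =>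
    guarded_bind_of_guarded_right _ fun V =>
      guarded_bind_of_guarded_left (guarded_flood hN _ _) fun b => by
        split_ifs <;> exact tight_done _
  refine guarded_bind_of_guarded_left (guarded_flood hN _ _) fun b => ?_
  split_ifs
  · refine Or.inr (guarded_bind_of_guarded_left ?_ fun _ => tight_done _)
    refine guarded_bind_of_guarded_right _ fun A =>
      guarded_bind_of_guarded_left (guarded_flood hN _ _) fun top => ?_
    by_cases h : top.val / 2 ^ (P.a * P.L) < P.m * P.s
    · simp only [if_pos h]
      exact tight_done _
    · simp only [if_neg h]
      exact Or.inr (guarded_bind_of_guarded_left (hrc _ _ _ _ _) fun _ => tight_done _)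
  · refine Or.inr (guarded_bind_of_guarded_left ?_ fun _ => tight_done _)
    refine guarded_bind_of_guarded_left ?_ fun _ => tight_done _
    exact guarded_bind_of_guarded_right _ fun bs => guarded_bind_of_guarded_right _ fun c =>
      hrc _ _ _ _ _
  · exact tight_done _

end PriorityForward

namespace PriorityForward

open Prog

variable {P : Params} {n : ℕ} [NeZero n] {uid : Fin n → ℕ}

/-! ## The size of the messages -/

/-- A packet is determined by its sorted list, padded to length `m`; this gives `(2^w + 1)^m ≤ 2^(m
(w + 1))`. -/
theorem card_packet_le (m w : ℕ) : Fintype.card (Packet m w) ≤ 2 ^ (m * (w + 1)) := by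
  let F : Packet m w → Fin m → Option (Word w) := fun A j => (A.1.sort (· ≤ ·))[j.val]?
  have hF : Function.Injective F := by
    intro A B h
    have hlen : ∀ A : Packet m w, ∀ i, m ≤ i → (A.1.sort (· ≤ ·))[i]? = none := fun A i hi =>
      List.getElem?_eq_none (by rw [Finset.length_sort]; exact A.2.trans hi)
    have : A.1.sort (· ≤ ·) = B.1.sort (· ≤ ·) := by
      refine List.ext_getElem? fun i => ?_
      by_cases hi : i < m
      · exact congrFun h ⟨i, hi⟩
      · rw [hlen A i (not_lt.1 hi), hlen B i (not_lt.1 hi)]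
    refine Subtype.ext ?_
    rw [← Finset.sort_toFinset A.1 (· ≤ ·), this, Finset.sort_toFinset]
  refine (Fintype.card_le_of_injective F hF).trans ?_
  rw [Fintype.card_fun, Fintype.card_option, Fintype.card_fin, Fintype.card_fin, mul_comm m,
    pow_mul]
  refine Nat.pow_le_pow_left ?_ _
  rw [pow_succ]
  have : 0 < 2 ^ w := by positivity
  omega

theorem card_coded (s m w : ℕ) : Fintype.card (Coded s m w) = 2 ^ (s + m * (w + 1)) := by
  simp only [Coded, Fintype.card_prod, Fintype.card_fun, ZMod.card, Fintype.card_fin]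
  rw [← pow_mul, ← pow_add, mul_comm m]

theorem short_pure {B : ℕ} {α : Type} (a : α) : Short B (pure a) := trivial

theorem short_sample {B : ℕ} {β : Type} (μ : PMF β) : Short B (sample μ) := fun _ => trivial

theorem short_anyNode {B : ℕ} (hB : 1 ≤ B) (x : Bool) : Short B (anyNode P x) :=
  short_flood (by simpa using Nat.pow_le_pow_right (n := 2) (by norm_num) hB) _ _ _

theorem short_randomForward {B m w : ℕ} (hB : m * (w + 1) ≤ B)
    (keep : Finset (Word w) → Finset (Word w)) (A : Finset (Word w)) :
    Short B (randomForward P m keep A) :=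
  short_iter (f := fun A => do
    let B ← sample (randomSubset m A)
    let r ← exchange (packet m B)
    return keep (A ∪ unite r)) (fun A => short_bind (short_sample _) fun C => short_bind
      (short_exchange ((card_packet_le m w).trans (Nat.pow_le_pow_right (by norm_num) hB)) _)
        fun _ => short_pure _) _ _

theorem short_indexedBroadcast {B s m w : ℕ} (hB1 : 1 ≤ B) (hB : s + m * (w + 1) ≤ B) (r : ℕ)
    (own : Fin s → Option (List (Word w))) : Short B (indexedBroadcast P s m w r own) := by
  refine short_bind (short_iter (fun V => ?_) _ _) fun V =>
    short_bind (short_anyNode hB1 _) fun b => ?_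
  · refine short_bind (short_sample _) fun x => ?_
    refine short_bind (short_exchange ?_ _) fun _ => short_pure _
    exact (card_coded s m w).le.trans (Nat.pow_le_pow_right (by norm_num) hB)
  · split_ifs <;> exact short_pure _

theorem short_iteration {B s m w : ℕ} (hB1 : 1 ≤ B) (hB : s + m * (w + 1) ≤ B)
    {index : Finset P.Key → Prog (Finset P.Key)} (hindex : ∀ K, Short B (index K)) (u : ℕ)
    (A : Finset (Word w)) : Short B (iteration P s m w index u A) := by
  refine short_bind ?_ fun bs => short_bind (hindex _) fun c => short_indexedBroadcast hB1 hB _ _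
  rw [assignPriorities]
  generalize (blocks m A).zipIdx = l
  induction l with
  | nil => exact trivial
  | cons B l ih =>
    rw [List.mapM_cons]
    refine short_bind ?_ fun _ => ?_
    · exact short_bind (short_sample _) fun _ => short_pure _
    · exact short_bind ih fun _ => short_pure _

/-- The longest messages carry `m'` priorities of `O(a L)` bits, and `m' L ≤ 64 b`. This last bound
needs `L ≤ 64 b` because `m'` is at least 1 even when `b < L`. -/
theorem short_body (S : Setting P n uid) (σ : NodeState P) :
    Short ((64 * (10 + P.a) + 2) * P.b) (body P σ) := by
  set B := (64 * (10 + P.a) + 2) * P.b with hB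
  have hb := S.one_le_b
  have hL1 : 1 ≤ P.L := Nat.succ_pos _
  have hL : P.L ≤ 64 * P.b := (Nat.le_self_pow (by norm_num) _).trans S.L_cube_le
  have hw : P.w + 1 ≤ (10 + P.a) * P.L := by
    rw [Params.w]
    nlinarith
  have hm'L : P.m' * P.L ≤ 64 * P.b := by
    have h1 : P.b / P.L * P.L ≤ P.b := Nat.div_mul_le_self _ _
    rcases max_choice 1 (P.b / P.L) with h | h
    · rw [Params.m', h]; omega
    · rw [Params.m', h]; omega
  have hm'b : P.m' ≤ P.b := max_le hb (Nat.div_le_self _ _)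
  have hm'w : P.m' * (P.w + 1) ≤ 64 * (10 + P.a) * P.b := by
    calc P.m' * (P.w + 1) ≤ P.m' * ((10 + P.a) * P.L) := Nat.mul_le_mul_left _ hw
      _ = (10 + P.a) * (P.m' * P.L) := by ring
      _ ≤ (10 + P.a) * (64 * P.b) := Nat.mul_le_mul_left _ hm'L
      _ = 64 * (10 + P.a) * P.b := by ring
  have hmd : P.m * (P.d + 1) ≤ 2 * P.b := by
    have h1 : P.m * max P.d 1 ≤ P.b := Nat.div_mul_le_self _ _
    calc P.m * (P.d + 1) ≤ P.m * (2 * max P.d 1) := Nat.mul_le_mul_left _ (by omega)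
      _ = 2 * (P.m * max P.d 1) := by ring
      _ ≤ 2 * P.b := by omega
  have hs : P.s ≤ P.b := min_le_left _ _
  have hs' : P.s' ≤ P.m' := min_le_left _ _
  have hBe : B = 64 * (10 + P.a) * P.b + 2 * P.b := by rw [hB]; ring
  have hBb : 64 * P.b ≤ 64 * (10 + P.a) * P.b := Nat.mul_le_mul_right _ (by omega)
  have hB1 : 1 ≤ B := by omega
  have hc : P.s + P.m * (P.d + 1) ≤ B := by omega
  have hc' : P.s' + P.m' * (P.w + 1) ≤ B := by omega
  have hkey : Fintype.card P.Key ≤ 2 ^ B := by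
    rw [Fintype.card_fin]
    refine Nat.pow_le_pow_right (by norm_num) ?_
    have : P.w + 1 ≤ P.m' * (P.w + 1) := Nat.le_mul_of_pos_left _ (m'_pos P)
    omega
  have hflood : ∀ K, Short B (floodIndex P K) := fun K =>
    short_bind (short_flood ((card_packet_le _ _).trans (Nat.pow_le_pow_right (by norm_num)
      ((Nat.mul_le_mul_right _ hs').trans (by omega)))) _ _ _) fun _ => short_pure _
  have hrec : ∀ u K, Short B (recursiveIndex P u K) := fun u K =>
    short_bind (short_randomForward (by omega) _ _) fun A =>
      short_bind (short_iteration hB1 hc' hflood _ _) fun _ => short_pure _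
  refine short_bind (short_anyNode hB1 _) fun b => ?_
  split_ifs
  · refine short_bind ?_ fun _ => short_pure _
    refine short_bind (short_randomForward (by omega) _ _) fun A =>
      short_bind (short_flood hkey _ _ _) fun top => ?_
    by_cases h : top.val / 2 ^ (P.a * P.L) < P.m * P.s
    · simp only [if_pos h]; trivial
    · simp only [if_neg h]
      exact short_bind (short_indexedBroadcast hB1 hc _ _) fun _ => short_pure _
  · refine short_bind ?_ fun _ => short_pure _
    exact short_bind (short_iteration hB1 hc (hrec _) _ _) fun _ => short_pure _
  · trivial

end PriorityForward

namespace PriorityForward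

open Prog

variable {P : Params} {n : ℕ} [NeZero n] {uid : Fin n → ℕ}

/-! ## Correctness of the output -/

theorem biUnion_eq_of_between {w : ℕ} {A₀ A : Fin n → Finset (Word w)}
    (h : ∀ v, A₀ v ⊆ A v ∧ A v ⊆ Finset.univ.biUnion A₀) :
    Finset.univ.biUnion A = Finset.univ.biUnion A₀ :=
  (Finset.biUnion_subset.2 fun v _ => (h v).2).antisymm
    (Finset.biUnion_mono fun v _ => (h v).1)

theorem biUnion_sdiff {w : ℕ} (A : Fin n → Finset (Word w)) (R : Finset (Word w)) :
    (Finset.univ.biUnion fun v => A v \ R) = Finset.univ.biUnion A \ R := by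
  ext x
  simp

theorem eq_empty_of_biUnion {w : ℕ} {A : Fin n → Finset (Word w)}
    (h : ¬ (Finset.univ.biUnion A).Nonempty) : A = fun _ => ∅ := by
  rw [Finset.not_nonempty_iff_eq_empty] at h
  funext v
  exact Finset.subset_empty.1 (h ▸ Finset.subset_biUnion_of_mem A (Finset.mem_univ v))

/-- No token is lost. -/
def Complete (P : Params) (uid : Fin n → ℕ) (U : Finset (Word P.d)) (σ : Fin n → NodeState P) :
    Prop :=
  ∃ g A D, σ = states P uid g A D ∧ Finset.univ.biUnion A ∪ D = U

/-- The union of active and finished tokens never changes, and termination requires that no active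
token is left. Taking for `F` the indicator of a violation, this says that the body has value `0`;
it holds for failed broadcasts too, since these remove nothing at any node. -/
theorem output_eq (S : Setting P n uid) (tokens : Fin n → Finset (Word P.d))
    (hk : (Finset.univ.biUnion tokens).card ≤ P.N)
    (adv : (priorityForward P).Adversary n) (hadv : ∀ h σ, (adv h σ).Connected) (t : ℕ)
    (x) (hx : x ∈ ((priorityForward P).exec (fun v => (uid v, tokens v)) adv t).support)
    (v : Fin n) (o) (ho : (priorityForward P).output (x.2 v) = some o) :
    o = Finset.univ.biUnion tokens := by
  classical
  set U := Finset.univ.biUnion tokens with hU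
  let F : (Fin n → NodeState P ⊕ Finset (Word P.d)) → ℝ≥0∞ := fun a =>
    if (∃ s : Fin n → NodeState P, a = (fun v => Sum.inl (s v)) ∧ Complete P uid U s) ∨
      ∃ o : Fin n → Finset (Word P.d), a = (fun v => Sum.inr (o v)) ∧ ∀ v, o v = U then 0 else 1
  have hF0 : ∀ g A D, Finset.univ.biUnion A ∪ D = U →
      (F fun v => Sum.inl (states P uid g A D v)) = 0 := fun g A D h =>
    if_pos (Or.inl ⟨_, rfl, g, A, D, rfl, h⟩)
  refine output_of_mem_support_exec (fun i : ℕ × Finset (Word P.d) => (⟨i.1, true, i.2, ∅⟩ : NodeState P))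
    (body P) (Complete P uid U) (fun o => o = U)
    (stepRounds P) F (fun a ha => ?_) (fun s hs => ?_) (guarded_body S.N_pos.ne')
    (fun v => (uid v, tokens v))
    ⟨true, tokens, ∅, rfl, by simp [hU]⟩ adv hadv t x hx v o ho
  · by_contra hcon
    simp only [F, if_neg hcon, one_ne_zero] at ha
  obtain ⟨g, A, D, rfl, hAD⟩ := hs
  rw [← nonpos_iff_eq_zero]
  by_cases hA : (Finset.univ.biUnion A).Nonempty
  swap
  · rw [eq_empty_of_biUnion hA] at hAD ⊢
    refine (ev_body_of_empty S g D F).trans (le_of_eq (if_pos (Or.inr ⟨fun _ => D, rfl, ?_⟩)))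
    intro v
    rw [← hAD]
    ext y
    simp
  have hAk : (Finset.univ.biUnion A).card ≤ P.N :=
    (Finset.card_le_card (hAD ▸ Finset.subset_union_left)).trans hk
  have hrem : ∀ A : Fin n → Finset (Word P.d), Finset.univ.biUnion A ∪ D = U →
      ∀ R ⊆ Finset.univ.biUnion A, (Finset.univ.biUnion fun v => A v \ R) ∪ (D ∪ R) = U := by
    intro A hAD R hR
    rw [biUnion_sdiff, ← hAD]
    ext y
    have := @hR y
    simp only [Finset.mem_union, Finset.mem_sdiff]
    tauto
  refine (ev_body S g hA D F).trans ?_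
  cases g
  · refine (ev_priorityStep _ _ _ _).trans (ev_priorityIteration_le_of_forall S S.m_pos (fun v =>
      (Finset.card_le_card (Finset.subset_biUnion_of_mem A (Finset.mem_univ v))).trans hAk)
      (hF0 false (fun v => A v \ ∅) (D ∪ ∅) ?_).le fun R hR =>
      (hF0 false (fun v => A v \ R) (D ∪ R) (hrem A hAD R hR)).le)
    simpa using hAD
  · refine (ev_antitone _ _ (greedyRounds_le P)).trans ((ev_greedyStep S A D hAk
      (T := ∅) (Finset.empty_subset _) (fun σ => F fun v => Sum.inl (σ v)) (B := 0) (c := 0)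
      (α := 0) le_rfl ?_ ?_).trans (by simp))
    · intro A' hA' _
      rw [hF0 false A' D (by rw [biUnion_eq_of_between hA', hAD])]
      exact zero_le
    · intro A' hA' R hR _
      have hAD' : Finset.univ.biUnion A' ∪ D = U := by rw [biUnion_eq_of_between hA', hAD]
      rw [hF0 true _ _ hAD', hF0 true _ _ (hrem A' hAD' R (by
        rwa [biUnion_eq_of_between hA']))]
      simp

/-! ## The setting of the theorem -/

/-- As `N ≤ 2 n`, the digit count satisfies `L ≤ l + 2` with `l` the integer binary logarithm of
`n`. For `l = 1` already `27 ≤ 64`, and for `l ≥ 2` one has `l + 2 ≤ 4 log n`. -/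
theorem setting_of_log_le {n N b d a κ : ℕ} {uid : Fin n → ℕ} (hn : 2 ≤ n) (hnN : n ≤ N)
    (hN : N ≤ 2 * n) (hb : Real.log n ^ 3 ≤ b) (hd : d ≤ b) (hinj : Function.Injective uid)
    (huid : ∀ v, uid v < n ^ a) (hκ : 64 ≤ κ) : Setting ⟨N, b, d, a, κ⟩ n uid := by
  have hlog : 0 < Real.log n := Real.log_pos (by exact_mod_cast hn)
  have hb1 : 1 ≤ b := by
    have : (0 : ℝ) < b := (by positivity : 0 < Real.log n ^ 3).trans_le hb
    exact_mod_cast this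
  refine ⟨hn, hnN, hN, hinj, huid, hb1, hd, ?_, hκ⟩
  set l := Nat.log 2 n with hl
  have hL : (⟨N, b, d, a, κ⟩ : Params).L ≤ l + 2 := by
    have h1 : Nat.log 2 N ≤ Nat.log 2 (n * 2) := Nat.log_mono_right (by omega)
    rw [Nat.log_mul_base one_lt_two (by omega)] at h1
    simp only [Params.L]
    omega
  refine (Nat.pow_le_pow_left hL 3).trans ?_
  have hl1 : 1 ≤ l := Nat.log_pos one_lt_two hn
  rcases eq_or_lt_of_le hl1 with h | h
  · rw [← h]
    simp only
    omega
  · have h2 : (l : ℝ) * Real.log 2 ≤ Real.log n := by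
      rw [← Real.log_pow]
      refine Real.log_le_log (by positivity) ?_
      exact_mod_cast Nat.pow_log_le_self 2 (by omega)
    have h3 : (l : ℝ) + 2 ≤ 4 * (l * Real.log 2) := by
      have h4 : (2 : ℝ) ≤ l := by exact_mod_cast h
      nlinarith [Real.log_two_gt_d9]
    have h5 : ((l : ℝ) + 2) ^ 3 ≤ 64 * b := by
      calc ((l : ℝ) + 2) ^ 3 ≤ (4 * Real.log n) ^ 3 :=
            pow_le_pow_left₀ (by positivity) (h3.trans (by linarith)) 3
        _ = 64 * Real.log n ^ 3 := by ring
        _ ≤ 64 * b := by linarith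
    exact_mod_cast h5

end PriorityForward

namespace PriorityForward

open Prog

variable {P : Params} {n : ℕ} [NeZero n] {uid : Fin n → ℕ}

/-! ## The load -/

section Load

variable {w : ℕ}

/-- The number of copies of tokens. -/
def load (A : Fin n → Finset (Word w)) : ℕ := ∑ v, (A v).card

theorem load_eq_sum {A : Fin n → Finset (Word w)} {U : Finset (Word w)} (hU : ∀ v, A v ⊆ U) :
    load A = ∑ t ∈ U, (knowers A t).card := by
  have h1 : ∀ v, (A v).card = ∑ t ∈ U, if t ∈ A v then 1 else 0 := fun v => by
    rw [Finset.sum_boole, Finset.filter_mem_eq_inter, Finset.inter_eq_right.2 (hU v)]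
    rfl
  have h2 : ∀ t, (knowers A t).card = ∑ v, if t ∈ A v then 1 else 0 := fun t => by
    rw [Finset.sum_boole, knowers]
    rfl
  simp only [load, h1, h2]
  exact Finset.sum_comm

theorem subset_biUnion (A : Fin n → Finset (Word w)) (v : Fin n) : A v ⊆ Finset.univ.biUnion A :=
  Finset.subset_biUnion_of_mem A (Finset.mem_univ v)

theorem knowers_sdiff {A : Fin n → Finset (Word w)} {R : Finset (Word w)} {t : Word w}
    (ht : t ∉ R) : knowers (fun v => A v \ R) t = knowers A t := by
  ext v
  simp [mem_knowers, ht]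

theorem knowers_sdiff_of_mem {A : Fin n → Finset (Word w)} {R : Finset (Word w)} {t : Word w}
    (ht : t ∈ R) : knowers (fun v => A v \ R) t = ∅ := by
  ext v
  simp [mem_knowers, ht]

theorem knowers_card_pos {A : Fin n → Finset (Word w)} {t : Word w}
    (ht : t ∈ Finset.univ.biUnion A) : 0 < (knowers A t).card := by
  obtain ⟨v, -, hv⟩ := Finset.mem_biUnion.1 ht
  exact Finset.card_pos.2 ⟨v, mem_knowers.2 hv⟩

theorem blockCount_mul_le_load (m : ℕ) (A : Fin n → Finset (Word w)) :
    blockCount m A * m ≤ load A + n * m := by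
  rw [blockCount, Finset.sum_mul]
  refine (Finset.sum_le_sum fun v _ => length_blocks_mul_le m (A v)).trans ?_
  rw [Finset.sum_add_distrib]
  simp [load]

theorem blockCount_le_load {m : ℕ} (hm : 0 < m) (A : Fin n → Finset (Word w)) :
    blockCount m A ≤ load A :=
  Finset.sum_le_sum fun v _ => length_blocks_le_card hm (A v)

theorem load_le {A : Fin n → Finset (Word w)} {k : ℕ} (hk : (Finset.univ.biUnion A).card ≤ k) :
    load A ≤ n * k := by
  refine (Finset.sum_le_card_nsmul _ _ k fun v _ =>
    (Finset.card_le_card (subset_biUnion A v)).trans hk).trans ?_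
  simp

end Load

/-! ## Progress of the iterations -/

/-- A lower bound for the probability that a token is broadcast by an iteration, up to a constant
factor. -/
def chance (P : Params) (A : Fin n → Finset (Word P.d)) (t : Word P.d) : ℝ :=
  min 1 ((P.s : ℝ) * (knowers A t).card / blockCount P.m A)

theorem chance_nonneg (A : Fin n → Finset (Word P.d)) (t : Word P.d) : 0 ≤ chance P A t :=
  le_min zero_le_one (by positivity)

/-- In expectation an iteration removes at least the fraction `δ` of the load. -/
def Progress (P : Params) (δ : ℝ) (A : Fin n → Finset (Word P.d)) : Prop :=
  δ * load A ≤ 1 / 2 ^ 22 * ∑ t ∈ Finset.univ.biUnion A, (knowers A t).card * chance P A t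

/-- Nonempty index sets only: for the empty one the right side is `0`, while programs out of
lockstep still have value `⊤`. -/
theorem ev_sum {α : Type} {ι : Type*} {s : Finset ι} (hs : s.Nonempty)
    (f : ι → (Fin n → α) → ℝ≥0∞) (T : ℕ) (p : Fin n → Prog α) :
    ev (fun a => ∑ i ∈ s, f i a) T p ≤ ∑ i ∈ s, ev (f i) T p := by
  classical
  induction hs using Finset.Nonempty.cons_induction with
  | singleton i => simp
  | cons i s hi hs ih =>
    simp only [Finset.sum_cons]
    exact (ev_add _ _ _ _).trans (add_le_add le_rfl ih)

/-- Linearity of expectation: the remaining load is the sum, over the tokens that were not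
broadcast, of their numbers of copies. Each token is bounded separately although the worst
adversaries differ. The factor `x` will be the decay over the iterations that follow. -/
theorem ev_priorityStep_load (S : Setting P n uid) {A : Fin n → Finset (Word P.d)}
    (hne : (Finset.univ.biUnion A).Nonempty) (hk : (Finset.univ.biUnion A).card ≤ P.N)
    (D : Finset (Word P.d)) {δ : ℝ} (hδ : Progress P δ A) {x : ℝ≥0∞} (hx : x ≠ 0)
    (f : (Fin n → NodeState P) → ℝ≥0∞)
    (hf : ∀ R D', f (states P uid false (fun v => A v \ R) D') ≤
      x * (load (fun v => A v \ R) : ℕ)) :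
    ev f (iterationRounds P) (fun v => priorityStep P (states P uid false A D v)) ≤
      x * (ENNReal.ofReal (1 - δ) * (load A : ℕ)) := by
  classical
  set U := Finset.univ.biUnion A with hU
  -- the indicator of the event that `t` remains
  let g : Word P.d → (Fin n → Option (Finset (Word P.d))) → ℝ≥0∞ := fun t R =>
    if ∃ c, R = fun _ => c then (if t ∈ (R 0).getD ∅ then 0 else 1) else ⊤
  have hg : ∀ t c, (g t fun _ => c) = if t ∈ c.getD ∅ then 0 else 1 := fun t c =>
    if_pos ⟨c, rfl⟩
  have hg1 : ∀ t c, (g t fun _ => c) ≤ 1 := fun t c => by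
    rw [hg]; split_ifs <;> simp
  have hc0 : ∀ t ∈ U, x * ((knowers A t).card : ℕ) ≠ 0 := fun t ht =>
    mul_ne_zero hx (by exact_mod_cast (knowers_card_pos ht).ne')
  have hA : ∀ v, (A v).card ≤ P.N := fun v => (Finset.card_le_card (subset_biUnion A v)).trans hk
  refine (ev_priorityStep _ _ _ _).trans ?_
  calc _ ≤ ev (fun R => ∑ t ∈ U, x * ((knowers A t).card : ℕ) * g t R) (iterationRounds P)
        (fun v => iteration P P.s P.m P.d (recursiveIndex P (uid v)) (uid v) (A v)) := by
        refine ev_mono (fun R => ?_) _ _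
        by_cases hR : ∃ c, R = fun _ => c
        · obtain ⟨c, rfl⟩ := hR
          refine (hf (c.getD ∅) (D ∪ c.getD ∅)).trans (le_of_eq ?_)
          rw [load_eq_sum (U := U) fun v => Finset.sdiff_subset.trans (subset_biUnion A v)]
          push_cast
          rw [Finset.mul_sum]
          refine Finset.sum_congr rfl fun t _ => ?_
          rw [hg]
          split_ifs with ht
          · rw [knowers_sdiff_of_mem ht]; simp
          · rw [knowers_sdiff ht, mul_one]
        · obtain ⟨t, ht⟩ := hne
          refine le_top.trans (le_trans (le_of_eq ?_) (Finset.single_le_sum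
            (f := fun t => x * ((knowers A t).card : ℕ) * g t R) (fun _ _ => zero_le) ht))
          simp only [g, if_neg hR]
          rw [ENNReal.mul_top (hc0 t ht)]
    _ ≤ ∑ t ∈ U, x * ((knowers A t).card : ℕ) *
          ENNReal.ofReal (1 - 1 / 2 ^ 22 * chance P A t) := by
        refine (ev_sum hne _ _ _).trans (Finset.sum_le_sum fun t ht => ?_)
        refine (ev_const_mul (hc0 t ht) _ _ _).trans ?_
        gcongr
        exact ev_priorityIteration_le S S.m_pos hA (hg1 t none) (fun R _ => hg1 t (some R)) ht
          fun R _ htR => by rw [hg]; exact if_pos htR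
    _ ≤ x * (ENNReal.ofReal (1 - δ) * (load A : ℕ)) := by
        simp only [mul_assoc]
        rw [← Finset.mul_sum]
        gcongr
        have h1 : ∀ t, 0 ≤ 1 - 1 / 2 ^ 22 * chance P A t := fun t => by
          have : chance P A t ≤ 1 := min_le_left _ _
          linarith
        simp only [← ENNReal.ofReal_natCast]
        rw [← ENNReal.ofReal_mul' (by positivity)]
        simp only [← ENNReal.ofReal_mul (Nat.cast_nonneg _)]
        rw [← ENNReal.ofReal_sum_of_nonneg fun t _ => mul_nonneg (Nat.cast_nonneg _) (h1 t)]
        refine ENNReal.ofReal_le_ofReal ?_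
        have h2 : (load A : ℝ) = ∑ t ∈ U, ((knowers A t).card : ℝ) := by
          rw [load_eq_sum (subset_biUnion A)]
          push_cast
          rfl
        have h3 : ∑ t ∈ U, ((knowers A t).card : ℝ) * (1 - 1 / 2 ^ 22 * chance P A t) =
            load A - 1 / 2 ^ 22 * ∑ t ∈ U, (knowers A t).card * chance P A t := by
          rw [h2, Finset.mul_sum, ← Finset.sum_sub_distrib]
          exact Finset.sum_congr rfl fun t _ => by ring
        rw [h3]
        have := hδ
        rw [Progress] at this
        linarith

/-! ## Lower bounds for the progress -/

theorem progress_of_forall_chance {A : Fin n → Finset (Word P.d)} {η : ℝ}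
    (h : ∀ t ∈ Finset.univ.biUnion A, η ≤ chance P A t) : Progress P (1 / 2 ^ 22 * η) A := by
  rw [Progress, mul_assoc, load_eq_sum (subset_biUnion A)]
  push_cast
  rw [Finset.mul_sum]
  refine mul_le_mul_of_nonneg_left (Finset.sum_le_sum fun t ht => ?_) (by norm_num)
  rw [mul_comm]
  exact mul_le_mul_of_nonneg_left (h t ht) (Nat.cast_nonneg _)

/-- There are at most `n²` blocks, so any token has chance at least `1 / n²`. This rate serves
bounded `n`, where `exp (-n)` is not small enough. -/
theorem progress_trivial (S : Setting P n uid) {A : Fin n → Finset (Word P.d)}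
    (hk : (Finset.univ.biUnion A).card ≤ n) : Progress P (1 / 2 ^ 22 * (1 / (n : ℝ) ^ 2)) A := by
  refine progress_of_forall_chance fun t ht => ?_
  have hn : (1 : ℝ) ≤ n := by exact_mod_cast (by have := S.two_le; omega : 1 ≤ n)
  obtain ⟨v, -, hv⟩ := Finset.mem_biUnion.1 ht
  have hQ0 : (0 : ℝ) < blockCount P.m A := by exact_mod_cast blockCount_pos S.m_pos hv
  have hQ : (blockCount P.m A : ℝ) ≤ n * n := by
    exact_mod_cast (blockCount_le_load S.m_pos A).trans (load_le hk)
  have hs : (1 : ℝ) ≤ P.s := by exact_mod_cast S.s_pos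
  have hc : (1 : ℝ) ≤ (knowers A t).card := by exact_mod_cast knowers_card_pos ht
  refine le_min ?_ ?_
  · rw [div_le_one (by positivity)]
    nlinarith
  · rw [div_le_div_iff₀ (by positivity) hQ0, one_mul]
    calc (blockCount P.m A : ℝ) ≤ 1 * (n : ℝ) ^ 2 := by rw [one_mul, sq]; exact hQ
      _ ≤ (P.s * (knowers A t).card) * (n : ℝ) ^ 2 := by
          gcongr
          exact one_le_mul_of_one_le_of_one_le hs hc

/-- Terms with `c t < θ` carry at most `|U| θ` of the sum and are given up; the others have `y t ≥
η`. -/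
theorem mul_sum_sub_le {ι : Type*} {U : Finset ι} {c y : ι → ℝ} {θ η : ℝ} (hc : ∀ t, 0 ≤ c t)
    (hy : ∀ t, 0 ≤ y t) (hθ : 0 ≤ θ) (hη : 0 ≤ η) (h : ∀ t ∈ U, θ ≤ c t → η ≤ y t) :
    η * (∑ t ∈ U, c t - U.card * θ) ≤ ∑ t ∈ U, c t * y t := by
  have e : η * (∑ t ∈ U, c t - U.card * θ) = ∑ t ∈ U, η * (c t - θ) := by
    rw [← Finset.mul_sum, Finset.sum_sub_distrib, Finset.sum_const, nsmul_eq_mul]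
  rw [e]
  refine Finset.sum_le_sum fun t ht => ?_
  rcases le_total θ (c t) with h' | h'
  · nlinarith [mul_le_mul_of_nonneg_left (h t ht h') (hc t), mul_nonneg hη hθ]
  · nlinarith [mul_nonneg (hc t) (hy t), mul_nonneg hη (sub_nonneg.2 h')]

/-- The tokens that few nodes know. -/
def rare (P : Params) (A : Fin n → Finset (Word P.d)) : Finset (Word P.d) :=
  (Finset.univ.biUnion A).filter fun t => (knowers A t).card * P.s < n

/-- If the load `Φ` is at least `n m`, there are at most `2 Φ / m` blocks, and tokens with at least
`Φ / (2 k)` copies carry half of the load. Otherwise there are at most `2 n` blocks: a token that is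
not rare has chance at least `1/2`, while the at most `s` rare ones, if they carry half of the load,
have enough copies on average because there are at most `Φ` blocks. -/
theorem progress_of_rare (S : Setting P n uid) {A : Fin n → Finset (Word P.d)} {k : ℕ}
    (hk : (Finset.univ.biUnion A).card ≤ k) (hrare : (rare P A).card ≤ P.s) :
    Progress P (1 / 2 ^ 26 / (1 + k / (P.m * P.s))) A := by
  classical
  set U := Finset.univ.biUnion A with hU
  rcases U.eq_empty_or_nonempty with hUe | ⟨t₀, ht₀⟩
  · rw [Progress, load_eq_sum (subset_biUnion A), ← hU, hUe]
    simp
  obtain ⟨v₀, -, hv₀⟩ := Finset.mem_biUnion.1 ht₀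
  set c : Word P.d → ℝ := fun t => (knowers A t).card with hc
  set y := chance P A with hy
  have hc0 : ∀ t, 0 ≤ c t := fun t => Nat.cast_nonneg _
  have hy0 : ∀ t, 0 ≤ y t := chance_nonneg A
  set Φ : ℝ := (load A : ℝ) with hΦ
  have hΦs : Φ = ∑ t ∈ U, c t := by
    rw [hΦ, load_eq_sum (subset_biUnion A)]
    push_cast
    rfl
  set Q : ℝ := (blockCount P.m A : ℝ) with hQ
  have hQ0 : 0 < Q := by rw [hQ]; exact_mod_cast blockCount_pos S.m_pos hv₀
  have hQΦ : Q ≤ Φ := by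
    rw [hQ, hΦ]
    exact_mod_cast blockCount_le_load S.m_pos A
  have hQm : Q * P.m ≤ Φ + n * P.m := by
    rw [hQ, hΦ]
    exact_mod_cast blockCount_mul_le_load P.m A
  have hΦ0 : 0 < Φ := hQ0.trans_le hQΦ
  have hm : (0 : ℝ) < P.m := by exact_mod_cast S.m_pos
  have hs : (0 : ℝ) < P.s := by exact_mod_cast S.s_pos
  have hn : (0 : ℝ) < n := by exact_mod_cast (by have := S.two_le; omega : 0 < n)
  have hkU : (U.card : ℝ) ≤ k := by exact_mod_cast hk
  have hk0 : (0 : ℝ) < k := lt_of_lt_of_le (by exact_mod_cast Finset.card_pos.2 ⟨t₀, ht₀⟩) hkU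
  set ρ : ℝ := 1 + k / (P.m * P.s) with hρ
  have hρ1 : 1 ≤ ρ := by rw [hρ]; linarith [show 0 ≤ (k : ℝ) / (P.m * P.s) by positivity]
  have hρk : (k : ℝ) ≤ ρ * (P.m * P.s) := by
    rw [hρ, add_mul, div_mul_cancel₀ _ (by positivity)]
    linarith [show 0 < (P.m : ℝ) * P.s by positivity]
  have hyt : ∀ (η : ℝ) t, η ≤ 1 → η * Q ≤ P.s * c t → η ≤ y t := fun η t h1 h2 =>
    le_min h1 ((le_div_iff₀ hQ0).2 h2)
  suffices h : Φ / 16 ≤ ρ * ∑ t ∈ U, c t * y t by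
    rw [Progress]
    have e : 1 / 2 ^ 26 / ρ * Φ = 1 / 2 ^ 22 * (Φ / 16 / ρ) := by
      field_simp
      norm_num
    rw [e]
    refine mul_le_mul_of_nonneg_left ?_ (by norm_num)
    rw [div_le_iff₀ (by linarith)]
    linarith
  have hsum0 : 0 ≤ ∑ t ∈ U, c t * y t := Finset.sum_nonneg fun t _ => mul_nonneg (hc0 t) (hy0 t)
  have hsub : ∀ V ⊆ U, ∑ t ∈ V, c t * y t ≤ ∑ t ∈ U, c t * y t := fun V hV =>
    Finset.sum_le_sum_of_subset_of_nonneg hV fun t _ _ => mul_nonneg (hc0 t) (hy0 t)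
  rcases le_total (n * P.m : ℝ) Φ with hcase | hcase
  · have h1 := mul_sum_sub_le (U := U) (θ := Φ / (2 * k)) (η := 1 / (4 * ρ)) hc0 hy0
      (by positivity) (by positivity) fun t _ ht => by
        refine hyt _ t ?_ ?_
        · rw [div_le_one (by linarith)]; linarith
        · rw [div_le_iff₀ (by positivity)] at ht
          have h2 : Q * P.m ≤ 2 * Φ := by linarith
          rw [div_mul_eq_mul_div, one_mul, div_le_iff₀ (by linarith)]
          refine le_of_mul_le_mul_right (a := (P.m : ℝ)) ?_ hm
          calc Q * P.m ≤ 2 * Φ := h2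
            _ ≤ 2 * (c t * (2 * k)) := by linarith
            _ = 4 * c t * k := by ring
            _ ≤ 4 * c t * (ρ * (P.m * P.s)) :=
                mul_le_mul_of_nonneg_left hρk (mul_nonneg (by norm_num) (hc0 t))
            _ = P.s * c t * (4 * ρ) * P.m := by ring
    have h3 : Φ / 2 ≤ ∑ t ∈ U, c t - U.card * (Φ / (2 * k)) := by
      rw [← hΦs]
      have : (U.card : ℝ) * (Φ / (2 * k)) ≤ Φ / 2 := by
        calc (U.card : ℝ) * (Φ / (2 * k)) ≤ k * (Φ / (2 * k)) := by gcongr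
          _ = Φ / 2 := by field_simp
      linarith
    have h4 : 1 / (4 * ρ) * (Φ / 2) ≤ ∑ t ∈ U, c t * y t :=
      (mul_le_mul_of_nonneg_left h3 (by positivity)).trans h1
    calc Φ / 16 ≤ ρ * (1 / (4 * ρ) * (Φ / 2)) := by
          have : ρ * (1 / (4 * ρ) * (Φ / 2)) = Φ / 8 := by field_simp; norm_num
          rw [this]; linarith
      _ ≤ _ := mul_le_mul_of_nonneg_left h4 (by linarith)
  · refine le_trans ?_ (le_mul_of_one_le_left hsum0 hρ1)
    have hQn : Q ≤ 2 * n := by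
      refine le_of_mul_le_mul_right (a := (P.m : ℝ)) ?_ hm
      linarith
    have hrU : rare P A ⊆ U := Finset.filter_subset _ _
    have hsplit : Φ = ∑ t ∈ rare P A, c t + ∑ t ∈ U \ rare P A, c t := by
      rw [hΦs, add_comm, Finset.sum_sdiff hrU]
    have hb := mul_sum_sub_le (U := U \ rare P A) (θ := 0) (η := 1 / 2) hc0 hy0
      le_rfl (by norm_num) fun t ht _ => by
        refine hyt _ t (by norm_num) ?_
        have h2 : n ≤ (knowers A t).card * P.s := by
          by_contra hcon
          obtain ⟨h3, h4⟩ := Finset.mem_sdiff.1 ht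
          exact h4 (Finset.mem_filter.2 ⟨h3, not_le.1 hcon⟩)
        have h5 : (n : ℝ) ≤ c t * P.s := by simp only [hc]; exact_mod_cast h2
        linarith
    -- At most `s` rare tokens lie below this threshold, giving up at most `Φ / 4`; above it, `s c ≥
    -- Φ / 4 ≥ Q / 4`.
    have hr := mul_sum_sub_le (U := rare P A) (θ := Φ / (4 * P.s)) (η := 1 / 4) hc0 hy0
      (by positivity) (by norm_num) fun t ht h => by
        refine hyt _ t (by norm_num) ?_
        rw [div_le_iff₀ (by positivity)] at h
        linarith
    have h6 : ((rare P A).card : ℝ) * (Φ / (4 * P.s)) ≤ Φ / 4 := by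
      have : ((rare P A).card : ℝ) ≤ P.s := by exact_mod_cast hrare
      calc ((rare P A).card : ℝ) * (Φ / (4 * P.s)) ≤ P.s * (Φ / (4 * P.s)) := by gcongr
        _ = Φ / 4 := by field_simp
    have h7 := hsub _ hrU
    have h8 := hsub _ (Finset.sdiff_subset : U \ rare P A ⊆ U)
    rw [mul_zero, sub_zero] at hb
    rcases le_total (Φ / 2) (∑ t ∈ rare P A, c t) with h9 | h9 <;> linarith

/-- Removing tokens at all nodes leaves the copies of the others unchanged, so few rare tokens at
the end of the greedy stage remain few during the whole priority stage. -/
theorem rare_sdiff_subset (A : Fin n → Finset (Word P.d)) (R : Finset (Word P.d)) :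
    rare P (fun v => A v \ R) ⊆ rare P A := by
  intro t ht
  obtain ⟨h1, h2⟩ := Finset.mem_filter.1 ht
  rw [biUnion_sdiff, Finset.mem_sdiff] at h1
  rw [knowers_sdiff h1.2] at h2
  exact Finset.mem_filter.2 ⟨h1.1, h2⟩

end PriorityForward

namespace PriorityForward

open Prog

variable {P : Params} {n : ℕ} [NeZero n] {uid : Fin n → ℕ}

/-! ## The stages -/

theorem failure_body_le (S : Setting P n uid) (t : ℕ) (σ : Fin n → NodeState P) :
    failure (body P) (stepRounds P + t) (fun v => body P (σ v)) ≤
      ev (joinHeads (fun s => failure (body P) t fun v => body P (s v)) fun _ => 0)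
        (stepRounds P) (fun v => body P (σ v)) := by
  have hg : ∀ v, Guarded (body P (σ v)) := fun v => guarded_body S.N_pos.ne' _
  refine le_trans (le_of_eq ?_)
    (failure_settle_le (body P) t (stepRounds P) (fun v => body P (σ v)) fun v => Or.inr (hg v))
  congr 1
  funext v
  exact (settle_of_guarded _ (hg v)).symm

theorem failure_body_of_empty (S : Setting P n uid) (t : ℕ) (g : Bool)
    {A : Fin n → Finset (Word P.d)} (hA : ¬ (Finset.univ.biUnion A).Nonempty)
    (D : Finset (Word P.d)) :
    failure (body P) (stepRounds P + t) (fun v => body P (states P uid g A D v)) = 0 := by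
  rw [eq_empty_of_biUnion hA, ← nonpos_iff_eq_zero]
  refine (failure_body_le S t _).trans ((ev_body_of_empty S g D _).trans ?_)
  rw [joinHeads_inr]

/-- `t` more rounds after a step. -/
theorem failure_body_of_nonempty (S : Setting P n uid) (t : ℕ) (g : Bool)
    {A : Fin n → Finset (Word P.d)} (hA : (Finset.univ.biUnion A).Nonempty)
    (D : Finset (Word P.d)) :
    failure (body P) (stepRounds P + t) (fun v => body P (states P uid g A D v)) ≤
      ev (fun σ => failure (body P) t fun v => body P (σ v)) (iterationRounds P) (fun v =>
        if g then greedyStep P (states P uid g A D v)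
        else priorityStep P (states P uid g A D v)) := by
  refine (failure_body_le S t _).trans ((ev_body S g hA D _).trans ?_)
  simp only [joinHeads_inl]
  exact le_rfl

/-- The priority stage. -/
theorem failure_priority (S : Setting P n uid) {δ : ℝ} (hδ : δ < 1) (j : ℕ)
    {A : Fin n → Finset (Word P.d)} (hk : (Finset.univ.biUnion A).card ≤ P.N)
    (hA : ∀ R, Progress P δ fun v => A v \ R) (D : Finset (Word P.d)) :
    failure (body P) ((j + 1) * stepRounds P) (fun v => body P (states P uid false A D v)) ≤
      ENNReal.ofReal (1 - δ) ^ j * (load A : ℕ) := by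
  induction j generalizing A D with
  | zero =>
    by_cases hne : (Finset.univ.biUnion A).Nonempty
    -- The last step is only the check for remaining tokens; if there are any, the load is at least
    -- 1 and bounds the failure probability.
    · rw [pow_zero, one_mul]
      refine (failure_le_one _ _ _).trans ?_
      obtain ⟨x, hx⟩ := hne
      obtain ⟨v, -, hv⟩ := Finset.mem_biUnion.1 hx
      exact_mod_cast Nat.succ_le_of_lt (Finset.sum_pos' (fun _ _ => Nat.zero_le _)
        ⟨v, Finset.mem_univ _, Finset.card_pos.2 ⟨x, hv⟩⟩)
    · rw [show (0 + 1) * stepRounds P = stepRounds P + 0 by ring, failure_body_of_empty S 0 _ hne]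
      exact zero_le
  | succ j ih =>
    rw [show (j + 1 + 1) * stepRounds P = stepRounds P + (j + 1) * stepRounds P by ring]
    by_cases hne : (Finset.univ.biUnion A).Nonempty
    · refine (failure_body_of_nonempty S _ _ hne D).trans ?_
      have h0 : ENNReal.ofReal (1 - δ) ^ j ≠ 0 :=
        pow_ne_zero _ (ENNReal.ofReal_pos.2 (by linarith)).ne'
      have hA0 : Progress P δ A := by simpa using hA ∅
      refine (ev_priorityStep_load S hne hk D hA0 h0 _ fun R D' => ih ?_ (fun R' => ?_) D').trans
        (le_of_eq ?_)
      · rw [biUnion_sdiff]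
        exact (Finset.card_le_card Finset.sdiff_subset).trans hk
      · simp only [sdiff_sdiff_left]
        exact hA (R ∪ R')
      · rw [pow_succ, mul_assoc]
    · rw [failure_body_of_empty S _ _ hne]
      exact zero_le

/-- Monotonicity in `a` needs `e ≤ 1`: raising `a` also lowers the penalty `e (b - a)`, but by no
more. -/
theorem add_mul_tsub_mono {a b a' b' e : ℝ≥0∞} (ha : a ≤ a') (hb : b ≤ b') (he : e ≤ 1) :
    a + e * (b - a) ≤ a' + e * (b' - a') := by
  calc a + e * (b - a) ≤ a + e * ((b' - a') + (a' - a)) := by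
        gcongr
        exact (tsub_le_tsub_right hb a).trans tsub_le_tsub_add_tsub
    _ = a + e * (a' - a) + e * (b' - a') := by ring
    _ ≤ a + 1 * (a' - a) + e * (b' - a') := by gcongr
    _ = a' + e * (b' - a') := by rw [one_mul, add_tsub_cancel_of_le ha]

/-- The greedy stage: each greedy step ends this stage, and then random forwarding has prepared the
priority stage except with probability `ε`, or it decreases the number of tokens with a good
probability. -/
theorem failure_greedy (S : Setting P n uid) {k J : ℕ} (hkN : k ≤ P.N) {β ε : ℝ≥0∞}
    (hend : ∀ A₀ : Fin n → Finset (Word P.d), (Finset.univ.biUnion A₀).card ≤ k →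
      ∃ T ⊆ Finset.univ.biUnion A₀, ∃ (c : ℝ≥0∞) (α : ℝ), 0 ≤ α ∧
        c * forwardWeight (P.m * P.s) T (α * (1 - 1 / (4 * P.s)) ^ (P.κ * P.N)) A₀ ≤ ε ∧
        ∀ A, (∀ v, A₀ v ⊆ A v ∧ A v ⊆ Finset.univ.biUnion A₀) →
          (∀ v, (A v).card < P.m * P.s) → ∀ D,
          failure (body P) ((J + 1) * stepRounds P)
            (fun v => body P (states P uid false A D v)) ≤
            β + c * forwardWeight (P.m * P.s) T α A)
    (j : ℕ) {A : Fin n → Finset (Word P.d)} (hk : (Finset.univ.biUnion A).card ≤ k)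
    (D : Finset (Word P.d)) :
    failure (body P) ((j + (J + 1)) * stepRounds P)
      (fun v => body P (states P uid true A D v)) ≤
      ENNReal.ofReal ((3 / 4) ^ j * 2 ^ ((Finset.univ.biUnion A).card / (P.m * P.s))) + β +
        j * ε := by
  induction j generalizing A D with
  | zero =>
    refine (failure_le_one _ _ _).trans (le_trans ?_ (le_self_add.trans le_self_add))
    rw [pow_zero, one_mul, ENNReal.one_le_ofReal]
    exact one_le_pow₀ (by norm_num)
  | succ j ih =>
    rw [show (j + 1 + (J + 1)) * stepRounds P = stepRounds P + (j + (J + 1)) * stepRounds P by ring]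
    by_cases hne : (Finset.univ.biUnion A).Nonempty
    swap
    · rw [failure_body_of_empty S _ _ hne]
      exact zero_le
    refine (failure_body_of_nonempty S _ _ hne D).trans ?_
    obtain ⟨T, hT, c, α, hα, hε, hA⟩ := hend A hk
    set U := Finset.univ.biUnion A with hU
    have hms : 0 < P.m * P.s := Nat.mul_pos S.m_pos S.s_pos
    set q := U.card / (P.m * P.s) with hq
    set B : ℝ≥0∞ := ENNReal.ofReal ((3 / 4) ^ (j + 1) * 2 ^ q) + β + j * ε with hB
    refine (ev_antitone _ _ (greedyRounds_le P)).trans ((ev_greedyStep S A D (hk.trans hkN) hT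
      (fun σ => failure (body P) ((j + (J + 1)) * stepRounds P) fun v => body P (σ v)) (B := B)
      (c := c) hα (fun A' hA' hcard => ?_) fun A' hA' R hR hRc => ?_).trans ?_)
    · refine (failure_antitone (body P) _
        (show (J + 1) * stepRounds P ≤ (j + (J + 1)) * stepRounds P from
          Nat.mul_le_mul_right _ (by omega))).trans ((hA A' hA' hcard D).trans ?_)
      gcongr
      rw [hB, add_right_comm]
      exact le_add_self
    · have hU' : Finset.univ.biUnion A' = U := biUnion_eq_of_between hA'
      have hqR : (U \ R).card / (P.m * P.s) + 1 = q := by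
        have h1 := Finset.card_sdiff_add_card_eq_card hR
        rw [hq, ← h1, hRc, Nat.add_div_right _ hms]
      have h1 := ih (A := fun v => A' v \ R) (by
        rw [biUnion_sdiff, hU']; exact (Finset.card_le_card Finset.sdiff_subset).trans hk) (D ∪ R)
      have h2 := ih (A := A') (by rw [hU']; exact hk) D
      rw [biUnion_sdiff, hU'] at h1
      rw [hU'] at h2
      -- Success lowers the exponent of 2 by one, so the potential is `y` after success and `2 y`
      -- after failure. Failure has probability at most `1/2`, hence the expectation is at most `y +
      -- y / 2`, which is `3/4` of the previous `2 y`.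
      set y : ℝ := (3 / 4) ^ j * 2 ^ ((U \ R).card / (P.m * P.s)) with hy
      have hy0 : 0 ≤ y := by positivity
      have e2 : (3 / 4 : ℝ) ^ j * 2 ^ (U.card / (P.m * P.s)) = y + y := by
        rw [← hq, ← hqR, pow_succ, hy]; ring
      have eB : (3 / 4 : ℝ) ^ (j + 1) * 2 ^ q = y + y / 2 := by
        rw [← hqR, pow_succ, pow_succ, hy]; ring
      rw [e2, ENNReal.ofReal_add hy0 hy0] at h2
      have herr : codingError n P.s (P.κ * P.N) ≤ ENNReal.ofReal (1 / 2) :=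
        (S.codingError_le (s_le_N P)).trans (ENNReal.ofReal_le_ofReal (by norm_num))
      refine (add_mul_tsub_mono h1 h2 (herr.trans (ENNReal.ofReal_le_one.2 (by norm_num)))).trans ?_
      calc _ ≤ (ENNReal.ofReal y + β + j * ε) + ENNReal.ofReal (1 / 2) * ENNReal.ofReal y := by
            gcongr
            rw [tsub_le_iff_right]
            apply le_of_eq
            ring
        _ = B := by
            rw [hB, eB, ENNReal.ofReal_add hy0 (by positivity), ← ENNReal.ofReal_mul (by norm_num),
              show 1 / 2 * y = y / 2 by ring]
            ring
    · calc _ ≤ B + ε := by gcongr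
        _ = _ := by rw [hB]; push_cast; ring

end PriorityForward

namespace PriorityForward

open Prog

variable {P : Params} {n : ℕ} [NeZero n] {uid : Fin n → ℕ}

/-! ## From the greedy stage to the priority stage -/

theorem Progress.mono {δ δ' : ℝ} {A : Fin n → Finset (Word P.d)} (h : Progress P δ A)
    (hδ : δ' ≤ δ) : Progress P δ' A :=
  (mul_le_mul_of_nonneg_right hδ (Nat.cast_nonneg _)).trans h

theorem failure_priority_le (S : Setting P n uid) {δ : ℝ} (hδ : δ < 1) (J : ℕ)
    {A : Fin n → Finset (Word P.d)} (hk : (Finset.univ.biUnion A).card ≤ n)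
    (hA : ∀ R, Progress P δ fun v => A v \ R) (D : Finset (Word P.d)) :
    failure (body P) ((J + 1) * stepRounds P) (fun v => body P (states P uid false A D v)) ≤
      ENNReal.ofReal (1 - δ) ^ J * ((n * n : ℕ) : ℝ≥0∞) := by
  refine (failure_priority S hδ J (hk.trans S.le_N) hA D).trans ?_
  gcongr
  exact load_le hk

/-- At the end of the greedy stage only few tokens are rare. -/
theorem exists_forwardWeight (S : Setting P n uid) {A₀ : Fin n → Finset (Word P.d)}
    (hk : (Finset.univ.biUnion A₀).card ≤ n) :
    ∃ (c : ℝ≥0∞) (α : ℝ), 0 ≤ α ∧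
      c * forwardWeight (P.m * P.s) (Finset.univ.biUnion A₀)
        (α * (1 - 1 / (4 * P.s)) ^ (P.κ * P.N)) A₀ ≤ ENNReal.ofReal (Real.exp (-n)) ∧
      ∀ A, (∀ v, A₀ v ⊆ A v ∧ A v ⊆ Finset.univ.biUnion A₀) →
        (∀ v, (A v).card < P.m * P.s) → P.s < (rare P A).card →
        1 ≤ c * forwardWeight (P.m * P.s) (Finset.univ.biUnion A₀) α A := by
  set U := Finset.univ.biUnion A₀ with hU
  have hs : (1 : ℝ) ≤ P.s := by exact_mod_cast S.s_pos
  have hs0 : (0 : ℝ) < P.s := by linarith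
  have hsN : (P.s : ℝ) ≤ P.N := by exact_mod_cast s_le_N P
  have hnN : (n : ℝ) ≤ P.N := by exact_mod_cast S.le_N
  set x : ℝ := P.N / P.s with hx
  have hx1 : 1 ≤ x := (one_le_div hs0).2 hsN
  have hxs : x * P.s = P.N := div_mul_cancel₀ _ hs0.ne'
  -- With `α = exp (3 x)`, each rare token has a factor of at least `exp (2 x)`, and more than `s`
  -- of them exceed `exp (2 N)`, cancelling `c`. The forwarding rounds bring `α` below 1, so the
  -- initial product is at most `exp N` and `exp (-N)` is left.
  refine ⟨ENNReal.ofReal (Real.exp (-(2 * P.N))), Real.exp (3 * x), (Real.exp_pos _).le, ?_, ?_⟩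
  · have hp : 0 ≤ 1 - 1 / (4 * (P.s : ℝ)) := by
      rw [sub_nonneg, div_le_one (by positivity)]; linarith
    have h1 : Real.exp (3 * x) * (1 - 1 / (4 * P.s)) ^ (P.κ * P.N) ≤ 1 := by
      calc Real.exp (3 * x) * (1 - 1 / (4 * P.s)) ^ (P.κ * P.N)
          ≤ Real.exp (3 * x) * (1 - 1 / (4 * P.s)) ^ (64 * P.N) := by
            gcongr Real.exp (3 * x) * ?_
            refine pow_le_pow_of_le_one hp ?_ (Nat.mul_le_mul_right _ S.le_κ)
            linarith [show 0 ≤ 1 / (4 * (P.s : ℝ)) by positivity]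
        _ ≤ Real.exp (3 * x) * Real.exp (-(1 / (4 * P.s))) ^ (64 * P.N) := by
            gcongr
            exact Real.one_sub_le_exp_neg _
        _ = Real.exp (3 * x - 16 * x) := by
            rw [← Real.exp_nat_mul, ← Real.exp_add]
            congr 1
            rw [hx]
            push_cast
            field_simp
            ring
        _ ≤ 1 := Real.exp_le_one_iff.2 (by linarith)
    have h2 : forwardWeight (P.m * P.s) U
        (Real.exp (3 * x) * (1 - 1 / (4 * P.s)) ^ (P.κ * P.N)) A₀ ≤
        ENNReal.ofReal (Real.exp P.N) := by
      rw [forwardWeight]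
      split_ifs
      swap
      · exact zero_le
      refine ENNReal.ofReal_le_ofReal ?_
      calc _ ≤ ∏ t ∈ U, Real.exp 1 := by
            refine Finset.prod_le_prod (fun t _ => ?_) fun t _ => ?_
            · have := spreadWeight_nonneg (D := knowers A₀ t)
              positivity
            · have h3 := spreadWeight_le_one (D := knowers A₀ t)
              have h4 := spreadWeight_nonneg (D := knowers A₀ t)
              have h5 := mul_le_one₀ h1 h4 h3
              have h6 := Real.add_one_le_exp (1 : ℝ)
              linarith
        _ = Real.exp U.card := by
            rw [Finset.prod_const, ← Real.exp_nat_mul, mul_one]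
        _ ≤ Real.exp P.N := by
            gcongr
            exact_mod_cast hk.trans S.le_N
    refine (mul_le_mul_right h2 _).trans ?_
    rw [← ENNReal.ofReal_mul (Real.exp_pos _).le, ← Real.exp_add]
    refine ENNReal.ofReal_le_ofReal (Real.exp_le_exp.2 ?_)
    linarith
  · intro A hA hcard hrare
    have hAU : Finset.univ.biUnion A = U := biUnion_eq_of_between hA
    rw [forwardWeight, if_pos fun v => (hcard v).le, ← ENNReal.ofReal_mul (Real.exp_pos _).le,
      ENNReal.one_le_ofReal]
    have hterm : ∀ t, 1 ≤ 1 + Real.exp (3 * x) * spreadWeight (knowers A t) := fun t => by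
      have := mul_nonneg (Real.exp_pos (3 * x)).le (spreadWeight_nonneg (D := knowers A t))
      linarith
    have hr : ∀ t ∈ rare P A,
        Real.exp (2 * x) ≤ 1 + Real.exp (3 * x) * spreadWeight (knowers A t) := by
      intro t ht
      have h1 := (Finset.mem_filter.1 ht).2
      have hne : knowers A t ≠ Finset.univ := by
        intro h
        rw [h, Finset.card_univ, Fintype.card_fin] at h1
        exact absurd h1 (not_lt.2 (Nat.le_mul_of_pos_right _ S.s_pos))
      have hc : ((knowers A t).card : ℝ) ≤ x := by
        rw [hx, le_div_iff₀ hs0]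
        have : ((knowers A t).card : ℝ) * P.s ≤ n := by exact_mod_cast h1.le
        linarith
      have hw : Real.exp (-x) ≤ spreadWeight (knowers A t) := by
        rw [spreadWeight, if_neg hne]
        calc Real.exp (-x) ≤ Real.exp (-((knowers A t).card : ℝ)) := by gcongr
          _ = Real.exp (-1) ^ (knowers A t).card := by rw [← Real.exp_nat_mul]; ring_nf
          _ ≤ (1 / 2) ^ (knowers A t).card := by
              gcongr
              rw [Real.exp_neg, one_div]
              have := Real.add_one_le_exp (1 : ℝ)
              gcongr
              linarith
      calc Real.exp (2 * x) = Real.exp (3 * x) * Real.exp (-x) := by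
            rw [← Real.exp_add]; ring_nf
        _ ≤ Real.exp (3 * x) * spreadWeight (knowers A t) := by gcongr
        _ ≤ _ := by linarith
    have hsub : rare P A ⊆ U := hAU ▸ Finset.filter_subset _ _
    have hprod : Real.exp (2 * P.N) ≤
        ∏ t ∈ U, (1 + Real.exp (3 * x) * spreadWeight (knowers A t)) := by
      calc Real.exp (2 * P.N) = Real.exp (2 * x) ^ P.s := by
            rw [← Real.exp_nat_mul, ← hxs]; ring_nf
        _ ≤ Real.exp (2 * x) ^ (rare P A).card :=
            pow_le_pow_right₀ (Real.one_le_exp (by linarith)) hrare.le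
        _ ≤ ∏ t ∈ rare P A, (1 + Real.exp (3 * x) * spreadWeight (knowers A t)) := by
            rw [← Finset.prod_const]
            exact Finset.prod_le_prod (fun _ _ => (Real.exp_pos _).le) hr
        _ ≤ _ := by
            rw [← Finset.prod_sdiff hsub]
            refine le_mul_of_one_le_left ?_ ?_
            · exact Finset.prod_nonneg fun t _ => zero_le_one.trans (hterm t)
            · simpa using Finset.prod_le_prod (s := U \ rare P A) (f := fun _ => (1 : ℝ))
                (fun _ _ => zero_le_one) fun t _ => hterm t
    calc (1 : ℝ) = Real.exp (-(2 * P.N)) * Real.exp (2 * P.N) := by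
          rw [← Real.exp_add]; simp
      _ ≤ _ := by gcongr

/-- The failure probability, bounded in terms of the numbers of greedy steps and of iterations. -/
theorem failure_le (S : Setting P n uid) {tokens : Fin n → Finset (Word P.d)} {k : ℕ}
    (hk : (Finset.univ.biUnion tokens).card = k) (hkn : k ≤ n) {δ ε : ℝ} (hδ1 : δ < 1)
    (h : δ ≤ 1 / 2 ^ 26 / (1 + k / (P.m * P.s)) ∧ Real.exp (-n) ≤ ε ∨
      δ ≤ 1 / 2 ^ 22 * (1 / (n : ℝ) ^ 2) ∧ 0 ≤ ε) (j J : ℕ) :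
    failure (body P) ((j + (J + 1)) * stepRounds P)
      (fun v => body P (states P uid true tokens ∅ v)) ≤
      ENNReal.ofReal ((3 / 4) ^ j * 2 ^ (k / (P.m * P.s)) + (1 - δ) ^ J * n ^ 2 + j * ε) := by
  have hend := failure_greedy (P := P) (uid := uid) S (J := J) (hkn.trans S.le_N)
    (β := ENNReal.ofReal (1 - δ) ^ J * ((n * n : ℕ) : ℝ≥0∞)) (ε := ENNReal.ofReal ε)
    (fun A₀ hA₀ => ?_) j (A := tokens) hk.le ∅
  · refine hend.trans (le_of_eq ?_)
    have hε : 0 ≤ ε := h.elim (fun h => (Real.exp_pos _).le.trans h.2) fun h => h.2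
    have hδ0 : 0 ≤ 1 - δ := by linarith
    rw [hk, ENNReal.ofReal_add (by positivity) (by positivity),
      ENNReal.ofReal_add (by positivity) (by positivity), ENNReal.ofReal_mul (by positivity)
        (q := (n : ℝ) ^ 2), ENNReal.ofReal_pow hδ0, ENNReal.ofReal_mul (Nat.cast_nonneg j),
      ENNReal.ofReal_natCast, ENNReal.ofReal_pow (Nat.cast_nonneg n), ENNReal.ofReal_natCast]
    push_cast
    ring
  · have hU : ∀ A : Fin n → Finset (Word P.d),
        (∀ v, A₀ v ⊆ A v ∧ A v ⊆ Finset.univ.biUnion A₀) → (Finset.univ.biUnion A).card ≤ k :=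
      fun A hA => by rw [biUnion_eq_of_between hA]; exact hA₀
    have hsd : ∀ (A : Fin n → Finset (Word P.d)) R, (Finset.univ.biUnion A).card ≤ k →
        (Finset.univ.biUnion fun v => A v \ R).card ≤ k := fun A R hA => by
      rw [biUnion_sdiff]
      exact (Finset.card_le_card Finset.sdiff_subset).trans hA
    -- In the first regime an excess of rare tokens is charged to the potential of
    -- `exists_forwardWeight`; in the second no preparation is needed and the potential is zero.
    rcases h with ⟨hδ, hε⟩ | ⟨hδ, -⟩
    · obtain ⟨c, α, hα, h1, h2⟩ := exists_forwardWeight S (hA₀.trans hkn)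
      refine ⟨_, subset_rfl, c, α, hα, h1.trans (ENNReal.ofReal_le_ofReal hε),
        fun A hA hcard D => ?_⟩
      by_cases hrare : (rare P A).card ≤ P.s
      · refine (failure_priority_le S hδ1 J ((hU A hA).trans hkn) (fun R => ?_) D).trans le_self_add
        exact (progress_of_rare S (hsd A R (hU A hA)) ((Finset.card_le_card
          (rare_sdiff_subset A R)).trans hrare)).mono hδ
      · exact (failure_le_one _ _ _).trans ((h2 A hA hcard (not_le.1 hrare)).trans le_add_self)
    · refine ⟨∅, Finset.empty_subset _, 0, 0, le_rfl, by simp, fun A hA hcard D => ?_⟩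
      refine (failure_priority_le S hδ1 J ((hU A hA).trans hkn) (fun R => ?_) D).trans le_self_add
      exact (progress_trivial S ((hsd A R (hU A hA)).trans hkn)).mono hδ

end PriorityForward

namespace PriorityForward

open Prog

/-! ## The number of rounds -/

/-- For large `n` this absorbs the error `exp (-n)` of each of the at most `(4 c + 13) n` greedy
steps into `n^(-(c + 2))`. -/
theorem exists_mul_pow_le_exp (c : ℕ) :
    ∃ n₀ : ℕ, 1 ≤ n₀ ∧ ∀ n : ℕ, n₀ ≤ n →
      (4 * c + 13) * (n : ℝ) ^ (c + 3) * Real.exp (-n) ≤ 1 := by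
  have h := (Real.tendsto_pow_mul_exp_neg_atTop_nhds_zero (c + 3)).comp
    (tendsto_natCast_atTop_atTop (R := ℝ))
  have hpos : (0 : ℝ) < 4 * c + 13 := by positivity
  obtain ⟨n₀, hn₀⟩ := Filter.eventually_atTop.1
    (h.eventually (ge_mem_nhds (show (0 : ℝ) < 1 / (4 * c + 13) by positivity)))
  refine ⟨max 1 n₀, le_max_left _ _, fun n hn => ?_⟩
  have := hn₀ n ((le_max_right _ _).trans hn)
  simp only [Function.comp_apply] at this
  rw [le_div_iff₀ hpos] at this
  linarith

variable {P : Params} {n : ℕ} {uid : Fin n → ℕ}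

/-- Rounding down costs a factor 2 in `m ≥ b / (2 max d 1)`. For `d = 0` there is only one word, so
`k ≤ 1`; if `s = N` instead of `b`, the quotient is at most 1 because `k ≤ N`. -/
theorem batches_le (S : Setting P n uid) {k : ℕ} (hkn : k ≤ n) (hk : k ≤ 2 ^ P.d) :
    (k : ℝ) / (P.m * P.s) ≤ 2 + 2 * (k * P.d / P.b ^ 2) := by
  have hb : (1 : ℝ) ≤ P.b := by exact_mod_cast S.one_le_b
  have hm1 : 1 ≤ P.m := Nat.div_pos (max_le S.d_le S.one_le_b) (by omega)
  have hm : (1 : ℝ) ≤ P.m := by exact_mod_cast hm1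
  have h0 : 0 ≤ 2 * ((k : ℝ) * P.d / P.b ^ 2) := by positivity
  rcases le_total P.b P.N with h | h
  · rw [Params.s, min_eq_left h]
    have h1 : P.b ≤ 2 * (P.m * max P.d 1) := by
      have h2 : P.b < (P.m + 1) * max P.d 1 := by
        have := Nat.lt_div_mul_add (a := P.b) (show 0 < max P.d 1 by omega)
        rw [Nat.add_mul, one_mul]
        exact this
      have h3 : (P.m + 1) * max P.d 1 ≤ (2 * P.m) * max P.d 1 :=
        Nat.mul_le_mul_right _ (by omega)
      rw [mul_assoc] at h3
      omega
    have h1' : (P.b : ℝ) ≤ 2 * (P.m * max P.d 1 : ℕ) := by exact_mod_cast h1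
    have h4 : (k : ℝ) * (max P.d 1 : ℕ) ≤ k * P.d + 1 := by
      rcases Nat.eq_zero_or_pos P.d with hd | hd
      · rw [hd, pow_zero] at hk
        rw [hd]
        have : (k : ℝ) ≤ 1 := by exact_mod_cast hk
        simpa using this
      · rw [max_eq_left hd]
        linarith
    have h5 : (k : ℝ) / (P.m * P.b) ≤ 2 * (k * (max P.d 1 : ℕ)) / P.b ^ 2 := by
      rw [div_le_div_iff₀ (by positivity) (by positivity)]
      push_cast at h1' ⊢
      calc (k : ℝ) * P.b ^ 2 = k * P.b * P.b := by ring
        _ ≤ k * P.b * (2 * (P.m * max (P.d : ℝ) 1)) := by gcongr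
        _ = _ := by ring
    refine h5.trans ?_
    calc 2 * ((k : ℝ) * (max P.d 1 : ℕ)) / (P.b : ℝ) ^ 2
        ≤ 2 * (k * P.d + 1) / (P.b : ℝ) ^ 2 := by gcongr
      _ = 2 * (k * P.d / (P.b : ℝ) ^ 2) + 2 / (P.b : ℝ) ^ 2 := by ring
      _ ≤ _ := by
          have : 2 / (P.b : ℝ) ^ 2 ≤ 2 := div_le_self (by norm_num) (one_le_pow₀ hb)
          linarith
  · rw [Params.s, min_eq_right h]
    have hN : (1 : ℝ) ≤ P.N := by
      have h1 := S.two_le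
      have h2 := S.le_N
      exact_mod_cast (by omega : 1 ≤ P.N)
    have hkN : (k : ℝ) ≤ P.N := by exact_mod_cast hkn.trans S.le_N
    have : (k : ℝ) / (P.m * P.N) ≤ 1 := by
      rw [div_le_one (by positivity)]
      nlinarith
    linarith

theorem steps_le {c δ l r j J : ℝ} (hc : 0 ≤ c) (hδ : 0 < δ) (hl : 1 / 2 ≤ l) (hr : 0 ≤ r)
    (hj : j ≤ 4 * (r + (c + 2) * l) + 1) (hJ : J ≤ (c + 4) * l / (δ / (1 + r)) + 1) :
    j + (J + 1) ≤ (4 * c + 22 + (c + 4) / δ) * (l * (1 + r)) := by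
  have h3 : (c + 4) * l / (δ / (1 + r)) = (c + 4) / δ * (l * (1 + r)) := by field_simp
  have h4 : l ≤ l * (1 + r) := le_mul_of_one_le_right (by linarith) (by linarith)
  have h5 : 1 / 2 * (1 + r) ≤ l * (1 + r) := mul_le_mul_of_nonneg_right hl (by linarith)
  have h7 : (c + 2) * l ≤ (c + 2) * (l * (1 + r)) :=
    mul_le_mul_of_nonneg_left h4 (by linarith)
  rw [h3] at hJ
  calc j + (J + 1) ≤ 4 * (2 * (l * (1 + r)) + (c + 2) * (l * (1 + r))) + 3 * (2 * (l * (1 + r))) +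
            (c + 4) / δ * (l * (1 + r)) := by linarith
    _ = (4 * c + 22 + (c + 4) / δ) * (l * (1 + r)) := by ring

set_option maxHeartbeats 800000 in
/-- With high probability the algorithm terminates within the claimed number of rounds. -/
theorem exists_failure_le (c : ℕ) : ∃ C : ℝ, ∀ (P : Params) (n : ℕ) [NeZero n] (uid : Fin n → ℕ)
    (_ : Setting P n uid) (_ : P.κ = 64) (tokens : Fin n → Finset (Word P.d)) (k : ℕ)
    (_ : (Finset.univ.biUnion tokens).card = k) (_ : k ≤ n) (t : ℕ),
    C * (Real.log n / P.b * (n * k * P.d / P.b) + n * Real.log n) ≤ t →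
    failure (body P) t (fun v => body P (states P uid true tokens ∅ v)) ≤
      ((n : ℝ≥0∞) ^ c)⁻¹ := by
  obtain ⟨n₀, hn₀1, hn₀⟩ := exists_mul_pow_le_exp c
  -- One rate for both regimes: the first entry for `n ≥ n₀`, the second for `n ≤ n₀`.
  set δ₁ : ℝ := min (1 / 2 ^ 26) (1 / 2 ^ 22 * (1 / (n₀ : ℝ) ^ 2)) with hδ₁
  have hn₀' : (0 : ℝ) < n₀ := by exact_mod_cast hn₀1
  have hδ₁0 : 0 < δ₁ := lt_min (by norm_num) (by positivity)
  set C₀ : ℝ := 4 * c + 22 + (c + 4) / δ₁ with hC₀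
  have hC₀0 : 0 < C₀ := by positivity
  -- `1176 = 3 * 392`: a step takes `196 N ≤ 392 n` rounds, and `1 + r ≤ 3 (1 + k d / b²)`.
  refine ⟨1176 * C₀, fun P n _ uid S hκ tokens k hk hkn t ht => ?_⟩
  have hn2 : (2 : ℝ) ≤ n := by exact_mod_cast S.two_le
  have hn0 : (0 : ℝ) < n := by linarith
  set l := Real.log n with hl
  have hl2 : 1 / 2 ≤ l := by
    have h1 : Real.log 2 ≤ l := Real.log_le_log (by norm_num) hn2
    linarith [Real.log_two_gt_d9]
  have hexpl : Real.exp l = n := Real.exp_log hn0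
  have hln : l ≤ n := (Real.log_le_self hn0.le)
  set r : ℝ := k / (P.m * P.s) with hr
  have hr0 : 0 ≤ r := by positivity
  have hms : 0 < P.m * P.s := Nat.mul_pos S.m_pos S.s_pos
  have hrn : r ≤ n := by
    have h1 : (1 : ℝ) ≤ P.m * P.s := by exact_mod_cast hms
    have h2 : (k : ℝ) ≤ n := by exact_mod_cast hkn
    exact (div_le_self (Nat.cast_nonneg k) h1).trans h2
  have hr2 : r ≤ 2 + 2 * (k * P.d / P.b ^ 2) := by
    refine batches_le S hkn ?_
    rw [← hk]
    exact (Finset.card_le_univ _).trans (by rw [Fintype.card_fin])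
  set ρ := 1 + r with hρ
  have hρ1 : 1 ≤ ρ := by linarith
  set δ := δ₁ / ρ with hδ
  have hδ0 : 0 < δ := by positivity
  have hδδ₁ : δ ≤ δ₁ := div_le_self hδ₁0.le hρ1
  have hδ1 : δ < 1 := hδδ₁.trans_lt ((min_le_left _ _).trans_lt (by norm_num))
  -- As `3/4 ≤ exp (-1/4)`, this `j` beats the initial potential `2^r ≤ exp r` down to `n^(-(c +
  -- 2))`. Likewise `J` reduces the initial load of at most `n²` to `n^(-(c + 2))`.
  set j := ⌈4 * (r + (c + 2) * l)⌉₊ with hj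
  set J := ⌈(c + 4) * l / δ⌉₊ with hJ
  have hj1 : 4 * (r + (c + 2) * l) ≤ j := Nat.le_ceil _
  have hj2 : (j : ℝ) < 4 * (r + (c + 2) * l) + 1 := Nat.ceil_lt_add_one (by positivity)
  have hJ1 : (c + 4) * l / δ ≤ J := Nat.le_ceil _
  have hJ2 : (J : ℝ) < (c + 4) * l / δ + 1 := Nat.ceil_lt_add_one (by positivity)
  set η := Real.exp (-((c + 2) * l)) with hη
  have hη0 : 0 < η := Real.exp_pos _
  have hηn : η * n ^ (c + 2) = 1 := by
    rw [← hexpl, ← Real.exp_nat_mul, hη, ← Real.exp_add]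
    push_cast
    simp
  -- the greedy stage
  have b₁ : (3 / 4 : ℝ) ^ j * 2 ^ (k / (P.m * P.s)) ≤ η := by
    have h1 : (3 / 4 : ℝ) ^ j ≤ Real.exp (-(r + (c + 2) * l)) := by
      calc (3 / 4 : ℝ) ^ j ≤ Real.exp (-(1 / 4)) ^ j := by
            gcongr
            linarith [Real.one_sub_le_exp_neg (1 / 4)]
        _ = Real.exp (j * -(1 / 4)) := (Real.exp_nat_mul _ _).symm
        _ ≤ _ := by gcongr; linarith
    have h2 : (2 : ℝ) ^ (k / (P.m * P.s)) ≤ Real.exp r := by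
      have h3 : ((k / (P.m * P.s) : ℕ) : ℝ) ≤ r := by
        rw [hr]
        exact_mod_cast Nat.cast_div_le (α := ℝ) (m := k) (n := P.m * P.s)
      calc (2 : ℝ) ^ (k / (P.m * P.s)) ≤ Real.exp 1 ^ (k / (P.m * P.s)) := by
            gcongr
            linarith [Real.add_one_le_exp (1 : ℝ)]
        _ = Real.exp (k / (P.m * P.s) : ℕ) := by rw [← Real.exp_nat_mul, mul_one]
        _ ≤ Real.exp r := Real.exp_le_exp.2 h3
    calc _ ≤ Real.exp (-(r + (c + 2) * l)) * Real.exp r := by gcongr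
      _ = η := by rw [← Real.exp_add, hη]; ring_nf
  -- the priority stage
  have b₂ : (1 - δ) ^ J * (n : ℝ) ^ 2 ≤ η := by
    have h1 : (1 - δ) ^ J ≤ Real.exp (-((c + 4) * l)) := by
      calc (1 - δ) ^ J ≤ Real.exp (-δ) ^ J :=
            pow_le_pow_left₀ (by linarith) (Real.one_sub_le_exp_neg δ) _
        _ = Real.exp (J * -δ) := (Real.exp_nat_mul _ _).symm
        _ ≤ _ := by
            gcongr
            rw [div_le_iff₀ hδ0] at hJ1
            linarith
    calc (1 - δ) ^ J * (n : ℝ) ^ 2 ≤ Real.exp (-((c + 4) * l)) * (n : ℝ) ^ 2 := by gcongr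
      _ = η := by
          rw [← hexpl, ← Real.exp_nat_mul, ← Real.exp_add, hη]
          push_cast
          ring_nf
  have hrate : ∃ ε : ℝ, (δ ≤ 1 / 2 ^ 26 / ρ ∧ Real.exp (-n) ≤ ε ∨
      δ ≤ 1 / 2 ^ 22 * (1 / (n : ℝ) ^ 2) ∧ 0 ≤ ε) ∧ j * ε ≤ η := by
    rcases le_total n₀ n with h | h
    · refine ⟨Real.exp (-n), Or.inl ⟨?_, le_rfl⟩, ?_⟩
      · exact div_le_div_of_nonneg_right (min_le_left _ _) (by linarith)
      · have h1 : (j : ℝ) ≤ (4 * c + 13) * n := by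
          have : ((c : ℝ) + 2) * l ≤ (c + 2) * n := by gcongr
          nlinarith
        have h2 := hn₀ n h
        have h3 : 0 < (n : ℝ) ^ (c + 2) := by positivity
        refine le_of_mul_le_mul_right (a := (n : ℝ) ^ (c + 2)) ?_ h3
        rw [hηn]
        calc j * Real.exp (-n) * (n : ℝ) ^ (c + 2)
            ≤ (4 * c + 13) * n * Real.exp (-n) * (n : ℝ) ^ (c + 2) := by gcongr
          _ = (4 * c + 13) * (n : ℝ) ^ (c + 3) * Real.exp (-n) := by ring
          _ ≤ 1 := h2
    · refine ⟨0, Or.inr ⟨?_, le_rfl⟩, by rw [mul_zero]; exact hη0.le⟩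
      refine hδδ₁.trans ((min_le_right _ _).trans ?_)
      have : (n : ℝ) ≤ n₀ := by exact_mod_cast h
      gcongr
  obtain ⟨ε, hε, b₃⟩ := hrate
  have hround : (j + (J + 1)) * stepRounds P ≤ t := by
    have h1 : (stepRounds P : ℝ) ≤ 392 * n := by
      have e : stepRounds P = 196 * P.N := by
        rw [stepRounds, iterationRounds, hκ]; ring
      have := S.N_le
      rw [e]
      exact_mod_cast (by omega : 196 * P.N ≤ 392 * n)
    have h2 : (j : ℝ) + (J + 1) ≤ C₀ * (l * ρ) :=
      steps_le (Nat.cast_nonneg c) hδ₁0 hl2 hr0 hj2.le hJ2.le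
    have h8 : ρ ≤ 3 * (1 + k * P.d / P.b ^ 2) := by
      have : 0 ≤ (k : ℝ) * P.d / P.b ^ 2 := by positivity
      rw [hρ]; linarith
    have h9 : (((j + (J + 1)) * stepRounds P : ℕ) : ℝ) ≤ t := by
      push_cast
      refine le_trans ?_ ht
      calc ((j : ℝ) + (J + 1)) * stepRounds P ≤ C₀ * (l * ρ) * (392 * n) := by gcongr
        _ ≤ C₀ * (l * (3 * (1 + k * P.d / P.b ^ 2))) * (392 * n) := by gcongr
        _ = _ := by
            have hb : (P.b : ℝ) ≠ 0 := by exact_mod_cast (by have := S.one_le_b; omega : P.b ≠ 0)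
            field_simp
            ring
    exact_mod_cast h9
  refine (failure_antitone (body P) _ hround).trans ((failure_le S hk hkn hδ1 hε j J).trans ?_)
  -- Three errors of size `η = n^(-(c + 2))` are added; the two spare powers of `n ≥ 2` absorb the
  -- factor 3.
  have hηc : 3 * η * n ^ c ≤ 1 := by
    have h1 : (4 : ℝ) ≤ (n : ℝ) ^ 2 := by nlinarith
    have h2 : η * n ^ c * n ^ 2 = 1 := by rw [mul_assoc, ← pow_add]; exact hηn
    have h3 : 0 ≤ η * (n : ℝ) ^ c := by positivity
    nlinarith
  rw [← ENNReal.ofReal_natCast, ← ENNReal.ofReal_pow hn0.le,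
    ← ENNReal.ofReal_inv_of_pos (by positivity)]
  refine ENNReal.ofReal_le_ofReal ?_
  rw [← one_div, le_div_iff₀ (by positivity)]
  refine le_trans ?_ hηc
  gcongr
  linarith

end PriorityForward

end

/-! ### Assembly of message size, correctness and running time -/

theorem theorem10 :
    ∃ κ : ℕ, ∀ a : ℕ, ∃ A : ℕ, ∀ c : ℕ, ∃ C : ℝ,
      ∀ (n N b d k : ℕ), 2 ≤ n → n ≤ N → N ≤ 2 * n →
        Real.log n ^ 3 ≤ b → d ≤ b → k ≤ n →
      ∀ (uid : Fin n → ℕ), Function.Injective uid → (∀ v, uid v < n ^ a) →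
      ∀ (tokens : Fin n → Finset (Word d)), (Finset.univ.biUnion tokens).card = k →
      ∀ (adv : (priorityForward ⟨N, b, d, a, κ⟩).Adversary n),
        (∀ h σ, (adv h σ).Connected) →
      -- messages have `O(b)` bits
      (∀ t, ∀ x ∈ ((priorityForward ⟨N, b, d, a, κ⟩).exec
            (fun v => (uid v, tokens v)) adv t).support,
          ∀ act ∈ x.1, ∀ v, (act v).1.length ≤ A * b) ∧
      -- whenever a node terminates, it outputs the set of all tokens
      (∀ t, ∀ x ∈ ((priorityForward ⟨N, b, d, a, κ⟩).exec
            (fun v => (uid v, tokens v)) adv t).support,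
          ∀ v o, (priorityForward ⟨N, b, d, a, κ⟩).output (x.2 v) = some o →
            o = Finset.univ.biUnion tokens) ∧
      -- with high probability all nodes terminate within the claimed number of rounds
      (∀ t : ℕ, C * (Real.log n / b * (n * k * d / b) + n * Real.log n) ≤ t →
        ((priorityForward ⟨N, b, d, a, κ⟩).exec
            (fun v => (uid v, tokens v)) adv t).toOuterMeasure
          {x | ¬ ∀ v, ((priorityForward ⟨N, b, d, a, κ⟩).output (x.2 v)).isSome} ≤
            ((n : ENNReal) ^ c)⁻¹) := by
  -- `64` repetitions suffice for all constant-probability bounds; the second witness is the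
  -- constant of `short_body`.
  refine ⟨64, fun a => ⟨64 * (10 + a) + 2, fun c => ?_⟩⟩
  obtain ⟨C, hC⟩ := PriorityForward.exists_failure_le c
  refine ⟨C, fun n N b d k hn hnN hN hb hd hk uid hinj huid tokens htok adv hadv => ?_⟩
  have : NeZero n := ⟨by omega⟩
  have S : PriorityForward.Setting ⟨N, b, d, a, 64⟩ n uid :=
    PriorityForward.setting_of_log_le hn hnN hN hb hd hinj huid le_rfl
  refine ⟨fun t x hx act hact v => ?_, fun t x hx v o ho => ?_, fun t ht => ?_⟩
  · exact Prog.length_le_of_mem_support_exec _ _ _ (PriorityForward.short_body S) _ adv t x hx act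
      hact v
  · exact PriorityForward.output_eq S tokens (htok.le.trans (hk.trans hnN)) adv hadv t x hx v o ho
  · exact (Prog.exec_loop_le_failure _ _ _ adv hadv t).trans
      (hC ⟨N, b, d, a, 64⟩ n uid S rfl tokens k htok hk t ht)
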